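/- **Theorem (Uniqueness of equivariant tubular neighborhoods).** Let $G$ be a compact Lie group, $M$ and $P$ smooth $G$-manifolds (finite-dimensional, Hausdorff, second countable, without boundary), $S\subset M$ a closed $G$-invariant smooth submanifold, and $f:M\to P$ a $G$-equivariant smooth map such that $f|_S:S\to P$ is a submersion. A *$G$-equivariant tubular neighborhood* of $S$ in $M$ is a triple $\mathsf T=(E,\varepsilon,\varphi)$ where $\pi_E:E\to S$ is a smooth $G$-vector bundle with a smooth $G$-invariant inner product $\langle-,-\rangle$, $\varepsilon:S\to(0,\infty)$ is a smooth $G$-invariant function, and $\varphi$ is a $G$-equivariant diffeomorphism from $B(\varepsilon,E)=\{v\in E\mid\langle v,v\rangle<\varepsilon(\pi_E(v))\}$ onto an open neighborhood $T_S$ of $S$ in $M$ whose composition with the zero section is the inclusion $S\hookrightarrow M$. It is *compatible with $f$* if $f\circ\pi_E\circ\varphi^{-1}=f|_{T_S}$. For $X\subset S$, a *($G$-equivariant) isomorphism* $\psi:\mathsf T|_X\to\mathsf T'|_X$ is a smooth $G$-equivariant isometric vector bundle isomorphism $\psi:E|_X\to E'|_X$ over $\mathrm{id}_X$ for which there is a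 continuous $\delta:X\to(0,\infty)$ with $\delta\le\min(\varepsilon,\varepsilon')$ and $\varphi'\circ\psi=\varphi$ on $B(\delta,E|_X)$ (smooth on a non-open $X$ means: locally extendable to a smooth map). If $h:M\to M$ is a $G$-equivariant diffeomorphism that restricts to the identity on $S$, then $h_*\mathsf T=(E,\varepsilon,h\circ\varphi)$. A *$G$-equivariant diffeotopy* of $M$ is a smooth map $H:M\times[0,1]\to M$ such that $H_0=\mathrm{id}_M$ and every $H_t=H(-,t)$ is a $G$-equivariant diffeomorphism; its support is $\overline{\{x\mid\exists t:\ H_t(x)\ne x\}}$, and it is *compatible with $f$* if $f\circ H_t=f$ for all $t$. Let $\mathsf T_0,\mathsf T_1$ be two $G$-equivariant tubular neighborhoods of $S$ in $M$, both compatible with $f$, let $U\subset S$ be $G$-invariant and relatively open, and let $\psi_0:\mathsf T_0|_U\to\mathsf T_1|_U$ be a $G$-equivariant isomorphism. Let $A,Z\subset S$ be $G$-invariant relatively closed subsets with $A\subset U$, let $V\subset M$ be a $G$-invariant open neighborhood of $Z$ in $M$, and let $O\subset M\times M$ be a $G$-invariant neighborhood of the diagonal. Then there exist a $G$-equivariant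 diffeotopy $H:M\times[0,1]\to M$ which leaves $S$ pointwise fixed (in particular invariant), is compatible with $f$, has support contained in $V\setminus A$ and satisfies $(H_t(x),x)\in O$ for all $t\in[0,1]$ and $x\in M$, and a $G$-equivariant isomorphism $$\psi:\big((H_1)_*\mathsf T_0\big)|_{A\cup Z}\longrightarrow\mathsf T_1|_{A\cup Z}\qquad\text{with}\qquad \psi|_A=\psi_0|_A .$$ -/

import Mathlib

open Set Topology Manifold Bundle
open scoped ContDiff

noncomputable section

/-- `E → S` is a smooth `G`-vector bundle: the Lie group `G` (modelled on `EG`) acts smoothly on the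
total space, covering the action on the base, and linearly from fibre to fibre. -/
class IsGVectorBundle (EG ES : Type*) [NormedAddCommGroup EG] [NormedSpace ℝ EG]
    [NormedAddCommGroup ES] [NormedSpace ℝ ES]
    (G : Type*) [Group G] [TopologicalSpace G] [ChartedSpace EG G]
    {S : Type*} [TopologicalSpace S] [ChartedSpace ES S] [MulAction G S]
    (F : Type*) [NormedAddCommGroup F] [NormedSpace ℝ F]
    (E : S → Type*) [TopologicalSpace (TotalSpace F E)]
    [∀ x, AddCommGroup (E x)] [∀ x, Module ℝ (E x)] [∀ x, TopologicalSpace (E x)]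
    [FiberBundle F E] [MulAction G (TotalSpace F E)] : Prop where
  smul_linear : ∀ (g : G) (x : S), ∃ L : E x →ₗ[ℝ] E (g • x),
    ∀ v : E x, g • (⟨x, v⟩ : TotalSpace F E) = ⟨g • x, L v⟩
  contMDiff_smul : ContMDiff ((𝓘(ℝ, EG)).prod ((𝓘(ℝ, ES)).prod 𝓘(ℝ, F)))
    ((𝓘(ℝ, ES)).prod 𝓘(ℝ, F)) ∞ (fun p : G × TotalSpace F E => p.1 • p.2)

section Tubular

variable (G : Type*) [Group G]
  (EM : Type*) [NormedAddCommGroup EM] [NormedSpace ℝ EM]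
  (ES : Type*) [NormedAddCommGroup ES] [NormedSpace ℝ ES]
  {M : Type*} [TopologicalSpace M] [ChartedSpace EM M] [MulAction G M]
  (S : SubMulAction G M) [ChartedSpace ES S] [IsManifold 𝓘(ℝ, ES) ∞ S]
  (F : Type*) [NormedAddCommGroup F] [NormedSpace ℝ F]
  (E : S → Type*) [TopologicalSpace (TotalSpace F E)]
  [∀ x, AddCommGroup (E x)] [∀ x, Module ℝ (E x)] [∀ x, TopologicalSpace (E x)]
  [∀ x, IsTopologicalAddGroup (E x)] [∀ x, ContinuousConstSMul ℝ (E x)]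
  [FiberBundle F E] [VectorBundle ℝ F E] [MulAction G (TotalSpace F E)]

/-- A `G`-equivariant tubular neighbourhood `(E, ε, φ)` of the `G`-invariant submanifold `S` of `M`,
with underlying `G`-vector bundle `E → S` (whose axioms are `IsGVectorBundle`): a smooth
`G`-invariant inner product on `E`, a smooth `G`-invariant function `ε : S → (0, ∞)`, and a
`G`-equivariant diffeomorphism `φ` from `B(ε, E) = {v | ⟨v, v⟩ < ε (π v)}` onto an open subset of
`M`, restricting to the inclusion of `S` on the zero section. -/
structure TubularNeighborhood where
  metric : ContMDiffRiemannianMetric 𝓘(ℝ, ES) ∞ F E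
  /-- Invariance of the quadratic form; by polarization, that of the inner product. -/
  metric_smul : ∀ (g : G) (v : TotalSpace F E),
    metric.inner (g • v).proj (g • v).snd (g • v).snd = metric.inner v.proj v.snd v.snd
  ε : S → ℝ
  ε_pos : ∀ x, 0 < ε x
  ε_smooth : ContMDiff 𝓘(ℝ, ES) 𝓘(ℝ, ℝ) ∞ ε
  ε_smul : ∀ (g : G) (x : S), ε (g • x) = ε x
  φ : OpenPartialHomeomorph (TotalSpace F E) M
  φ_source : φ.source = {v | metric.inner v.proj v.snd v.snd < ε v.proj}
  φ_smooth : ContMDiffOn ((𝓘(ℝ, ES)).prod 𝓘(ℝ, F)) 𝓘(ℝ, EM) ∞ φ φ.source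
  φ_symm_smooth : ContMDiffOn 𝓘(ℝ, EM) ((𝓘(ℝ, ES)).prod 𝓘(ℝ, F)) ∞ φ.symm φ.target
  φ_smul : ∀ (g : G), ∀ v ∈ φ.source, φ (g • v) = g • φ v
  φ_zero : ∀ x : S, φ ⟨x, 0⟩ = (x : M)

variable {G EM ES S F E}

namespace TubularNeighborhood

/-- The projection `π_S = π_E ∘ φ⁻¹`; only its values on `T_S = φ.target` are meaningful. -/
def projection (T : TubularNeighborhood G EM ES S F E) (y : M) : S := (T.φ.symm y).proj

/-- `T` is compatible with `f` if `f ∘ π_S = f` on `T_S`. -/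
def CompatibleWith {P : Type*} (T : TubularNeighborhood G EM ES S F E) (f : M → P) : Prop :=
  ∀ y ∈ T.φ.target, f (T.projection y : M) = f y

/-- The push-forward `h_* T = ((h⁻¹)^* E, ε ∘ h⁻¹, h ∘ φ)` of a tubular neighbourhood of `S` under
an equivariant diffeomorphism `h` of `M` that restricts to the identity of `S`, so that
`(h⁻¹)^* E = E` and `ε ∘ h⁻¹ = ε`. -/
def pushforward (T : TubularNeighborhood G EM ES S F E) (h : M ≃ₘ^∞⟮𝓘(ℝ, EM), 𝓘(ℝ, EM)⟯ M)
    (h_smul : ∀ (g : G) (x : M), h (g • x) = g • h x) (h_fix : ∀ x : S, h (x : M) = x) :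
    TubularNeighborhood G EM ES S F E where
  metric := T.metric
  metric_smul := T.metric_smul
  ε := T.ε
  ε_pos := T.ε_pos
  ε_smooth := T.ε_smooth
  ε_smul := T.ε_smul
  φ := T.φ.transHomeomorph h.toHomeomorph
  φ_source := T.φ_source
  φ_smooth := h.contMDiff.comp_contMDiffOn T.φ_smooth
  φ_symm_smooth := T.φ_symm_smooth.comp h.symm.contMDiff.contMDiffOn (fun _ hy => hy)
  φ_smul := fun g v hv => (congrArg h (T.φ_smul g v hv)).trans (h_smul g _)
  φ_zero := fun x => (congrArg h (T.φ_zero x)).trans (h_fix x)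

variable {F' : Type*} [NormedAddCommGroup F'] [NormedSpace ℝ F']
  {E' : S → Type*} [TopologicalSpace (TotalSpace F' E')]
  [∀ x, AddCommGroup (E' x)] [∀ x, Module ℝ (E' x)] [∀ x, TopologicalSpace (E' x)]
  [∀ x, IsTopologicalAddGroup (E' x)] [∀ x, ContinuousConstSMul ℝ (E' x)]
  [FiberBundle F' E'] [VectorBundle ℝ F' E'] [MulAction G (TotalSpace F' E')]

/-- A `G`-equivariant isomorphism `T|_X → T'|_X` over a subset `X` of `S`: a `G`-equivariant
isometric isomorphism of vector bundles `ψ : E|_X → E'|_X` over the identity, together with a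
continuous `δ : X → (0, ∞)`, `δ ≤ min (ε, ε')`, such that `φ' ∘ ψ = φ` on `B(δ, E|_X)`.
As usual for maps on arbitrary subsets of manifolds, `ψ` is smooth if it locally extends to a smooth
map; for open `X` this is smoothness in the ordinary sense. -/
structure IsoOver (T : TubularNeighborhood G EM ES S F E)
    (T' : TubularNeighborhood G EM ES S F' E') (X : Set S) where
  ψ : ∀ x : X, E x ≃ₗ[ℝ] E' x
  isometry : ∀ (x : X) (v w : E x),
    T'.metric.inner x (ψ x v) (ψ x w) = T.metric.inner x v w
  smooth : ∀ x ∈ X, ∃ W : Set S, IsOpen W ∧ x ∈ W ∧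
    ∃ Ψ : TotalSpace F E → TotalSpace F' E',
      ContMDiffOn ((𝓘(ℝ, ES)).prod 𝓘(ℝ, F)) ((𝓘(ℝ, ES)).prod 𝓘(ℝ, F')) ∞ Ψ
        {v | v.proj ∈ W} ∧
      ∀ v (hv : v.proj ∈ X), v.proj ∈ W → Ψ v = ⟨v.proj, ψ ⟨v.proj, hv⟩ v.snd⟩
  equivariant : ∀ (g : G) (v : TotalSpace F E) (hv : v.proj ∈ X) (hgv : (g • v).proj ∈ X),
    (⟨(g • v).proj, ψ ⟨(g • v).proj, hgv⟩ (g • v).snd⟩ : TotalSpace F' E') =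
      g • (⟨v.proj, ψ ⟨v.proj, hv⟩ v.snd⟩ : TotalSpace F' E')
  δ : X → ℝ
  δ_pos : ∀ x, 0 < δ x
  δ_le : ∀ x, δ x ≤ min (T.ε x) (T'.ε x)
  δ_continuous : Continuous δ
  φ_comp : ∀ (x : X) (v : E x), T.metric.inner x v v < δ x →
    T'.φ ⟨x, ψ x v⟩ = T.φ ⟨x, v⟩

end TubularNeighborhood

end Tubular

/-- A `G`-equivariant diffeotopy of the `G`-manifold `M`: a smooth map `M × [0,1] → M`,
`(x, t) ↦ H_t x`, such that each `H_t` is a `G`-equivariant diffeomorphism and `H_0 = id`. -/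
structure EquivariantDiffeotopy (G : Type*) [Group G]
    (EM : Type*) [NormedAddCommGroup EM] [NormedSpace ℝ EM]
    (M : Type*) [TopologicalSpace M] [ChartedSpace EM M] [MulAction G M] where
  toDiffeo : unitInterval → (M ≃ₘ^∞⟮𝓘(ℝ, EM), 𝓘(ℝ, EM)⟯ M)
  contMDiff : ContMDiff ((𝓘(ℝ, EM)).prod (𝓡∂ 1)) 𝓘(ℝ, EM) ∞
    (fun p : M × unitInterval => toDiffeo p.2 p.1)
  zero : ∀ x, toDiffeo 0 x = x
  map_smul : ∀ t (g : G) (x : M), toDiffeo t (g • x) = g • toDiffeo t x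

namespace EquivariantDiffeotopy

variable {G : Type*} [Group G] {EM : Type*} [NormedAddCommGroup EM] [NormedSpace ℝ EM]
  {M : Type*} [TopologicalSpace M] [ChartedSpace EM M] [MulAction G M]

/-- The closure of the set of points that are moved at some time. -/
def support (H : EquivariantDiffeotopy G EM M) : Set M :=
  closure {x | ∃ t, H.toDiffeo t x ≠ x}

/-- `f (H_t x) = f x` for all `x` and `t`. -/
def CompatibleWith {P : Type*} (H : EquivariantDiffeotopy G EM M) (f : M → P) : Prop :=
  ∀ t x, f (H.toDiffeo t x) = f x

end EquivariantDiffeotopy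

end

/-! Let `θ = φ₁⁻¹ ∘ φ₀` be the transition map; it is defined near the zero section and fixes it. By
Hadamard's lemma the family `s⁻¹ θ(s v)` extends smoothly to `s = 0`, where it becomes the fibrewise
derivative `L` of `θ` (`contMDiffAt_blowUp`). So `θ` is joined to a bundle isomorphism, which need
not be isometric. If `Q` is the positive self-adjoint factor for which `L ∘ Q` is an isometry, the
segment from `id` to `Q` consists of invertible maps. Running along this segment while `s` decreases
from `1` to `0` joins `θ` to the isometry `ψ = L ∘ Q` (`path`). An integral formula for `Q`
(`polarFactor`) makes its smooth dependence on the metrics visible, and its naturality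
(`polarFactor_naturality`) makes it well defined on bundles and equivariant.

On `M` this becomes a local isotopy `Φ_t = φ₁ ∘ path_t ∘ φ₀⁻¹` near `S` with `Φ_0 = id` and `Φ_1 ∘
φ₀ = φ₁ ∘ ψ`. It fixes `S`, is equivariant, and preserves `f`: compatibility says `f ∘ φᵢ = f ∘ π`,
so `θ` moves base points inside the fibres of `f`, and rescaling does not change this.

The isotopy is globalized by stopping its clock instead of truncating a vector field: `H_s(x) =
Φ_{sχ(x)}(x)` with an invariant cutoff `χ`. Every `Φ_t` preserves `f`, hence so does `H_s`. If `Ψ_t`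
inverts `Φ_t`, inverting `H_s` at `y` amounts to solving `t = s χ(Ψ_t y)`, which has a unique
solution, smooth in `y`, as soon as `χ` grows with speed less than one along the curves `t ↦ Ψ_t y`
(`exists_equivariantDiffeotopy_of_local`).

The difficulty is that `χ` has to fall from `1` to `0` inside a prescribed thin neighbourhood of
`S`. The path commutes with fibrewise scaling up to a change of its parameter `s`. Consequently,
along the curves near the zero section, `log |v|` changes at a bounded rate and the base point moves
at rate `O(|v|)`. A cutoff that varies slowly in `log |v|` therefore works: `χ = β σ(2 - 4
|v|^{2g(b)})` with a small exponent `g`, which lowers the slope and shrinks the support at the same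
time. To handle a noncompact `S`, `b` is an invariant exhaustion function and `g` decays
sufficiently fast (`exists_cutoff_exponent`).

For the relative statement let `β` be `1` near `Z \ U` and `0` near `A` and near the complement of
`V`. Over `U` the map `θ` is `ψ₀` near the zero section, so `L` is isometric there, `Q = id`, and
the isotopy is stationary near `U`. Hence any cutoff gives `H_1 ∘ φ₀ = φ₁ ∘ ψ` with `ψ = ψ₀` there,
while near `Z \ U` the clock runs to the end. -/

noncomputable section

set_option linter.unusedSectionVars false
set_option linter.unusedSimpArgs false

/-! ### Smooth dependence of integrals on parameters in manifolds. -/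

section ParametricIntegral

open MeasureTheory Function

variable {EN : Type*} [NormedAddCommGroup EN] [NormedSpace ℝ EN] {HN : Type*} [TopologicalSpace HN]
  {J : ModelWithCorners ℝ EN HN} {N : Type*} [TopologicalSpace N] [ChartedSpace HN N]
  [IsManifold J ∞ N]

/-- The manifold derivative of a family depends smoothly on its parameter, and between vector spaces
the tangent coordinates in which this is expressed are trivial. To differentiate at a variable
point, that point is made part of the parameter. -/
theorem ContMDiffAt.fderiv_param {V W : Type*} [NormedAddCommGroup V] [NormedSpace ℝ V]
    [NormedAddCommGroup W] [NormedSpace ℝ W] {F : N → V → W} {k : N} {x : V}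
    (hF : ContMDiffAt (J.prod 𝓘(ℝ, V)) 𝓘(ℝ, W) ∞ (uncurry F) (k, x)) :
    ContMDiffAt (J.prod 𝓘(ℝ, V)) 𝓘(ℝ, V →L[ℝ] W) ∞ (fun p : N × V => fderiv ℝ (F p.1) p.2)
      (k, x) := by
  have h1 : ContMDiffAt ((J.prod 𝓘(ℝ, V)).prod 𝓘(ℝ, V)) 𝓘(ℝ, W) ∞
      (uncurry fun (p : N × V) (y : V) => F p.1 y) ((k, x), x) :=
    ContMDiffAt.comp (f := fun q : (N × V) × V => (q.1.1, q.2)) ((k, x), x) hF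
      ((contMDiffAt_fst.fst).prodMk contMDiffAt_snd)
  have h2 := ContMDiffAt.mfderiv (fun (p : N × V) (y : V) => F p.1 y) Prod.snd (x₀ := (k, x)) h1
    contMDiffAt_snd (m := ∞) (by simp)
  simp only [mfderiv_eq_fderiv] at h2
  refine h2.congr_of_eventuallyEq (Filter.EventuallyEq.of_eq ?_)
  exact (inTangentCoordinates_model_space (Prod.snd : N × V → V) (fun x => F x.1 x.2) (fun p => fderiv ℝ (F p.1) p.2) (k, x)).symm

theorem ContMDiffAt.deriv_param {W : Type*} [NormedAddCommGroup W] [NormedSpace ℝ W]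
    {F : N → ℝ → W} {k : N} {x : ℝ}
    (hF : ContMDiffAt (J.prod 𝓘(ℝ, ℝ)) 𝓘(ℝ, W) ∞ (uncurry F) (k, x)) :
    ContMDiffAt (J.prod 𝓘(ℝ, ℝ)) 𝓘(ℝ, W) ∞ (fun p : N × ℝ => deriv (F p.1) p.2) (k, x) :=
  hF.fderiv_param.clm_apply (contMDiffAt_const (c := (1 : ℝ)))

variable [T2Space N] [SecondCountableTopology N] [MeasurableSpace N] [BorelSpace N]

/-- The measure is concentrated on the compact set `K`. A bound for the derivative on `K × {x}`
persists, enlarged by `1`, for all nearby parameters, and so dominated convergence applies. -/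
theorem hasFDerivAt_integral_of_contMDiffAt {V W : Type*} [NormedAddCommGroup V] [NormedSpace ℝ V]
    [NormedAddCommGroup W] [NormedSpace ℝ W] {μ : Measure N} [IsFiniteMeasure μ] {K : Set N}
    (hK : IsCompact K) (hμ : μ Kᶜ = 0) {Ω : Set V} (hΩ : IsOpen Ω) {F : N → V → W}
    (hF : ∀ k ∈ K, ∀ x ∈ Ω, ContMDiffAt (J.prod 𝓘(ℝ, V)) 𝓘(ℝ, W) ∞ (uncurry F) (k, x))
    {x : V} (hx : x ∈ Ω) :
    HasFDerivAt (fun x => ∫ k, F k x ∂μ) (∫ k, fderiv ℝ (F k) x ∂μ) x := by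
  have hae : ∀ᵐ k ∂μ, k ∈ K := hμ
  have hr : μ.restrict K = μ := Measure.restrict_eq_self_of_ae_mem hae
  have hmeas : ∀ (H : N → W), ContinuousOn H K → AEStronglyMeasurable H μ := by
    intro H hH
    rw [← hr]
    exact hH.aestronglyMeasurable hK.measurableSet
  have hcont : ∀ y ∈ Ω, ContinuousOn (fun k => F k y) K := fun y hy k hk =>
    ((hF k hk y hy).continuousAt.comp (f := fun k => (k, y))
      (by fun_prop : ContinuousAt (fun k => (k, y)) k)).continuousWithinAt
  have hd : ∀ k ∈ K, ContinuousAt (fun p : N × V => fderiv ℝ (F p.1) p.2) (k, x) :=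
    fun k hk => (hF k hk x hx).fderiv_param.continuousAt
  have hd' : ContinuousOn (fun k => fderiv ℝ (F k) x) K := fun k hk =>
    ((hd k hk).comp (f := fun k => (k, x))
      (by fun_prop : ContinuousAt (fun k => (k, x)) k)).continuousWithinAt
  obtain ⟨C, hC⟩ := hK.exists_bound_of_continuousOn hd'
  have hbd : ∀ᶠ y in 𝓝 x, ∀ k ∈ K, ‖fderiv ℝ (F k) y‖ ≤ C + 1 := by
    refine hK.eventually_forall_of_forall_eventually
      (P := fun y k => ‖fderiv ℝ (F k) y‖ ≤ C + 1) fun k hk => ?_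
    have h1 : ContinuousAt (fun p : V × N => ‖fderiv ℝ (F p.2) p.1‖) (x, k) :=
      ((hd k hk).comp (f := fun p : V × N => (p.2, p.1)) (x := (x, k))
        continuous_swap.continuousAt).norm
    have h2 : ‖fderiv ℝ (F k) x‖ < C + 1 := lt_of_le_of_lt (hC k hk) (lt_add_one C)
    exact (h1.eventually_lt_const h2).mono fun _ h => h.le
  have hint : Integrable (fun k => F k x) μ := by
    obtain ⟨C', hC'⟩ := hK.exists_bound_of_continuousOn (hcont x hx)
    exact Integrable.of_bound (hmeas _ (hcont x hx)) C' (hae.mono fun k hk => hC' k hk)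
  refine hasFDerivAt_integral_of_dominated_of_fderiv_le (F := fun y k => F k y)
    (F' := fun y k => fderiv ℝ (F k) y) (bound := fun _ => C + 1)
    (s := {y | ∀ k ∈ K, ‖fderiv ℝ (F k) y‖ ≤ C + 1} ∩ Ω)
    (Filter.inter_mem hbd (hΩ.mem_nhds hx)) ?_ hint
    (hr ▸ hd'.aestronglyMeasurable hK.measurableSet) ?_ (integrable_const _) ?_
  · exact (hΩ.eventually_mem hx).mono fun y hy => hmeas _ (hcont y hy)
  · exact hae.mono fun k hk y hy => hy.1 k hk
  · refine hae.mono fun k hk y hy => ?_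
    have h1 : ContMDiffAt 𝓘(ℝ, V) 𝓘(ℝ, W) ∞ (F k) y :=
      (hF k hk y hy.2).comp (f := fun y => (k, y)) y (contMDiffAt_const.prodMk contMDiffAt_id)
    exact (h1.contDiffAt.differentiableAt (by simp)).hasFDerivAt

-- The induction replaces the target `W` by `V →L[ℝ] W`, so the universe of `W` has to contain that
-- of `V`.
universe u v in
theorem contDiffOn_integral_aux {V : Type u} {W : Type max u v} [NormedAddCommGroup V]
    [NormedSpace ℝ V]
    [NormedAddCommGroup W] [NormedSpace ℝ W] {μ : Measure N} [IsFiniteMeasure μ] {K : Set N}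
    (hK : IsCompact K) (hμ : μ Kᶜ = 0) {Ω : Set V} (hΩ : IsOpen Ω) {F : N → V → W}
    (hF : ∀ k ∈ K, ∀ x ∈ Ω, ContMDiffAt (J.prod 𝓘(ℝ, V)) 𝓘(ℝ, W) ∞ (uncurry F) (k, x)) (n : ℕ) :
    ContDiffOn ℝ n (fun x => ∫ k, F k x ∂μ) Ω := by
  induction n generalizing W with
  | zero =>
    exact contDiffOn_zero.2 fun x hx =>
      (hasFDerivAt_integral_of_contMDiffAt hK hμ hΩ hF hx).continuousAt.continuousWithinAt
  | succ n ih =>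
    have hd := fun x hx => hasFDerivAt_integral_of_contMDiffAt (x := x) hK hμ hΩ hF hx
    rw [show ((n + 1 : ℕ) : WithTop ℕ∞) = (n : WithTop ℕ∞) + 1 by norm_cast,
      contDiffOn_succ_iff_fderiv_of_isOpen hΩ]
    refine ⟨fun x hx => (hd x hx).differentiableAt.differentiableWithinAt, by simp, ?_⟩
    exact (ih (W := V →L[ℝ] W) (F := fun k x => fderiv ℝ (F k) x)
      fun k hk x hx => (hF k hk x hx).fderiv_param).congr fun x hx => (hd x hx).fderiv

universe u v in
theorem contDiffOn_integral {V : Type u} {W : Type v} [NormedAddCommGroup V] [NormedSpace ℝ V]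
    [NormedAddCommGroup W] [NormedSpace ℝ W] [CompleteSpace W] {μ : Measure N} [IsFiniteMeasure μ]
    {K : Set N} (hK : IsCompact K) (hμ : μ Kᶜ = 0) {Ω : Set V} (hΩ : IsOpen Ω) {F : N → V → W}
    (hF : ∀ k ∈ K, ∀ x ∈ Ω, ContMDiffAt (J.prod 𝓘(ℝ, V)) 𝓘(ℝ, W) ∞ (uncurry F) (k, x)) :
    ContDiffOn ℝ ∞ (fun x => ∫ k, F k x ∂μ) Ω := by
  -- Lifting the target removes the universe restriction of the inductive version.
  let e : ULift.{u} W ≃L[ℝ] W := ContinuousLinearEquiv.ulift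
  refine contDiffOn_infty.2 fun n => ?_
  have h := contDiffOn_integral_aux.{u, v} (V := V) (W := ULift.{u} W) (J := J) (μ := μ) hK hμ hΩ
    (F := fun k x => e.symm (F k x)) (fun k hk x hx =>
      (e.symm.contDiff.contMDiff (n := ∞)).contMDiffAt.comp (k, x) (hF k hk x hx)) n
  have h2 := (e.contDiff (n := n)).comp_contDiffOn h
  refine h2.congr fun x hx => ?_
  simp only [comp_apply]
  rw [← ContinuousLinearEquiv.integral_comp_comm]
  simp

/-- This serves three times: for averaging over `G`, for the integral formula of the polar factor,
and for Hadamard's lemma. -/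
theorem contMDiffAt_integral {EX HX X W : Type*} [NormedAddCommGroup EX] [NormedSpace ℝ EX]
    [TopologicalSpace HX] {I : ModelWithCorners ℝ EX HX} [I.Boundaryless] [TopologicalSpace X]
    [ChartedSpace HX X] [IsManifold I ∞ X]
    [NormedAddCommGroup W] [NormedSpace ℝ W] [CompleteSpace W] {μ : Measure N} [IsFiniteMeasure μ]
    {K : Set N} (hK : IsCompact K) (hμ : μ Kᶜ = 0) {F : N → X → W} {x₀ : X}
    (hF : ∀ᶠ x in 𝓝 x₀, ∀ k ∈ K, ContMDiffAt (J.prod I) 𝓘(ℝ, W) ∞ (uncurry F) (k, x)) :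
    ContMDiffAt I 𝓘(ℝ, W) ∞ (fun x => ∫ k, F k x ∂μ) x₀ := by
  obtain ⟨U, hU, hUo, hxU⟩ := eventually_nhds_iff.1 hF
  set e := extChartAt I x₀
  set Ω : Set EX := e.target ∩ e.symm ⁻¹' U with hΩdef
  have hΩ : IsOpen Ω := (continuousOn_extChartAt_symm x₀).isOpen_inter_preimage
    (isOpen_extChartAt_target x₀) hUo
  have h := contDiffOn_integral (J := J) (μ := μ) hK hμ hΩ (F := fun k y => F k (e.symm y))
    (fun k hk y hy => by
      have h1 : ContMDiffAt 𝓘(ℝ, EX) I ∞ e.symm y :=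
        (contMDiffOn_extChartAt_symm x₀).contMDiffAt
          ((isOpen_extChartAt_target x₀).mem_nhds hy.1)
      exact (hU _ hy.2 k hk).comp (f := fun p : N × EX => (p.1, e.symm p.2)) (k, y)
        (contMDiffAt_fst.prodMk (h1.comp (k, y) contMDiffAt_snd)))
  have hx : e x₀ ∈ Ω := ⟨mem_extChartAt_target x₀, by
    simp only [e, mem_preimage, extChartAt_to_inv]; exact hxU⟩
  have h2 : ContMDiffAt I 𝓘(ℝ, W) ∞ ((fun y => ∫ k, F k (e.symm y) ∂μ) ∘ e) x₀ :=
    ((h.contDiffAt (hΩ.mem_nhds hx)).contMDiffAt).comp x₀ contMDiffAt_extChartAt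
  refine h2.congr_of_eventuallyEq ?_
  filter_upwards [extChartAt_source_mem_nhds (I := I) x₀] with x hx
  simp only [comp_apply, e, (extChartAt I x₀).left_inv hx]

end ParametricIntegral

/-! ### Real functions: fast decay, and the logarithmic slope of a power cutoff. -/

section RealFunctions

open MeasureTheory

theorem Real.smoothTransition.exists_deriv_bound :
    ∃ C : ℝ, 0 < C ∧ ∀ x, |deriv Real.smoothTransition x| ≤ C := by
  have hc : Continuous (deriv Real.smoothTransition) :=
    (Real.smoothTransition.contDiff (n := 1)).continuous_deriv le_rfl
  obtain ⟨C, hC⟩ := (isCompact_Icc (a := (0 : ℝ)) (b := 1)).exists_bound_of_continuousOn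
    hc.continuousOn
  refine ⟨max C 1, by positivity, fun x => ?_⟩
  by_cases hx : x ∈ Icc (0 : ℝ) 1
  · exact (hC x hx).trans (le_max_left _ _)
  · have : deriv Real.smoothTransition x = 0 := by
      rcases not_and_or.1 hx with h | h
      · rw [Filter.EventuallyEq.deriv_eq (f := fun _ => (0 : ℝ)), deriv_const]
        filter_upwards [gt_mem_nhds (not_le.1 h)] with y hy
        exact Real.smoothTransition.zero_of_nonpos (le_of_lt hy)
      · rw [Filter.EventuallyEq.deriv_eq (f := fun _ => (1 : ℝ)), deriv_const]
        filter_upwards [lt_mem_nhds (not_le.1 h)] with y hy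
        exact Real.smoothTransition.one_of_one_le (le_of_lt hy)
    rw [this, abs_zero]; positivity

/-- There are smooth positive functions on the half-line that decay, together with their first
derivative, as fast as prescribed. -/
theorem exists_contDiff_pos_deriv_le (a : ℕ → ℝ) (ha : ∀ n, 0 < a n) :
    ∃ g : ℝ → ℝ, ContDiff ℝ ∞ g ∧ (∀ y, 0 < g y) ∧
      ∀ (n : ℕ) (y : ℝ), n ≤ y → y ≤ n + 1 → g y ≤ a n ∧ |deriv g y| ≤ a n := by
  -- Running minima turn the prescribed bounds into an antitone sequence, so that a bound at `n`
  -- holds at everything to the right of `n`.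
  let a' : ℕ → ℝ := fun n => (Finset.range (n + 1)).inf' (by simp) a
  have ha' : ∀ n, 0 < a' n := fun n => (Finset.lt_inf'_iff _).2 fun i _ => ha i
  have hanti : ∀ {m n}, m ≤ n → a' n ≤ a' m := fun {m n} h =>
    Finset.inf'_mono a (Finset.range_subset_range.2 (by omega)) _
  have hle : ∀ n, a' n ≤ a n := fun n => Finset.inf'_le a (by simp)
  obtain ⟨h, hh⟩ := exists_contMDiffMap_forall_mem_convex_of_local_const (n := ⊤) 𝓘(ℝ, ℝ)
    (t := fun x : ℝ => Ioc 0 (a' ⌊x⌋₊)) (fun x => convex_Ioc _ _) (fun x => by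
      -- The next index is used because the floor may jump near `x`; every `y` close to `x` has
      -- floor at most `⌊x⌋₊`.
      refine ⟨a' (⌊x⌋₊ + 1), ?_⟩
      filter_upwards [gt_mem_nhds (Nat.lt_floor_add_one x)] with y hy
      refine ⟨ha' _, hanti ?_⟩
      rcases le_or_gt y 0 with h0 | h0
      · simp [Nat.floor_of_nonpos h0]
      · have := (Nat.floor_lt h0.le (n := ⌊x⌋₊ + 1)).2 (by push_cast; exact hy)
        exact this.le)
  have hs : ContDiff ℝ ∞ h := h.contMDiff.contDiff
  have hint : ∀ u v, IntervalIntegrable h volume u v := fun u v =>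
    hs.continuous.intervalIntegrable u v
  let F : ℝ → ℝ := fun y => ∫ t in (0 : ℝ)..y, h t
  have hF : ∀ y, HasDerivAt F (h y) y := fun y =>
    intervalIntegral.integral_hasDerivAt_right (hint 0 y)
      (hs.continuous.stronglyMeasurableAtFilter _ _) hs.continuous.continuousAt
  have hFs : ContDiff ℝ ∞ F := by
    refine contDiff_infty_iff_deriv.2 ⟨fun y => (hF y).differentiableAt, ?_⟩
    rwa [show deriv F = h from funext fun y => (hF y).deriv]
  have hg : ∀ y, F (y + 1) - F y = ∫ t in y..(y + 1), h t := fun y =>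
    intervalIntegral.integral_interval_sub_left (hint _ _) (hint _ _)
  have hd : ∀ y, HasDerivAt (fun y => F (y + 1) - F y) (h (y + 1) - h y) y := fun y =>
    ((hF (y + 1)).comp_add_const y 1).sub (hF y)
  -- Taking `g(y)` to be the integral of `h` over `[y, y + 1]` makes the derivative the difference
  -- `h(y + 1) - h(y)` of two numbers in `(0, a n]`. Thus one bound on `h` controls both `g` and
  -- `g'`.
  refine ⟨fun y => F (y + 1) - F y, (hFs.comp (contDiff_id.add contDiff_const)).sub hFs,
    fun y => ?_, fun n y h1 h2 => ?_⟩
  · beta_reduce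
    rw [hg]
    exact intervalIntegral.intervalIntegral_pos_of_pos (hint _ _) (fun x => (hh x).1) (by linarith)
  · have hb : ∀ t, (n : ℝ) ≤ t → h t ≤ a n := fun t ht =>
      ((hh t).2.trans (hanti (Nat.le_floor ht))).trans (hle n)
    constructor
    · beta_reduce
      rw [hg]
      calc ∫ t in y..(y + 1), h t ≤ ∫ _ in y..(y + 1), a n :=
            intervalIntegral.integral_mono_on (by linarith) (hint _ _) (by simp)
              fun t ht => hb t (h1.trans ht.1)
        _ = a n := by simp
    · rw [(hd y).deriv, abs_le]
      have := (hh y).1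
      have := (hh (y + 1)).1
      constructor <;> linarith [hb y h1, hb (y + 1) (by linarith)]

/-- The function `t ↦ q(t) ^ η(t)` inside a cutoff: bound for the derivative in terms of the
logarithmic derivatives of `q`. -/
theorem abs_deriv_smoothTransition_rpow_le {C : ℝ} (hC : ∀ x, |deriv Real.smoothTransition x| ≤ C)
    {q η : ℝ → ℝ} {q' η' t : ℝ} (hq : HasDerivAt q q' t) (hη : HasDerivAt η η' t) (hqt : 0 < q t)
    (h1 : q t ^ η t ≤ 1) :
    ∃ d, HasDerivAt (fun t => Real.smoothTransition (2 - 4 * q t ^ η t)) d t ∧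
      |d| ≤ 4 * C * (|η'| * |Real.log (q t)| + |η t| * (|q'| / q t)) := by
  have hr := hq.rpow hη hqt
  have hσ := (Real.smoothTransition.contDiffAt (n := 1)
    (x := 2 - 4 * q t ^ η t)).differentiableAt one_ne_zero |>.hasDerivAt
  have hd := hσ.comp t ((hr.const_mul 4).const_sub 2)
  refine ⟨_, hd, ?_⟩
  have hy : 0 < q t ^ η t := Real.rpow_pos_of_pos hqt _
  -- The derivative of `q^η` is `q^η` times its logarithmic derivative, and the first factor is at
  -- most `1` by hypothesis.
  have e : q' * η t * q t ^ (η t - 1) + η' * q t ^ η t * Real.log (q t) =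
      q t ^ η t * (η' * Real.log (q t) + η t * (q' / q t)) := by
    rw [Real.rpow_sub_one hqt.ne']; field_simp; ring
  rw [e, abs_mul, abs_neg, abs_mul, abs_mul, abs_of_pos hy,
    abs_of_pos (four_pos (α := ℝ))]
  have h2 : |η' * Real.log (q t) + η t * (q' / q t)| ≤
      |η'| * |Real.log (q t)| + |η t| * (|q'| / q t) := by
    refine (abs_add_le _ _).trans (le_of_eq ?_)
    rw [abs_mul, abs_mul, abs_div, abs_of_pos hqt]
  have h3 : 0 ≤ |η'| * |Real.log (q t)| + |η t| * (|q'| / q t) := by positivity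
  have hC0 : 0 ≤ C := (abs_nonneg _).trans (hC 0)
  calc _ ≤ C * (4 * (1 * (|η'| * |Real.log (q t)| + |η t| * (|q'| / q t)))) := by
        gcongr
        exact hC _
    _ = _ := by ring

end RealFunctions

/-! ### The implicit function theorem for a real unknown over a manifold. -/

section ImplicitFunction

theorem exists_contMDiffAt_implicit {EX HX X : Type*} [NormedAddCommGroup EX] [NormedSpace ℝ EX]
    [CompleteSpace EX]
    [TopologicalSpace HX] {I : ModelWithCorners ℝ EX HX} [I.Boundaryless] [TopologicalSpace X]
    [ChartedSpace HX X] [IsManifold I ∞ X] {F : X → ℝ → ℝ} {x₀ : X} {t₀ : ℝ}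
    (hF : ContMDiffAt (I.prod 𝓘(ℝ, ℝ)) 𝓘(ℝ, ℝ) ∞ (Function.uncurry F) (x₀, t₀))
    (h0 : F x₀ t₀ = 0) (hd : deriv (F x₀) t₀ ≠ 0) :
    ∃ τ : X → ℝ, ContMDiffAt I 𝓘(ℝ, ℝ) ∞ τ x₀ ∧ τ x₀ = t₀ ∧ ∀ᶠ x in 𝓝 x₀, F x (τ x) = 0 := by
  set e := extChartAt I x₀ with he
  have hs : ContMDiffAt 𝓘(ℝ, EX) I ∞ e.symm (e x₀) :=
    (contMDiffOn_extChartAt_symm x₀).contMDiffAt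
      ((isOpen_extChartAt_target x₀).mem_nhds (mem_extChartAt_target x₀))
  let f : EX × ℝ → ℝ := fun p => F (e.symm p.1) p.2
  have hex : e.symm (e x₀) = x₀ := extChartAt_to_inv x₀
  have hfm : ContMDiffAt (𝓘(ℝ, EX).prod 𝓘(ℝ, ℝ)) 𝓘(ℝ, ℝ) ∞ f (e x₀, t₀) := by
    refine ContMDiffAt.comp (I' := I.prod 𝓘(ℝ, ℝ)) (g := Function.uncurry F)
      (f := fun p : EX × ℝ => (e.symm p.1, p.2)) (e x₀, t₀) (by rw [hex]; exact hF) ?_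
    exact (hs.comp (e x₀, t₀) contMDiffAt_fst).prodMk contMDiffAt_snd
  have hf : ContDiffAt ℝ ∞ f (e x₀, t₀) := by
    rw [← contMDiffAt_iff_contDiffAt, modelWithCornersSelf_prod, ← chartedSpaceSelf_prod]
    exact hfm
  have hinv : (fderiv ℝ f (e x₀, t₀) ∘L .inr ℝ EX ℝ).IsInvertible := by
    have h1 : HasFDerivAt (F x₀) (fderiv ℝ f (e x₀, t₀) ∘L .inr ℝ EX ℝ) t₀ := by
      have h2 := (hf.differentiableAt (by simp)).hasFDerivAt.comp (f := fun t : ℝ => (e x₀, t)) t₀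
        (hasFDerivAt_prodMk_right (e x₀) t₀)
      simpa only [f, Function.comp_def, hex] using h2
    have h3 : (fderiv ℝ f (e x₀, t₀) ∘L .inr ℝ EX ℝ) 1 = deriv (F x₀) t₀ := by
      rw [h1.hasDerivAt.deriv]
    refine ⟨ContinuousLinearEquiv.unitsEquivAut ℝ (Units.mk0 _ hd), ?_⟩
    ext
    simp [← h3]
  refine ⟨fun x => hf.implicitFunction (by simp) hinv (e x), ?_, ?_, ?_⟩
  · exact (hf.contDiffAt_implicitFunction (by simp) hinv).contMDiffAt.comp x₀
      contMDiffAt_extChartAt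
  · exact hf.implicitFunction_apply_self (by simp) hinv
  · have h1 := hf.eventually_apply_implicitFunction (by simp) hinv
    have h2 := (continuousAt_extChartAt (I := I) x₀).eventually h1
    filter_upwards [h2, extChartAt_source_mem_nhds (I := I) x₀] with x hx hxs
    have h4 : f (e x₀, t₀) = 0 := by simp only [f, hex, h0]
    rw [h4] at hx
    simpa only [f, he, (extChartAt I x₀).left_inv hxs] using hx

end ImplicitFunction

/-! ### Invariant smooth functions by averaging. -/

section InvariantFunctions

open MeasureTheory

variable {EM : Type*} [NormedAddCommGroup EM] [NormedSpace ℝ EM] [FiniteDimensional ℝ EM]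
    {M : Type*} [TopologicalSpace M] [ChartedSpace EM M] [IsManifold 𝓘(ℝ, EM) ∞ M]

/-- Averaging of a smooth function over a compact Lie group. -/
theorem exists_contMDiff_average
    (EG : Type*) [NormedAddCommGroup EG] [NormedSpace ℝ EG] [FiniteDimensional ℝ EG]
    (G : Type*) [Group G] [TopologicalSpace G] [ChartedSpace EG G] [LieGroup 𝓘(ℝ, EG) ∞ G]
    [CompactSpace G] [T2Space G] [MulAction G M] [ContMDiffSMul 𝓘(ℝ, EG) 𝓘(ℝ, EM) ∞ G M] {b : M → ℝ} (hb : ContMDiff 𝓘(ℝ, EM) 𝓘(ℝ, ℝ) ∞ b) :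
    ∃ c : M → ℝ, ContMDiff 𝓘(ℝ, EM) 𝓘(ℝ, ℝ) ∞ c ∧ (∀ (g : G) x, c (g • x) = c x) ∧
      ∀ x m, ((∀ g : G, m ≤ b (g • x)) → m ≤ c x) ∧ ((∀ g : G, b (g • x) ≤ m) → c x ≤ m) := by
  have : IsTopologicalGroup G := topologicalGroup_of_lieGroup 𝓘(ℝ, EG) ∞
  have : SecondCountableTopology G := ChartedSpace.secondCountable_of_sigmaCompact EG G
  let _ : MeasurableSpace G := borel G
  have : BorelSpace G := ⟨rfl⟩
  let μ : Measure G := Measure.haarMeasure ⊤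
  have : IsProbabilityMeasure μ := ⟨Measure.haarMeasure_self (K₀ := (⊤ : TopologicalSpace.PositiveCompacts G))⟩
  have hact : ContMDiff (𝓘(ℝ, EG).prod 𝓘(ℝ, EM)) 𝓘(ℝ, ℝ) ∞
      (fun p : G × M => b (p.1⁻¹ • p.2)) := by
    refine hb.comp ?_
    have h1 : ContMDiff (𝓘(ℝ, EG).prod 𝓘(ℝ, EM)) 𝓘(ℝ, EG) ∞ (fun p : G × M => p.1⁻¹) :=
      contMDiff_fst.inv
    exact (contMDiff_smul (I := 𝓘(ℝ, EG)) (I' := 𝓘(ℝ, EM)) (n := ∞) (G := G) (M := M)).comp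
      (h1.prodMk contMDiff_snd)
  have hint : ∀ x, Integrable (fun g : G => b (g⁻¹ • x)) μ := fun x => by
    have hc : Continuous (fun g : G => b (g⁻¹ • x)) :=
      hact.continuous.comp (f := fun g : G => (g, x)) (by fun_prop)
    obtain ⟨C, hC⟩ := isCompact_univ.exists_bound_of_continuousOn hc.continuousOn
    exact Integrable.of_bound hc.aestronglyMeasurable C (Filter.Eventually.of_forall fun g => hC g trivial)
  refine ⟨fun x => ∫ g, b (g⁻¹ • x) ∂μ, fun x => ?_, fun h x => ?_, fun x m => ⟨fun hm => ?_, fun hm => ?_⟩⟩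
  · exact contMDiffAt_integral (J := 𝓘(ℝ, EG)) (F := fun (g : G) (x : M) => b (g⁻¹ • x))
      isCompact_univ (by simp)
      (Filter.Eventually.of_forall fun y k _ => hact.contMDiffAt)
  · have := integral_mul_left_eq_self (μ := μ) (fun g : G => b (g⁻¹ • x)) h⁻¹
    beta_reduce
    rw [← this]
    simp [mul_smul]
  · have := integral_mono (μ := μ) (integrable_const m) (hint x) fun g => hm g⁻¹
    simpa using this
  · have := integral_mono (μ := μ) (hint x) (integrable_const m) fun g => hm g⁻¹
    simpa using this

variable [T2Space M] [SigmaCompactSpace M]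

-- Average a smooth function that dominates the index of a compact exhaustion. If `x` lies outside
-- the compact set `G • K n`, the function is at least `n` on the whole orbit of `x`, and so is its
-- average. Hence each sublevel set is a closed subset of some `G • K n`.
variable (EM M) in
theorem exists_contMDiff_invariant_exhaustion
    (EG : Type*) [NormedAddCommGroup EG] [NormedSpace ℝ EG] [FiniteDimensional ℝ EG]
    (G : Type*) [Group G] [TopologicalSpace G] [ChartedSpace EG G] [LieGroup 𝓘(ℝ, EG) ∞ G]
    [CompactSpace G] [T2Space G] [MulAction G M] [ContMDiffSMul 𝓘(ℝ, EG) 𝓘(ℝ, EM) ∞ G M] :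
    ∃ b : M → ℝ, ContMDiff 𝓘(ℝ, EM) 𝓘(ℝ, ℝ) ∞ b ∧ (∀ (g : G) x, b (g • x) = b x) ∧
      (∀ x, 0 ≤ b x) ∧ ∀ m, IsCompact {x | b x ≤ m} := by
  have : LocallyCompactSpace M := Manifold.locallyCompact_of_finiteDimensional 𝓘(ℝ, EM)
  have : ContinuousSMul G M :=
    ContMDiffSMul.continuousSMul (I := 𝓘(ℝ, EG)) (I' := 𝓘(ℝ, EM)) ∞
  let K : CompactExhaustion M := default
  obtain ⟨b₀, hb₀⟩ := exists_contMDiffMap_forall_mem_convex_of_local_const (n := ⊤) 𝓘(ℝ, EM)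
    (t := fun x : M => Ici (K.find x : ℝ)) (fun x => convex_Ici _) (fun x => by
      refine ⟨K.find x + 1, ?_⟩
      have : interior (K (K.find x + 1)) ∈ 𝓝 x :=
        isOpen_interior.mem_nhds (K.subset_interior_succ _ (K.mem_find x))
      filter_upwards [this] with y hy
      have := K.mem_iff_find_le.1 (interior_subset hy)
      simp only [mem_Ici]
      exact_mod_cast this)
  obtain ⟨c, hc, hinv, hcb⟩ := exists_contMDiff_average EG G b₀.contMDiff
  refine ⟨c, hc, hinv, fun x => (hcb x 0).1 fun g => (Nat.cast_nonneg _).trans (hb₀ _), fun m => ?_⟩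
  obtain ⟨n, hn⟩ := exists_nat_gt m
  have hcomp : IsCompact ((fun p : G × M => p.1 • p.2) '' (univ ×ˢ K n)) :=
    (isCompact_univ.prod (K.isCompact n)).image continuous_smul
  refine hcomp.of_isClosed_subset (isClosed_le hc.continuous continuous_const) fun x hx => ?_
  by_contra hcon
  have h1 : ∀ g : G, (n : ℝ) ≤ b₀ (g • x) := fun g => by
    have : ¬ g • x ∈ K n := fun h => hcon ⟨(g⁻¹, g • x), ⟨trivial, h⟩, by simp⟩
    rw [K.mem_iff_find_le, not_le] at this
    exact (Nat.cast_le.2 this.le).trans (hb₀ _)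
  exact absurd ((hcb x n).1 h1) (not_le.2 (lt_of_le_of_lt hx hn))

/-- Averaging keeps the values on neighbourhoods: by compactness of `G` and invariance of `C` and
`D`, a point near `C` (or `D`) has its whole orbit in the region where the unaveraged function is
constant. -/
theorem exists_contMDiff_invariant_cutoff
    (EG : Type*) [NormedAddCommGroup EG] [NormedSpace ℝ EG] [FiniteDimensional ℝ EG]
    (G : Type*) [Group G] [TopologicalSpace G] [ChartedSpace EG G] [LieGroup 𝓘(ℝ, EG) ∞ G]
    [CompactSpace G] [T2Space G] [MulAction G M] [ContMDiffSMul 𝓘(ℝ, EG) 𝓘(ℝ, EM) ∞ G M] {C D : Set M} (hC : IsClosed C) (hD : IsClosed D)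
    (hCD : Disjoint C D) (hCi : ∀ (g : G), ∀ x ∈ C, g • x ∈ C) (hDi : ∀ (g : G), ∀ x ∈ D, g • x ∈ D) :
    ∃ β : M → ℝ, ContMDiff 𝓘(ℝ, EM) 𝓘(ℝ, ℝ) ∞ β ∧ (∀ (g : G) x, β (g • x) = β x) ∧
      (∀ x, β x ∈ Icc (0 : ℝ) 1) ∧ (∀ x ∈ C, ∀ᶠ y in 𝓝 x, β y = 1) ∧
      ∀ x ∈ D, ∀ᶠ y in 𝓝 x, β y = 0 := by
  have : LocallyCompactSpace M := Manifold.locallyCompact_of_finiteDimensional 𝓘(ℝ, EM)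
  have : ContinuousSMul G M :=
    ContMDiffSMul.continuousSMul (I := 𝓘(ℝ, EG)) (I' := 𝓘(ℝ, EM)) ∞
  obtain ⟨β₀, h0, h1, h01⟩ := exists_contMDiffMap_zero_one_nhds_of_isClosed 𝓘(ℝ, EM) (n := ⊤) hD hC
    hCD.symm
  obtain ⟨c, hc, hinv, hcb⟩ := exists_contMDiff_average EG G (b := β₀) β₀.contMDiff
  have key : ∀ (v : ℝ) (B : Set M), (∀ (g : G), ∀ x ∈ B, g • x ∈ B) →
      (∀ᶠ x in 𝓝ˢ B, β₀ x = v) → ∀ x ∈ B, ∀ᶠ y in 𝓝 x, c y = v := by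
    intro v B hB hv x hx
    have h2 : ∀ᶠ y in 𝓝 x, ∀ g ∈ (univ : Set G), β₀ (g • y) = v := by
      refine isCompact_univ.eventually_forall_of_forall_eventually
        (P := fun y (g : G) => β₀ (g • y) = v) fun g _ => ?_
      have h3 : ContinuousAt (fun p : M × G => p.2 • p.1) (x, g) := by fun_prop
      exact h3.eventually ((Filter.eventually_iff_exists_mem.1 hv).elim fun s hs =>
        Filter.mem_of_superset (mem_nhdsSet_iff_forall.1 hs.1 (g • x) (hB g x hx)) hs.2)
    filter_upwards [h2] with y hy
    exact le_antisymm ((hcb y v).2 fun g => (hy g trivial).le) ((hcb y v).1 fun g => (hy g trivial).ge)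
  exact ⟨c, hc, hinv, fun x => ⟨(hcb x 0).1 fun g => (h01 _).1, (hcb x 1).2 fun g => (h01 _).2⟩,
    key 1 C hCi h1, key 0 D hDi h0⟩

end InvariantFunctions

/-! ### The polar factor of two positive definite forms. -/

section Polar

open MeasureTheory

/-- Simultaneous diagonalization of a symmetric form and a positive definite one. -/
theorem LinearMap.exists_basis_diagonal {V : Type*} [AddCommGroup V] [Module ℝ V]
    [FiniteDimensional ℝ V] (B C : V →ₗ[ℝ] V →ₗ[ℝ] ℝ) (hB : ∀ u w, B u w = B w u)
    (hpos : ∀ u, u ≠ 0 → 0 < B u u) (hC : ∀ u w, C u w = C w u) :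
    ∃ (n : ℕ) (e : Module.Basis (Fin n) ℝ V) (l : Fin n → ℝ), ∀ i w, C (e i) w = l i * B (e i) w := by
  let core : InnerProductSpace.Core ℝ V :=
    { inner := fun u w => B u w
      conj_inner_symm := fun u w => by simpa using hB w u
      re_inner_nonneg := fun u => by
        rcases eq_or_ne u 0 with rfl | h
        · simp
        · simpa using (hpos u h).le
      add_left := fun u v w => by simp
      smul_left := fun u w r => by simp
      definite := fun u h => by
        by_contra hu
        exact (hpos u hu).ne' h }
  let _ : NormedAddCommGroup V := core.toNormedAddCommGroup
  let _ : InnerProductSpace ℝ V := InnerProductSpace.ofCore core.toCore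
  have hin : ∀ u w : V, inner ℝ u w = B u w := fun u w => rfl
  let T : V →ₗ[ℝ] V := ((InnerProductSpace.toDual ℝ V).symm.toLinearEquiv.toLinearMap).comp
    ((LinearMap.toContinuousLinearMap (𝕜 := ℝ) (E := V) (F' := ℝ)).toLinearMap.comp C)
  have hT : ∀ u w, inner ℝ (T u) w = C u w := fun u w => by
    simp only [T, LinearMap.comp_apply, LinearEquiv.coe_coe]
    erw [InnerProductSpace.toDual_symm_apply]
    rfl
  have hsym : T.IsSymmetric := fun u w => by
    rw [hT, real_inner_comm, hT, hC]
  refine ⟨Module.finrank ℝ V, (hsym.eigenvectorBasis rfl).toBasis, hsym.eigenvalues rfl,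
    fun i w => ?_⟩
  rw [← hT, OrthonormalBasis.coe_toBasis, hsym.apply_eigenvectorBasis, ← hin, inner_smul_left]
  rfl

/-- This evaluates the polar factor on a common eigenvector, where only a scalar integral remains.
-/
theorem Real.integral_inv_sin_sq_add_cos_sq {l : ℝ} (hl : 0 < l) :
    ∫ φ in (0 : ℝ)..(Real.pi / 2), (Real.sin φ ^ 2 + Real.cos φ ^ 2 * l)⁻¹ =
      Real.pi / 2 * (Real.sqrt l)⁻¹ := by
  set c := Real.sqrt l with hc
  have hc0 : 0 < c := Real.sqrt_pos.2 hl
  have hcl : c ^ 2 = l := Real.sq_sqrt hl.le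
  have hden : ∀ φ, 0 < c * Real.cos φ ^ 2 + Real.sin φ ^ 2 := fun φ => by
    have h1 := Real.sin_sq_add_cos_sq φ
    rcases (sq_nonneg (Real.sin φ)).eq_or_lt with h | h
    · rw [← h] at h1 ⊢
      nlinarith
    · positivity
  have hden2 : ∀ φ, 0 < Real.sin φ ^ 2 + Real.cos φ ^ 2 * l := fun φ => by
    have h1 := Real.sin_sq_add_cos_sq φ
    rcases (sq_nonneg (Real.sin φ)).eq_or_lt with h | h
    · rw [← h] at h1 ⊢
      nlinarith
    · positivity
  -- The usual antiderivative `c⁻¹ arctan (tan φ / c)` breaks down at `π / 2`. Splitting off `φ` by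
  -- the subtraction formula for the arctangent gives an expression that is smooth everywhere.
  have hd : ∀ φ, HasDerivAt (fun φ => c⁻¹ * (φ + Real.arctan
      ((1 - c) * (Real.sin φ * Real.cos φ) / (c * Real.cos φ ^ 2 + Real.sin φ ^ 2))))
      (Real.sin φ ^ 2 + Real.cos φ ^ 2 * l)⁻¹ φ := fun φ => by
    have hs := Real.hasDerivAt_sin φ
    have hk := Real.hasDerivAt_cos φ
    have hn : HasDerivAt (fun φ => (1 - c) * (Real.sin φ * Real.cos φ))
        ((1 - c) * (Real.cos φ * Real.cos φ + Real.sin φ * -Real.sin φ)) φ :=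
      (hs.mul hk).const_mul (1 - c)
    have hm : HasDerivAt (fun φ => c * Real.cos φ ^ 2 + Real.sin φ ^ 2)
        (c * (2 * Real.cos φ * -Real.sin φ) + 2 * Real.sin φ * Real.cos φ) φ := by
      have h := ((hk.pow 2).const_mul c).add (hs.pow 2)
      refine HasDerivAt.congr_deriv (f := fun φ => c * Real.cos φ ^ 2 + Real.sin φ ^ 2) h ?_
      push_cast; ring
    have h1 : HasDerivAt (fun φ => (1 - c) * (Real.sin φ * Real.cos φ) /
        (c * Real.cos φ ^ 2 + Real.sin φ ^ 2)) _ φ := hn.div hm (hden φ).ne'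
    have h2 : HasDerivAt (fun φ => c⁻¹ * (φ + Real.arctan
        ((1 - c) * (Real.sin φ * Real.cos φ) / (c * Real.cos φ ^ 2 + Real.sin φ ^ 2)))) _ φ :=
      ((hasDerivAt_id φ).add h1.arctan).const_mul c⁻¹
    refine h2.congr_deriv ?_
    have := (hden φ).ne'
    have h3 := (hden2 φ).ne'
    have h4 := Real.sin_sq_add_cos_sq φ
    set s := Real.sin φ
    set k := Real.cos φ
    rw [← hcl] at h3 ⊢
    have h5 : 0 < (c * k ^ 2 + s ^ 2) ^ 2 + ((1 - c) * (s * k)) ^ 2 := by positivity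
    have h5' := h5.ne'
    have h6 : (c * k ^ 2 + s ^ 2) ^ 2 + ((1 - c) * (s * k)) ^ 2 = s ^ 2 + k ^ 2 * c ^ 2 := by
      have : s ^ 2 = 1 - k ^ 2 := by linarith
      have h7 : s ^ 2 + k ^ 2 * c ^ 2 = (s ^ 2 + k ^ 2 * c ^ 2) * (s ^ 2 + k ^ 2) := by
        rw [h4, mul_one]
      rw [h7]; ring
    have h8 : 1 + ((1 - c) * (s * k) / (c * k ^ 2 + s ^ 2)) ^ 2 =
        (s ^ 2 + k ^ 2 * c ^ 2) / (c * k ^ 2 + s ^ 2) ^ 2 := by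
      rw [← h6]; field_simp
    have h9 : (1 - c) * (k * k + s * -s) * (c * k ^ 2 + s ^ 2) -
        (1 - c) * (s * k) * (c * (2 * k * -s) + 2 * s * k) = c - (s ^ 2 + k ^ 2 * c ^ 2) := by
      have : (1 - c) * (k * k + s * -s) * (c * k ^ 2 + s ^ 2) -
        (1 - c) * (s * k) * (c * (2 * k * -s) + 2 * s * k) =
          (1 - c) * ((c * k ^ 2 - s ^ 2) * (s ^ 2 + k ^ 2)) := by ring
      rw [this, h4]
      linear_combination c * h4
    have h10 : ∀ X D : ℝ, X ≠ 0 → D ≠ 0 → c⁻¹ * (1 + 1 / (X / D ^ 2) * ((c - X) / D ^ 2)) = X⁻¹ := by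
      intro X D hX hD
      have := hc0.ne'
      rw [show 1 / (X / D ^ 2) * ((c - X) / D ^ 2) = (c - X) / X by field_simp, sub_div,
        div_self hX]
      field_simp
      ring
    rw [h8, h9, h10 _ _ h3 this]
  rw [intervalIntegral.integral_eq_sub_of_hasDerivAt (fun φ _ => hd φ)]
  · simp
    ring
  · refine Continuous.intervalIntegrable ?_ _ _
    exact Continuous.inv₀ (by fun_prop) fun φ => (hden2 φ).ne'

variable {V : Type*} [NormedAddCommGroup V] [NormedSpace ℝ V]

/-- Positive definite symmetric bilinear forms. -/
structure IsPosForm (g : V →L[ℝ] V →L[ℝ] ℝ) : Prop where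
  symm : ∀ u w, g u w = g w u
  pos : ∀ u, u ≠ 0 → 0 < g u u

/-- `(h⁻¹ g)^{1/2}` for positive definite forms `g` and `h`; it maps `g` isometrically to `h`. -/
def polarFactor (g h : V →L[ℝ] V →L[ℝ] ℝ) : V →L[ℝ] V :=
  (2 / Real.pi) • ∫ φ in Icc (0 : ℝ) (Real.pi / 2),
    (Real.sin φ ^ 2 • g + Real.cos φ ^ 2 • h).inverse ∘L g

variable [FiniteDimensional ℝ V]

theorem IsPosForm.isInvertible {g : V →L[ℝ] V →L[ℝ] ℝ} (hg : IsPosForm g) : g.IsInvertible := by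
  have hinj : Function.Injective g.toLinearMap := by
    refine (injective_iff_map_eq_zero _).2 fun u hu => ?_
    by_contra h
    have h1 : g u = 0 := hu
    simpa [h1] using hg.pos u h
  have hdim : Module.finrank ℝ V = Module.finrank ℝ (V →L[ℝ] ℝ) := by
    rw [← (LinearMap.toContinuousLinearMap (𝕜 := ℝ) (E := V) (F' := ℝ)).finrank_eq]
    exact Subspace.dual_finrank_eq.symm
  exact ⟨(LinearMap.linearEquivOfInjective g.toLinearMap hinj hdim).toContinuousLinearEquiv, by
    ext; rfl⟩

variable {g h : V →L[ℝ] V →L[ℝ] ℝ}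

omit [FiniteDimensional ℝ V] in
theorem IsPosForm.combination (hg : IsPosForm g) (hh : IsPosForm h) (φ : ℝ) :
    IsPosForm (Real.sin φ ^ 2 • g + Real.cos φ ^ 2 • h) where
  symm u w := by simp [hg.symm u w, hh.symm u w]
  pos u hu := by
    have h1 := hg.pos u hu
    have h2 := hh.pos u hu
    have h3 := Real.sin_sq_add_cos_sq φ
    simp only [_root_.add_apply, _root_.smul_apply, smul_eq_mul]
    rcases (sq_nonneg (Real.sin φ)).eq_or_lt with h | h
    · rw [← h] at h3 ⊢
      nlinarith
    · positivity

omit [FiniteDimensional ℝ V] in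
theorem ContDiffAt.contMDiffAt_prod {A B W : Type*} [NormedAddCommGroup A] [NormedSpace ℝ A]
    [NormedAddCommGroup B] [NormedSpace ℝ B] [NormedAddCommGroup W] [NormedSpace ℝ W]
    {f : A × B → W} {p : A × B} {n : WithTop ℕ∞} (hf : ContDiffAt ℝ n f p) :
    ContMDiffAt (𝓘(ℝ, A).prod 𝓘(ℝ, B)) 𝓘(ℝ, W) n f p := by
  rw [← contMDiffAt_iff_contDiffAt, modelWithCornersSelf_prod, ← chartedSpaceSelf_prod] at hf
  exact hf

omit [FiniteDimensional ℝ V] in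
theorem contDiff_sin_sq_smul_add_cos_sq_smul {n : WithTop ℕ∞} :
    ContDiff ℝ n (fun p : ℝ × V × V => Real.sin p.1 ^ 2 • p.2.1 + Real.cos p.1 ^ 2 • p.2.2) := by
  have h1 : ContDiff ℝ n (fun p : ℝ × V × V => Real.sin p.1) := Real.contDiff_sin.comp contDiff_fst
  have h2 : ContDiff ℝ n (fun p : ℝ × V × V => Real.cos p.1) := Real.contDiff_cos.comp contDiff_fst
  exact ((h1.pow 2).smul (contDiff_fst.comp contDiff_snd)).add
    ((h2.pow 2).smul (contDiff_snd.comp contDiff_snd))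

/-- The weighted sum of the two forms is positive definite, hence invertible. Invertibility is an
open condition, and inversion is smooth where it holds. -/
theorem contDiffAt_polarFactor_integrand (hg : IsPosForm g) (hh : IsPosForm h) (φ : ℝ) :
    ∀ᶠ z : ((V →L[ℝ] V →L[ℝ] ℝ) × (V →L[ℝ] V →L[ℝ] ℝ)) × ℝ in 𝓝 ((g, h), φ),
    ContDiffAt ℝ ∞ (fun p : ℝ × (V →L[ℝ] V →L[ℝ] ℝ) × (V →L[ℝ] V →L[ℝ] ℝ) =>
      (Real.sin p.1 ^ 2 • p.2.1 + Real.cos p.1 ^ 2 • p.2.2).inverse ∘L p.2.1) (z.2, z.1) := by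
  have hopen : IsOpen {A : V →L[ℝ] V →L[ℝ] ℝ | A.IsInvertible} := by
    exact ContinuousLinearEquiv.isOpen (𝕜 := ℝ) (E := V) (F := V →L[ℝ] ℝ)
  have hc : ContinuousAt (fun z : ((V →L[ℝ] V →L[ℝ] ℝ) × (V →L[ℝ] V →L[ℝ] ℝ)) × ℝ =>
      Real.sin z.2 ^ 2 • z.1.1 + Real.cos z.2 ^ 2 • z.1.2) ((g, h), φ) :=
    ((contDiff_sin_sq_smul_add_cos_sq_smul (V := V →L[ℝ] V →L[ℝ] ℝ) (n := 0)).continuous.comp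
      continuous_swap).continuousAt
  filter_upwards [hc (hopen.mem_nhds (hg.combination hh φ).isInvertible)] with z hz
  have h1 := (contDiff_sin_sq_smul_add_cos_sq_smul (V := V →L[ℝ] V →L[ℝ] ℝ)
    (n := ∞)).contDiffAt (x := (z.2, z.1))
  have h2 := ContDiffAt.comp (z.2, z.1) (ContinuousLinearMap.IsInvertible.contDiffAt_map_inverse
    (n := ∞) (𝕜 := ℝ) (e := Real.sin z.2 ^ 2 • z.1.1 + Real.cos z.2 ^ 2 • z.1.2) hz) h1
  exact h2.clm_comp (contDiffAt_fst.comp _ contDiffAt_snd)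

set_option synthInstance.maxHeartbeats 200000 in
theorem contDiffAt_polarFactor (hg : IsPosForm g) (hh : IsPosForm h) :
    ContDiffAt ℝ ∞ (fun p : (V →L[ℝ] V →L[ℝ] ℝ) × (V →L[ℝ] V →L[ℝ] ℝ) =>
      polarFactor p.1 p.2) (g, h) := by
  refine ContDiffAt.const_smul _ ?_
  rw [← contMDiffAt_iff_contDiffAt]
  refine contMDiffAt_integral (J := 𝓘(ℝ, ℝ)) (F := fun (φ : ℝ)
    (p : (V →L[ℝ] V →L[ℝ] ℝ) × (V →L[ℝ] V →L[ℝ] ℝ)) =>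
    (Real.sin φ ^ 2 • p.1 + Real.cos φ ^ 2 • p.2).inverse ∘L p.1)
    (K := Icc (0 : ℝ) (Real.pi / 2)) isCompact_Icc (by simp) ?_
  refine isCompact_Icc.eventually_forall_of_forall_eventually (P := fun p (φ : ℝ) => ContMDiffAt _ _ _ _ (φ, p)) fun φ _ => ?_
  exact (contDiffAt_polarFactor_integrand hg hh φ).mono fun z hz => hz.contMDiffAt_prod

-- On a vector with `h u = l • g u` the integrand acts as the scalar `(sin² φ + l cos² φ)⁻¹`. Its
-- normalized integral is `l^{-1/2}`, which justifies reading `polarFactor` as a square root.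
set_option synthInstance.maxHeartbeats 200000 in
theorem polarFactor_apply_of_eigen (hg : IsPosForm g) (hh : IsPosForm h) {u : V} {l : ℝ}
    (hl : 0 < l) (hu : h u = l • g u) : polarFactor g h u = (Real.sqrt l)⁻¹ • u := by
  have hcont : Continuous fun φ : ℝ =>
      (Real.sin φ ^ 2 • g + Real.cos φ ^ 2 • h).inverse ∘L g := by
    refine continuous_iff_continuousAt.2 fun φ => ?_
    have h0 := (contDiffAt_polarFactor_integrand hg hh φ).self_of_nhds
    have h1 : ContinuousAt (fun p : ℝ × (V →L[ℝ] V →L[ℝ] ℝ) × (V →L[ℝ] V →L[ℝ] ℝ) =>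
      (Real.sin p.1 ^ 2 • p.2.1 + Real.cos p.1 ^ 2 • p.2.2).inverse ∘L p.2.1) (φ, (g, h)) :=
      ContDiffAt.continuousAt h0
    exact ContinuousAt.comp (x := φ) (f := fun φ : ℝ => (φ, (g, h))) h1
      (continuousAt_id.prodMk continuousAt_const)
  have hint := (hcont.continuousOn (s := Icc (0 : ℝ) (Real.pi / 2))).integrableOn_compact
    (μ := volume) isCompact_Icc
  have hval : ∀ φ : ℝ, ((Real.sin φ ^ 2 • g + Real.cos φ ^ 2 • h).inverse ∘L g) u =
      (Real.sin φ ^ 2 + Real.cos φ ^ 2 * l)⁻¹ • u := fun φ => by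
    have hinv := (hg.combination hh φ).isInvertible
    have hne : Real.sin φ ^ 2 + Real.cos φ ^ 2 * l ≠ 0 := by
      have h3 := Real.sin_sq_add_cos_sq φ
      have : 0 < Real.sin φ ^ 2 + Real.cos φ ^ 2 * l := by
        rcases (sq_nonneg (Real.sin φ)).eq_or_lt with h | h
        · rw [← h] at h3 ⊢
          nlinarith
        · positivity
      exact this.ne'
    rw [ContinuousLinearMap.comp_apply, hinv.inverse_apply_eq]
    simp only [_root_.add_apply, _root_.smul_apply, map_smul, hu]
    rw [smul_smul, ← add_smul, smul_smul, inv_mul_cancel₀ hne, one_smul]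
  rw [polarFactor, _root_.smul_apply, ContinuousLinearMap.integral_apply hint]
  simp only [hval]
  rw [integral_smul_const, integral_Icc_eq_integral_Ioc, ← intervalIntegral.integral_of_le
    (by positivity), Real.integral_inv_sin_sq_add_cos_sq hl, smul_smul]
  congr 1
  field_simp

theorem IsPosForm.exists_basis (hg : IsPosForm g) (hh : IsPosForm h) :
    ∃ (n : ℕ) (e : Module.Basis (Fin n) ℝ V) (l : Fin n → ℝ), (∀ i, 0 < l i) ∧
      ∀ i, h (e i) = l i • g (e i) := by
  obtain ⟨n, e, l, hl⟩ := LinearMap.exists_basis_diagonal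
    ((ContinuousLinearMap.coeLM ℝ).comp g.toLinearMap)
    ((ContinuousLinearMap.coeLM ℝ).comp h.toLinearMap) hg.symm hg.pos hh.symm
  have hl' : ∀ i w, h (e i) w = l i * g (e i) w := hl
  refine ⟨n, e, l, fun i => ?_, fun i => ?_⟩
  · have h1 := hg.pos _ (e.ne_zero i)
    have h2 := hh.pos _ (e.ne_zero i)
    rw [hl'] at h2
    exact pos_of_mul_pos_left h2 h1.le
  · ext w
    exact hl' i w

/-- In a basis of common eigenvectors the factor is diagonal with entries `l_i^{-1/2}`. Pairs with
equal eigenvalues scale correctly, and pairs with different eigenvalues are orthogonal for both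
forms. -/
theorem polarFactor_isometry (hg : IsPosForm g) (hh : IsPosForm h) (u w : V) :
    h (polarFactor g h u) (polarFactor g h w) = g u w := by
  obtain ⟨n, e, l, hl, he⟩ := hg.exists_basis hh
  have hp := fun i => polarFactor_apply_of_eigen hg hh (hl i) (he i)
  have h1 : ∀ i w, h (polarFactor g h (e i)) (polarFactor g h w) = g (e i) w := fun i w => by
    have : (h (polarFactor g h (e i)) ∘L polarFactor g h).toLinearMap = (g (e i)).toLinearMap := by
      refine e.ext fun j => ?_
      simp only [ContinuousLinearMap.coe_coe, ContinuousLinearMap.comp_apply, hp, map_smul,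
        _root_.smul_apply, smul_eq_mul, he]
      rcases eq_or_ne (l i) (l j) with hij | hij
      · rw [← hij, ← mul_assoc, ← mul_assoc, ← mul_inv, Real.mul_self_sqrt (hl i).le,
          inv_mul_cancel₀ (hl i).ne', one_mul]
      · have h0 : g (e i) (e j) = 0 := by
          have h1 : h (e i) (e j) = h (e j) (e i) := hh.symm _ _
          rw [he, he, _root_.smul_apply, _root_.smul_apply,
            hg.symm (e j), smul_eq_mul, smul_eq_mul] at h1
          have h2 : (l i - l j) * g (e i) (e j) = 0 := by linarith
          exact (mul_eq_zero.1 h2).resolve_left (sub_ne_zero.2 hij)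
        simp [h0]
    exact LinearMap.congr_fun this w
  have h2 : ((h.flip (polarFactor g h w)) ∘L polarFactor g h).toLinearMap =
      (g.flip w).toLinearMap := e.ext fun i => by simpa using h1 i w
  exact LinearMap.congr_fun h2 u

theorem polarFactor_self (hg : IsPosForm g) (u : V) : polarFactor g g u = u := by
  simpa using polarFactor_apply_of_eigen hg hg (u := u) one_pos (by simp)

/-- A map that is isometric for both pairs of forms carries common eigenvectors to common
eigenvectors with the same eigenvalue. This yields independence of the trivialization as well as
equivariance. -/
theorem polarFactor_naturality {V' : Type*} [NormedAddCommGroup V'] [NormedSpace ℝ V']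
    [FiniteDimensional ℝ V'] {g' h' : V' →L[ℝ] V' →L[ℝ] ℝ} (hg : IsPosForm g) (hh : IsPosForm h)
    (hg' : IsPosForm g') (hh' : IsPosForm h') (T : V ≃ₗ[ℝ] V')
    (h1 : ∀ u w, g' (T u) (T w) = g u w) (h2 : ∀ u w, h' (T u) (T w) = h u w) (u : V) :
    polarFactor g' h' (T u) = T (polarFactor g h u) := by
  obtain ⟨n, e, l, hl, he⟩ := hg.exists_basis hh
  have : (polarFactor g' h').toLinearMap.comp T.toLinearMap =
      T.toLinearMap.comp (polarFactor g h).toLinearMap := by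
    refine e.ext fun i => ?_
    have h3 : h' (T (e i)) = l i • g' (T (e i)) := by
      ext w
      obtain ⟨w, rfl⟩ := T.surjective w
      rw [h2, he, _root_.smul_apply, _root_.smul_apply, h1]
    simp [polarFactor_apply_of_eigen hg hh (hl i) (he i),
      polarFactor_apply_of_eigen hg' hh' (hl i) h3]
  exact LinearMap.congr_fun this u

/-- On common eigenvectors the map is multiplication by `(1 - t) + t l^{-1/2}`, which is positive
for `t` in `[0, 1]`. -/
theorem isInvertible_polarFactor_path (hg : IsPosForm g) (hh : IsPosForm h) {t : ℝ}
    (ht : t ∈ Icc (0 : ℝ) 1) :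
    ((1 - t) • ContinuousLinearMap.id ℝ V + t • polarFactor g h).IsInvertible := by
  obtain ⟨n, e, l, hl, he⟩ := hg.exists_basis hh
  have hpos : ∀ i, 0 < (1 - t) + t * (Real.sqrt (l i))⁻¹ := fun i => by
    have h1 : 0 < (Real.sqrt (l i))⁻¹ := inv_pos.2 (Real.sqrt_pos.2 (hl i))
    rcases ht.1.eq_or_lt with h | h
    · rw [← h]; norm_num
    · have : 0 ≤ 1 - t := by linarith [ht.2]
      positivity
  let D : V →ₗ[ℝ] V := ((1 - t) • ContinuousLinearMap.id ℝ V + t • polarFactor g h).toLinearMap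
  have hD : ∀ i, D (e i) = ((1 - t) + t * (Real.sqrt (l i))⁻¹) • e i := fun i => by
    simp [D, polarFactor_apply_of_eigen hg hh (hl i) (he i), add_smul, smul_smul]
  have hsurj : Function.Surjective D := by
    rw [← LinearMap.range_eq_top, ← top_le_iff, ← e.span_eq, Submodule.span_le]
    rintro _ ⟨i, rfl⟩
    exact ⟨((1 - t) + t * (Real.sqrt (l i))⁻¹)⁻¹ • e i, by
      rw [map_smul, hD, smul_smul, inv_mul_cancel₀ (hpos i).ne', one_smul]⟩
  exact ⟨(LinearEquiv.ofBijective D ⟨LinearMap.injective_iff_surjective.2 hsurj,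
    hsurj⟩).toContinuousLinearEquiv, by ext; rfl⟩

end Polar

/-! ### Fibrewise scaling and trivializations of vector bundles. -/

section BundleBasics

variable {EB : Type*} [NormedAddCommGroup EB] [NormedSpace ℝ EB]
  {B : Type*} [TopologicalSpace B] [ChartedSpace EB B]
  {F : Type*} [NormedAddCommGroup F] [NormedSpace ℝ F]
  {E : B → Type*} [TopologicalSpace (TotalSpace F E)]
  [∀ x, AddCommGroup (E x)] [∀ x, Module ℝ (E x)] [∀ x, TopologicalSpace (E x)]
  [FiberBundle F E] [VectorBundle ℝ F E]

/-- Fibrewise multiplication by a real number. -/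
def fiberSmul (s : ℝ) (v : TotalSpace F E) : TotalSpace F E := ⟨v.proj, s • v.snd⟩

@[simp] theorem fiberSmul_proj (s : ℝ) (v : TotalSpace F E) : (fiberSmul s v).proj = v.proj := rfl

theorem fiberSmul_mk (s : ℝ) (x : B) (v : E x) :
    fiberSmul s (⟨x, v⟩ : TotalSpace F E) = ⟨x, s • v⟩ := rfl

theorem fiberSmul_fiberSmul (s t : ℝ) (v : TotalSpace F E) :
    fiberSmul s (fiberSmul t v) = fiberSmul (s * t) v :=
  congrArg (TotalSpace.mk v.proj) (smul_smul s t v.snd)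

@[simp] theorem fiberSmul_one (v : TotalSpace F E) : fiberSmul 1 v = v := by
  simp [fiberSmul]

theorem fiberSmul_zero (v : TotalSpace F E) : fiberSmul 0 v = ⟨v.proj, 0⟩ := by
  simp [fiberSmul]

@[simp] theorem fiberSmul_zero_section (s : ℝ) (x : B) :
    fiberSmul s (⟨x, 0⟩ : TotalSpace F E) = ⟨x, 0⟩ := by
  simp [fiberSmul]

/-- Uniqueness of limits in the total space is what extends identities from `s ≠ 0` to `s = 0` in
the blow-up. -/
theorem t2Space_totalSpace [T2Space B] : T2Space (TotalSpace F E) := by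
  refine ⟨fun v w hvw => ?_⟩
  by_cases h : v.proj = w.proj
  · let e := trivializationAt F E v.proj
    have hv : v ∈ e.source := FiberBundle.mem_trivializationAt_proj_source
    have hw : w ∈ e.source := by
      rw [e.mem_source, ← h]; exact mem_baseSet_trivializationAt F E _
    have hne : e v ≠ e w := fun h => hvw (e.injOn hv hw h)
    have hne2 : (e v).2 ≠ (e w).2 := fun h2 => hne (Prod.ext (by
      rw [e.coe_fst hv, e.coe_fst hw, h]) h2)
    obtain ⟨a, b, ha, hb, hva, hwb, hab⟩ := t2_separation hne2
    have hc : ContinuousOn (fun z => (e z).2) e.source := continuous_snd.comp_continuousOn e.continuousOn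
    exact ⟨_, _, hc.isOpen_inter_preimage e.open_source ha,
      hc.isOpen_inter_preimage e.open_source hb, ⟨hv, hva⟩, ⟨hw, hwb⟩,
      (hab.preimage (fun z => (e z).2)).mono inter_subset_right inter_subset_right⟩
  · obtain ⟨a, b, ha, hb, hva, hwb, hab⟩ := t2_separation h
    exact ⟨_, _, ha.preimage (FiberBundle.continuous_proj F E),
      hb.preimage (FiberBundle.continuous_proj F E), hva, hwb, hab.preimage _⟩

theorem trivialization_snd_fiberSmul {e : Trivialization F (π F E)} [MemTrivializationAtlas e]
    {v : TotalSpace F E} (hv : v.proj ∈ e.baseSet) (s : ℝ) :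
    (e (fiberSmul s v)).2 = s • (e v).2 :=
  (e.linear ℝ hv).map_smul s v.snd

variable [IsManifold 𝓘(ℝ, EB) ∞ B] [ContMDiffVectorBundle ∞ F E 𝓘(ℝ, EB)]

theorem contMDiffAt_trivialization_symm {e : Trivialization F (π F E)} [MemTrivializationAtlas e]
    {p : B × F} (hp : p.1 ∈ e.baseSet) :
    ContMDiffAt (𝓘(ℝ, EB).prod 𝓘(ℝ, F)) (𝓘(ℝ, EB).prod 𝓘(ℝ, F)) ∞
      (fun p : B × F => (⟨p.1, e.symm p.1 p.2⟩ : TotalSpace F E)) p := by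
  have h1 := (e.contMDiffOn_symm (IB := 𝓘(ℝ, EB)) (n := ∞)).contMDiffAt
    (e.open_target.mem_nhds (e.mem_target.2 hp))
  refine h1.congr_of_eventuallyEq ?_
  filter_upwards [(e.open_baseSet.preimage continuous_fst).mem_nhds hp] with z hz
  exact e.mk_symm hz z.2

theorem contMDiffAt_trivialization {e : Trivialization F (π F E)} [MemTrivializationAtlas e]
    {v : TotalSpace F E} (hv : v.proj ∈ e.baseSet) :
    ContMDiffAt (𝓘(ℝ, EB).prod 𝓘(ℝ, F)) (𝓘(ℝ, EB).prod 𝓘(ℝ, F)) ∞ e v :=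
  (e.contMDiffOn (IB := 𝓘(ℝ, EB)) (n := ∞)).contMDiffAt (e.open_source.mem_nhds (e.mem_source.2 hv))

theorem contMDiff_fiberSmul : ContMDiff (𝓘(ℝ, ℝ).prod (𝓘(ℝ, EB).prod 𝓘(ℝ, F)))
    (𝓘(ℝ, EB).prod 𝓘(ℝ, F)) ∞ (fun p : ℝ × TotalSpace F E => fiberSmul p.1 p.2) := by
  intro p
  let e := trivializationAt F E p.2.proj
  have hp : p.2.proj ∈ e.baseSet := mem_baseSet_trivializationAt F E _
  have h0 : ContMDiffAt (𝓘(ℝ, ℝ).prod (𝓘(ℝ, EB).prod 𝓘(ℝ, F))) 𝓘(ℝ, EB) ∞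
      (fun p : ℝ × TotalSpace F E => p.2.proj) p :=
    (contMDiff_proj E).contMDiffAt.comp p contMDiffAt_snd
  refine (e.contMDiffAt_iff (f := fun p : ℝ × TotalSpace F E => fiberSmul p.1 p.2) (x₀ := p)
    (e.mem_source.2 hp)).2 ⟨h0, ?_⟩
  have h1 : ContMDiffAt (𝓘(ℝ, ℝ).prod (𝓘(ℝ, EB).prod 𝓘(ℝ, F))) 𝓘(ℝ, F) ∞
      (fun p : ℝ × TotalSpace F E => p.1 • (e p.2).2) p :=
    contMDiffAt_fst.smul (contMDiffAt_snd.comp p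
      ((contMDiffAt_trivialization hp).comp p contMDiffAt_snd))
  refine h1.congr_of_eventuallyEq ?_
  filter_upwards [(e.open_baseSet.preimage ((FiberBundle.continuous_proj F E).comp
    continuous_snd)).mem_nhds hp] with z hz
  exact trivialization_snd_fiberSmul hz _

end BundleBasics

/-! ### Riemannian metrics on bundles: smoothness of the norm and disc bundles. -/

section Metric

variable {EB : Type*} [NormedAddCommGroup EB] [NormedSpace ℝ EB]
  {B : Type*} [TopologicalSpace B] [ChartedSpace EB B]
  {F : Type*} [NormedAddCommGroup F] [NormedSpace ℝ F]
  {E : B → Type*} [TopologicalSpace (TotalSpace F E)]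
  [∀ x, AddCommGroup (E x)] [∀ x, Module ℝ (E x)] [∀ x, TopologicalSpace (E x)]
  [∀ x, IsTopologicalAddGroup (E x)] [∀ x, ContinuousConstSMul ℝ (E x)]
  [FiberBundle F E] [VectorBundle ℝ F E]
  [IsManifold 𝓘(ℝ, EB) ∞ B] [ContMDiffVectorBundle ∞ F E 𝓘(ℝ, EB)]

namespace Bundle.ContMDiffRiemannianMetric

variable (g : ContMDiffRiemannianMetric 𝓘(ℝ, EB) ∞ F E)

/-- The quadratic form of a Riemannian metric, as a function on the total space. -/
def normSq (v : TotalSpace F E) : ℝ := g.inner v.proj v.snd v.snd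

/-- The bilinear form on the model fibre given by the metric at `x`, in a trivialization. -/
def localForm (e : Trivialization F (π F E)) [MemTrivializationAtlas e] (x : B) :
    F →L[ℝ] F →L[ℝ] ℝ :=
  (ContinuousLinearMap.precomp ℝ (e.symmL ℝ x)) ∘L (g.inner x) ∘L e.symmL ℝ x

theorem localForm_apply (e : Trivialization F (π F E)) [MemTrivializationAtlas e] {x : B}
    (hx : x ∈ e.baseSet) (u w : F) :
    g.localForm e x u w = g.inner x (e.symm x u) (e.symm x w) := by
  simp [localForm, hx]

theorem isPosForm_localForm (e : Trivialization F (π F E)) [MemTrivializationAtlas e] {x : B}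
    (hx : x ∈ e.baseSet) : IsPosForm (g.localForm e x) where
  symm u w := by rw [localForm_apply g e hx, localForm_apply g e hx]; exact g.symm _ _ _
  pos u hu := by
    rw [localForm_apply g e hx]
    refine g.pos _ _ fun h => hu ?_
    have := e.apply_mk_symm hx u
    rw [h] at this
    have h2 := congrArg Prod.snd (e.zeroSection ℝ hx)
    simp only [zeroSection] at h2
    rw [this] at h2
    exact h2

theorem contMDiffAt_localForm (x₀ : B) :
    ContMDiffAt 𝓘(ℝ, EB) 𝓘(ℝ, F →L[ℝ] F →L[ℝ] ℝ) ∞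
      (g.localForm (trivializationAt F E x₀)) x₀ := by
  have h := (contMDiffAt_hom_bundle _).1 (g.contMDiff x₀)
  refine h.2.congr_of_eventuallyEq ?_
  filter_upwards [(trivializationAt F E x₀).open_baseSet.mem_nhds
    (mem_baseSet_trivializationAt F E x₀)] with x hx
  ext u w
  rw [localForm_apply g _ hx]
  erw [inCoordinates_apply_eq₂ hx hx (mem_univ _)]
  simp

theorem normSq_eq_localForm (e : Trivialization F (π F E)) [MemTrivializationAtlas e]
    {v : TotalSpace F E} (hv : v.proj ∈ e.baseSet) :
    g.normSq v = g.localForm e v.proj (e v).2 (e v).2 := by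
  have h : e.symm v.proj (e v).2 = v.snd := by
    have := e.symm_apply_apply_mk hv v.snd
    exact this
  rw [localForm_apply g e hv, h]; rfl

theorem contMDiff_normSq : ContMDiff (𝓘(ℝ, EB).prod 𝓘(ℝ, F)) 𝓘(ℝ, ℝ) ∞ g.normSq := by
  intro v
  let e := trivializationAt F E v.proj
  have hv : v.proj ∈ e.baseSet := mem_baseSet_trivializationAt F E _
  have h1 : ContMDiffAt (𝓘(ℝ, EB).prod 𝓘(ℝ, F)) 𝓘(ℝ, F →L[ℝ] F →L[ℝ] ℝ) ∞
      (fun v : TotalSpace F E => g.localForm e v.proj) v :=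
    (g.contMDiffAt_localForm v.proj).comp v (contMDiff_proj E).contMDiffAt
  have h2 : ContMDiffAt (𝓘(ℝ, EB).prod 𝓘(ℝ, F)) 𝓘(ℝ, F) ∞ (fun v => (e v).2) v :=
    contMDiffAt_snd.comp v (contMDiffAt_trivialization hv)
  refine ((h1.clm_apply h2).clm_apply h2).congr_of_eventuallyEq ?_
  filter_upwards [(e.open_baseSet.preimage (FiberBundle.continuous_proj F E)).mem_nhds hv] with z hz
  exact g.normSq_eq_localForm e hz

@[simp] theorem normSq_zero (x : B) : g.normSq (⟨x, 0⟩ : TotalSpace F E) = 0 := by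
  simp [normSq]

theorem normSq_fiberSmul (s : ℝ) (v : TotalSpace F E) :
    g.normSq (fiberSmul s v) = s ^ 2 * g.normSq v := by
  change g.inner v.proj (s • v.snd) (s • v.snd) = s ^ 2 * g.inner v.proj v.snd v.snd
  rw [ContinuousLinearMap.map_smul, ContinuousLinearMap.map_smul, _root_.smul_apply, smul_eq_mul, smul_eq_mul]
  ring

theorem normSq_pos {v : TotalSpace F E} (hv : v.snd ≠ 0) : 0 < g.normSq v := g.pos _ _ hv

theorem normSq_nonneg (v : TotalSpace F E) : 0 ≤ g.normSq v := by
  by_cases h : v.snd = 0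
  · simp [normSq, h]
  · exact (g.normSq_pos h).le

variable [FiniteDimensional ℝ F]

/-- The local form has a positive minimum on the compact unit sphere of the model fibre. Half of it
is still a lower bound for nearby base points, and homogeneity extends the bound to all vectors. -/
theorem exists_lower_bound (x₀ : B) :
    ∃ m > 0, ∀ᶠ x in 𝓝 x₀, x ∈ (trivializationAt F E x₀).baseSet ∧
      ∀ v : TotalSpace F E, v.proj = x → m * ‖(trivializationAt F E x₀ v).2‖ ^ 2 ≤ g.normSq v := by
  set e := trivializationAt F E x₀ with he
  have hx₀ : x₀ ∈ e.baseSet := mem_baseSet_trivializationAt F E x₀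
  have hK : IsCompact (Metric.sphere (0 : F) 1) := isCompact_sphere 0 1
  have hcont : Continuous fun u : F => g.localForm e x₀ u u := by fun_prop
  obtain ⟨m, hm, hmK⟩ : ∃ m > 0, ∀ u ∈ Metric.sphere (0 : F) 1, m < g.localForm e x₀ u u := by
    rcases (Metric.sphere (0 : F) 1).eq_empty_or_nonempty with h | h
    · exact ⟨1, one_pos, by simp [h]⟩
    · obtain ⟨u, hu, hmin⟩ := hK.exists_isMinOn h hcont.continuousOn
      have hpos : 0 < g.localForm e x₀ u u := (g.isPosForm_localForm e hx₀).pos u fun h => by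
        simp [h] at hu
      exact ⟨_, half_pos hpos, fun w hw => lt_of_lt_of_le (half_lt_self hpos) (hmin hw)⟩
  have hev : ∀ᶠ x in 𝓝 x₀, ∀ u ∈ Metric.sphere (0 : F) 1, m < g.localForm e x u u := by
    refine hK.eventually_forall_of_forall_eventually
      (P := fun x u => m < g.localForm e x u u) fun u hu => ?_
    have h1 : ContinuousAt (fun z : B × F => g.localForm e z.1) (x₀, u) :=
      ContinuousAt.comp (x := (x₀, u)) (f := fun z : B × F => z.1) (g := g.localForm e)
        (g.contMDiffAt_localForm x₀).continuousAt continuousAt_fst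
    have h2 : ContinuousAt (fun z : B × F => g.localForm e z.1 z.2 z.2) (x₀, u) :=
      (h1.clm_apply continuousAt_snd).clm_apply continuousAt_snd
    exact h2.eventually_const_lt (hmK u hu)
  refine ⟨m, hm, ?_⟩
  filter_upwards [hev, e.open_baseSet.mem_nhds hx₀] with x hx hxe
  refine ⟨hxe, fun v hv => ?_⟩
  subst hv
  rw [g.normSq_eq_localForm e hxe]
  rcases eq_or_ne (e v).2 0 with h | h
  · simp [h]
  · have hn : ‖(e v).2‖ ≠ 0 := norm_ne_zero_iff.2 h
    have h1 := (hx (‖(e v).2‖⁻¹ • (e v).2) (by simp [norm_smul, hn])).le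
    simp only [map_smul, _root_.smul_apply, smul_eq_mul] at h1
    have h2 : 0 < ‖(e v).2‖ ^ 2 := by positivity
    calc m * ‖(e v).2‖ ^ 2 ≤ (‖(e v).2‖⁻¹ * (‖(e v).2‖⁻¹ * g.localForm e v.proj (e v).2 (e v).2)) *
          ‖(e v).2‖ ^ 2 := by gcongr
      _ = _ := by field_simp

/-- A neighbourhood of a zero vector contains a small disc bundle around it. -/
theorem exists_disc_subset {N : Set (TotalSpace F E)} {x₀ : B}
    (hN : N ∈ 𝓝 (⟨x₀, 0⟩ : TotalSpace F E)) :
    ∃ c > 0, ∀ᶠ x in 𝓝 x₀, ∀ v : TotalSpace F E, v.proj = x → g.normSq v ≤ c → v ∈ N := by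
  obtain ⟨m, hm, hlow⟩ := g.exists_lower_bound x₀
  set e := trivializationAt F E x₀ with he
  have hx₀ : x₀ ∈ e.baseSet := mem_baseSet_trivializationAt F E x₀
  have hz : e (⟨x₀, 0⟩ : TotalSpace F E) = (x₀, 0) := e.zeroSection ℝ hx₀
  have hN' : e.toOpenPartialHomeomorph.symm ⁻¹' N ∈ 𝓝 (x₀, (0 : F)) := by
    have h1 : ContinuousAt e.toOpenPartialHomeomorph.symm (x₀, (0 : F)) :=
      e.toOpenPartialHomeomorph.continuousOn_symm.continuousAt (e.open_target.mem_nhds (e.mem_target.2 hx₀))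
    refine h1 ?_
    rw [← hz, e.symm_apply_apply (e.mem_source.2 hx₀)]
    exact hN
  rw [nhds_prod_eq, Filter.mem_prod_iff] at hN'
  obtain ⟨W, hW, R, hR, hWR⟩ := hN'
  obtain ⟨r, hr, hrR⟩ := Metric.mem_nhds_iff.1 hR
  refine ⟨m * (r / 2) ^ 2, by positivity, ?_⟩
  filter_upwards [hlow, hW] with x hx hxW v hv hvc
  have h1 := (hx.2 v hv).trans hvc
  have h2 : ‖(e v).2‖ ≤ r / 2 := by
    have h3 := le_of_mul_le_mul_left h1 hm
    exact (sq_le_sq₀ (norm_nonneg _) (by positivity)).1 h3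
  have h4 : e v ∈ W ×ˢ R := by
    refine ⟨?_, hrR (by simpa using lt_of_le_of_lt h2 (half_lt_self hr))⟩
    rw [e.coe_fst' (hv ▸ hx.1), hv]; exact hxW
  have := hWR h4
  rwa [mem_preimage, e.symm_apply_apply (e.mem_source.2 (hv ▸ hx.1))] at this

theorem exists_disc_subset_of_isCompact {N : Set (TotalSpace F E)} {C : Set B} (hC : IsCompact C)
    (hN : ∀ x ∈ C, N ∈ 𝓝 (⟨x, 0⟩ : TotalSpace F E)) :
    ∃ c > 0, ∀ v : TotalSpace F E, v.proj ∈ C → g.normSq v ≤ c → v ∈ N := by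
  refine hC.induction_on (p := fun C => ∃ c > 0, ∀ v : TotalSpace F E, v.proj ∈ C →
    g.normSq v ≤ c → v ∈ N) ⟨1, one_pos, by simp⟩ ?_ ?_ ?_
  · rintro s t hst ⟨c, hc, h⟩
    exact ⟨c, hc, fun v hv => h v (hst hv)⟩
  · rintro s t ⟨c, hc, h⟩ ⟨c', hc', h'⟩
    exact ⟨min c c', lt_min hc hc', fun v hv hvc => hv.elim
      (fun hv => h v hv (hvc.trans (min_le_left _ _)))
      fun hv => h' v hv (hvc.trans (min_le_right _ _))⟩
  · intro x hx
    obtain ⟨c, hc, h⟩ := g.exists_disc_subset (hN x hx)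
    exact ⟨_, mem_nhdsWithin_of_mem_nhds h, c, hc, fun v hv hvc => hv v rfl hvc⟩

/-- By the local lower bound, a disc bundle over a small compact set lies in the image of a product
of this set with a closed ball of the model fibre; finitely many such sets cover. -/
theorem isCompact_disc [T2Space B] [LocallyCompactSpace B] {C : Set B} (hC : IsCompact C) (c : ℝ) :
    IsCompact {v : TotalSpace F E | v.proj ∈ C ∧ g.normSq v ≤ c} := by
  obtain ⟨K, hK, hKs⟩ : ∃ K, IsCompact K ∧ {v : TotalSpace F E | v.proj ∈ C ∧ g.normSq v ≤ c} ⊆ K := by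
    refine hC.induction_on (p := fun C => ∃ K, IsCompact K ∧
      {v : TotalSpace F E | v.proj ∈ C ∧ g.normSq v ≤ c} ⊆ K) ⟨∅, isCompact_empty, by simp⟩ ?_ ?_ ?_
    · rintro s t hst ⟨K, hK, h⟩
      exact ⟨K, hK, fun v hv => h ⟨hst hv.1, hv.2⟩⟩
    · rintro s t ⟨K, hK, h⟩ ⟨K', hK', h'⟩
      exact ⟨K ∪ K', hK.union hK', fun v hv => hv.1.elim (fun hs => Or.inl (h ⟨hs, hv.2⟩))
        fun ht => Or.inr (h' ⟨ht, hv.2⟩)⟩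
    · intro x₀ _
      obtain ⟨m, hm, hlow⟩ := g.exists_lower_bound x₀
      set e := trivializationAt F E x₀ with he
      obtain ⟨W, hW, hWs, hWc⟩ := local_compact_nhds hlow
      have hbs : ∀ x ∈ W, x ∈ e.baseSet := fun x hx => (hWs hx).1
      refine ⟨W, mem_nhdsWithin_of_mem_nhds hW, e.toOpenPartialHomeomorph.symm ''
        (W ×ˢ Metric.closedBall 0 (Real.sqrt (|c| / m))), ?_, ?_⟩
      · refine (hWc.prod (isCompact_closedBall _ _)).image_of_continuousOn
          (e.toOpenPartialHomeomorph.continuousOn_symm.mono fun p hp => e.mem_target.2 (hbs _ hp.1))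
      · intro v hv
        have hvb := hbs _ hv.1
        refine ⟨e v, ⟨by rw [e.coe_fst' hvb]; exact hv.1, ?_⟩, e.symm_apply_apply (e.mem_source.2 hvb)⟩
        have h1 := ((hWs hv.1).2 v rfl).trans (hv.2.trans (le_abs_self c))
        simp only [Metric.mem_closedBall, dist_zero_right]
        refine Real.le_sqrt_of_sq_le ?_
        rw [le_div_iff₀ hm, mul_comm]; exact h1
  refine hK.of_isClosed_subset ?_ hKs
  exact (hC.isClosed.preimage (FiberBundle.continuous_proj F E)).inter
    (isClosed_le g.contMDiff_normSq.continuous continuous_const)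

end Bundle.ContMDiffRiemannianMetric

end Metric

/-! ### Hadamard's lemma for maps that fix the zero section: the family `s⁻¹ θ(s v)`. -/

section BlowUp

open MeasureTheory Function

/-- This is the fundamental theorem of calculus for `r ↦ b (r s u)`. Its point is that the left side
makes sense, and is smooth, across `s = 0`. -/
theorem integral_fderiv_segment {V W : Type*} [NormedAddCommGroup V] [NormedSpace ℝ V]
    [NormedAddCommGroup W] [NormedSpace ℝ W] [CompleteSpace W] {b : V → W} {u : V} {s : ℝ}
    (hb : ∀ r ∈ Icc (0 : ℝ) 1, ContDiffAt ℝ ∞ b ((r * s) • u)) (h0 : b 0 = 0) (hs : s ≠ 0) :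
    ∫ r in Icc (0 : ℝ) 1, fderiv ℝ b ((r * s) • u) u = s⁻¹ • b (s • u) := by
  have hd : ∀ r ∈ Icc (0 : ℝ) 1, HasDerivAt (fun r : ℝ => b ((r * s) • u))
      (s • fderiv ℝ b ((r * s) • u) u) r := by
    intro r hr
    have h1 : HasDerivAt (fun r : ℝ => (r * s) • u) (s • u) r := by
      simpa using ((hasDerivAt_id r).mul_const s).smul_const u
    have h2 := ((hb r hr).differentiableAt (by simp)).hasFDerivAt.comp_hasDerivAt r h1
    rwa [map_smul] at h2
  have hc : ContinuousOn (fun r : ℝ => fderiv ℝ b ((r * s) • u) u) (Icc 0 1) := by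
    intro r hr
    have h1 : ContinuousAt (fderiv ℝ b) ((r * s) • u) :=
      ((hb r hr).fderiv_right (m := 0) (by simp)).continuousAt
    have h2 : ContinuousAt (fun r : ℝ => fderiv ℝ b ((r * s) • u)) r :=
      ContinuousAt.comp (f := fun r : ℝ => (r * s) • u) h1 (by fun_prop)
    exact (h2.clm_apply continuousAt_const).continuousWithinAt
  have h := intervalIntegral.integral_eq_sub_of_hasDerivAt (a := 0) (b := 1)
    (f := fun r : ℝ => b ((r * s) • u)) (f' := fun r : ℝ => s • fderiv ℝ b ((r * s) • u) u)
    (by rw [uIcc_of_le zero_le_one]; exact hd)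
    (ContinuousOn.intervalIntegrable (by rw [uIcc_of_le zero_le_one]; exact hc.const_smul s))
  rw [intervalIntegral.integral_smul, intervalIntegral.integral_of_le zero_le_one,
    ← integral_Icc_eq_integral_Ioc] at h
  simp only [one_mul, zero_mul, zero_smul, h0, sub_zero] at h
  rw [← h, smul_smul, inv_mul_cancel₀ hs, one_smul]

variable {EB : Type*} [NormedAddCommGroup EB] [NormedSpace ℝ EB]
  {B : Type*} [TopologicalSpace B] [ChartedSpace EB B]
  {F : Type*} [NormedAddCommGroup F] [NormedSpace ℝ F]
  {E : B → Type*} [TopologicalSpace (TotalSpace F E)]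
  [∀ x, AddCommGroup (E x)] [∀ x, Module ℝ (E x)] [∀ x, TopologicalSpace (E x)]
  [FiberBundle F E] [VectorBundle ℝ F E]
  {F' : Type*} [NormedAddCommGroup F'] [NormedSpace ℝ F']
  {E' : B → Type*} [TopologicalSpace (TotalSpace F' E')]
  [∀ x, AddCommGroup (E' x)] [∀ x, Module ℝ (E' x)] [∀ x, TopologicalSpace (E' x)]
  [FiberBundle F' E'] [VectorBundle ℝ F' E']

/-- The fibre component of a map between total spaces in trivializations. -/
def localRep (e : Trivialization F (π F E)) (e' : Trivialization F' (π F' E'))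
    [MemTrivializationAtlas e] (θ : TotalSpace F E → TotalSpace F' E') (x : B) (u : F) : F' :=
  (e' (θ ⟨x, e.symm x u⟩)).2

variable (F E F' E') in
/-- The derivative at the zero section, in fibre direction, of a map that fixes the zero section. -/
def normalDeriv (θ : TotalSpace F E → TotalSpace F' E') (x : B) : E x →L[ℝ] E' x :=
  (trivializationAt F' E' x).symmL ℝ x ∘L
    fderiv ℝ (localRep (trivializationAt F E x) (trivializationAt F' E' x) θ x) 0 ∘L
    (trivializationAt F E x).continuousLinearMapAt ℝ x

open Classical in
/-- The family `s⁻¹ θ(s v)`, extended to `s = 0` by the normal derivative. -/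
def blowUp (θ : TotalSpace F E → TotalSpace F' E') (s : ℝ) (v : TotalSpace F E) :
    TotalSpace F' E' :=
  if s = 0 then ⟨v.proj, normalDeriv F E F' E' θ v.proj v.snd⟩
  else fiberSmul s⁻¹ (θ (fiberSmul s v))

theorem blowUp_zero (θ : TotalSpace F E → TotalSpace F' E') (v : TotalSpace F E) :
    blowUp θ 0 v = ⟨v.proj, normalDeriv F E F' E' θ v.proj v.snd⟩ := if_pos rfl

theorem blowUp_of_ne (θ : TotalSpace F E → TotalSpace F' E') {s : ℝ} (hs : s ≠ 0)
    (v : TotalSpace F E) : blowUp θ s v = fiberSmul s⁻¹ (θ (fiberSmul s v)) := if_neg hs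

theorem blowUp_one (θ : TotalSpace F E → TotalSpace F' E') (v : TotalSpace F E) :
    blowUp θ 1 v = θ v := by simp [blowUp_of_ne θ one_ne_zero]

variable {θ : TotalSpace F E → TotalSpace F' E'} (hθ0 : ∀ x : B, θ ⟨x, 0⟩ = ⟨x, 0⟩)
include hθ0

theorem proj_blowUp (s : ℝ) (v : TotalSpace F E) :
    (blowUp θ s v).proj = (θ (fiberSmul s v)).proj := by
  by_cases hs : s = 0
  · subst hs; rw [blowUp_zero, fiberSmul_zero, hθ0]
  · rw [blowUp_of_ne θ hs]; rfl

theorem blowUp_fiberSmul (s c : ℝ) (v : TotalSpace F E) :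
    blowUp θ s (fiberSmul c v) = fiberSmul c (blowUp θ (s * c) v) := by
  by_cases hs : s = 0
  · subst hs
    rw [zero_mul, blowUp_zero, blowUp_zero]
    exact congrArg (TotalSpace.mk v.proj) (map_smul _ c v.snd)
  by_cases hc : c = 0
  · subst hc
    rw [mul_zero, blowUp_zero, fiberSmul_zero, fiberSmul_zero, blowUp_of_ne θ hs,
      fiberSmul_zero_section, hθ0, fiberSmul_zero_section]
  rw [blowUp_of_ne θ hs, blowUp_of_ne θ (mul_ne_zero hs hc), fiberSmul_fiberSmul,
    fiberSmul_fiberSmul]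
  congr 1
  field_simp

theorem localRep_zero {e : Trivialization F (π F E)} {e' : Trivialization F' (π F' E')}
    [MemTrivializationAtlas e] [MemTrivializationAtlas e'] {x : B} (hx : x ∈ e.baseSet)
    (hx' : x ∈ e'.baseSet) : localRep e e' θ x 0 = 0 := by
  have h1 : e.symm x 0 = 0 := by
    rw [← e.coe_symmₗ (R := ℝ) hx]; exact map_zero _
  rw [localRep, h1, hθ0]
  exact congrArg Prod.snd (e'.zeroSection ℝ hx')

theorem snd_blowUp {e : Trivialization F (π F E)} {e' : Trivialization F' (π F' E')}
    [MemTrivializationAtlas e] [MemTrivializationAtlas e'] {s : ℝ} (hs : s ≠ 0)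
    {v : TotalSpace F E} (hv : v.proj ∈ e.baseSet) (hv' : (θ (fiberSmul s v)).proj ∈ e'.baseSet) :
    (e' (blowUp θ s v)).2 = s⁻¹ • localRep e e' θ v.proj (s • (e v).2) := by
  rw [blowUp_of_ne θ hs, trivialization_snd_fiberSmul hv', localRep,
    ← trivialization_snd_fiberSmul hv]
  congr 5
  exact congrArg (TotalSpace.mk v.proj) (e.symm_apply_apply_mk hv (s • v.snd)).symm

variable [IsManifold 𝓘(ℝ, EB) ∞ B] [ContMDiffVectorBundle ∞ F E 𝓘(ℝ, EB)]
  [ContMDiffVectorBundle ∞ F' E' 𝓘(ℝ, EB)]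

omit hθ0 in
theorem contMDiffAt_localRep {e : Trivialization F (π F E)} {e' : Trivialization F' (π F' E')}
    [MemTrivializationAtlas e] [MemTrivializationAtlas e'] {x : B} {u : F} (hx : x ∈ e.baseSet)
    (hθ : ContMDiffAt (𝓘(ℝ, EB).prod 𝓘(ℝ, F)) (𝓘(ℝ, EB).prod 𝓘(ℝ, F')) ∞ θ ⟨x, e.symm x u⟩)
    (hx' : (θ ⟨x, e.symm x u⟩).proj ∈ e'.baseSet) :
    ContMDiffAt (𝓘(ℝ, EB).prod 𝓘(ℝ, F)) 𝓘(ℝ, F') ∞ (uncurry (localRep e e' θ)) (x, u) := by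
  have h1 := contMDiffAt_trivialization_symm (EB := EB) (e := e) (p := (x, u)) hx
  have h2 := ContMDiffAt.comp (g := θ) (x, u) hθ h1
  have h3 := ContMDiffAt.comp (g := e') (x, u) (contMDiffAt_trivialization (EB := EB) hx') h2
  exact contMDiffAt_snd.comp (x, u) h3

omit hθ0 in
theorem contDiffAt_localRep {e : Trivialization F (π F E)} {e' : Trivialization F' (π F' E')}
    [MemTrivializationAtlas e] [MemTrivializationAtlas e'] {x : B} {u : F} (hx : x ∈ e.baseSet)
    (hθ : ContMDiffAt (𝓘(ℝ, EB).prod 𝓘(ℝ, F)) (𝓘(ℝ, EB).prod 𝓘(ℝ, F')) ∞ θ ⟨x, e.symm x u⟩)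
    (hx' : (θ ⟨x, e.symm x u⟩).proj ∈ e'.baseSet) :
    ContDiffAt ℝ ∞ (localRep e e' θ x) u := by
  have h := contMDiffAt_localRep hx hθ hx'
  exact (ContMDiffAt.comp (f := fun u => (x, u)) u h
    (contMDiffAt_const.prodMk contMDiffAt_id)).contDiffAt

/-- In trivializations the fibre component is a difference quotient. The trivializations are
arbitrary here, so that uniqueness of limits shows the normal derivative, defined with preferred
ones, to be given by the same formula in all of them. -/
theorem tendsto_blowUp {e : Trivialization F (π F E)} {e' : Trivialization F' (π F' E')}
    [MemTrivializationAtlas e] [MemTrivializationAtlas e'] {v : TotalSpace F E}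
    (hv : v.proj ∈ e.baseSet) (hv' : v.proj ∈ e'.baseSet)
    (hθ : ContMDiffAt (𝓘(ℝ, EB).prod 𝓘(ℝ, F)) (𝓘(ℝ, EB).prod 𝓘(ℝ, F')) ∞ θ ⟨v.proj, 0⟩) :
    Filter.Tendsto (fun s => blowUp θ s v) (𝓝[≠] 0)
      (𝓝 ⟨v.proj, e'.symm v.proj (fderiv ℝ (localRep e e' θ v.proj) 0 (e v).2)⟩) := by
  have hsymm0 : e.symm v.proj 0 = 0 := by
    rw [← e.coe_symmₗ (R := ℝ) hv]; exact map_zero _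
  have hd : DifferentiableAt ℝ (localRep e e' θ v.proj) 0 :=
    (contDiffAt_localRep hv (by rw [hsymm0]; exact hθ)
      (by rw [hsymm0, hθ0]; exact hv')).differentiableAt (by simp)
  have h1 : HasDerivAt (fun s : ℝ => s • (e v).2) (e v).2 0 := by
    simpa using (hasDerivAt_id (0 : ℝ)).smul_const (e v).2
  have h2 : HasDerivAt (fun s : ℝ => localRep e e' θ v.proj (s • (e v).2))
      (fderiv ℝ (localRep e e' θ v.proj) 0 (e v).2) 0 :=
    HasFDerivAt.comp_hasDerivAt (l := localRep e e' θ v.proj)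
      (f := fun s : ℝ => s • (e v).2) (0 : ℝ) (by rw [zero_smul]; exact hd.hasFDerivAt) h1
  have h3 := h2.tendsto_slope_zero
  simp only [zero_add, zero_smul, localRep_zero hθ0 hv hv', sub_zero] at h3
  have hcont : ContinuousAt (fun s : ℝ => (θ (fiberSmul s v)).proj) 0 := by
    have h4 : ContinuousAt (fun s : ℝ => fiberSmul s v) 0 :=
      ((contMDiff_fiberSmul (EB := EB)).continuous.comp
        (by fun_prop : Continuous fun s : ℝ => (s, v))).continuousAt
    have h5 : ContinuousAt (fun s : ℝ => θ (fiberSmul s v)) 0 :=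
      ContinuousAt.comp (g := θ) (by rw [fiberSmul_zero]; exact hθ.continuousAt) h4
    exact (FiberBundle.continuous_proj F' E').continuousAt.comp h5
  have hc0 : (θ (fiberSmul 0 v)).proj = v.proj := by rw [fiberSmul_zero, hθ0]
  have hev : ∀ᶠ s in 𝓝 (0 : ℝ), (θ (fiberSmul s v)).proj ∈ e'.baseSet :=
    hcont (by simp only [hc0]; exact e'.open_baseSet.mem_nhds hv')
  have h6 : ContinuousAt (fun p : B × F' => (⟨p.1, e'.symm p.1 p.2⟩ : TotalSpace F' E'))
      (v.proj, fderiv ℝ (localRep e e' θ v.proj) 0 (e v).2) :=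
    (contMDiffAt_trivialization_symm (EB := EB) (e := e')
      (p := (v.proj, fderiv ℝ (localRep e e' θ v.proj) 0 (e v).2)) hv').continuousAt
  have h7 : Filter.Tendsto (fun s : ℝ => (θ (fiberSmul s v)).proj) (𝓝[≠] 0) (𝓝 v.proj) := by
    have := hcont.tendsto
    rw [hc0] at this
    exact this.mono_left nhdsWithin_le_nhds
  refine (h6.tendsto.comp (h7.prodMk_nhds h3)).congr' ?_
  filter_upwards [self_mem_nhdsWithin, nhdsWithin_le_nhds hev] with s hs hse
  have h8 : (blowUp θ s v).proj ∈ e'.baseSet := by rwa [proj_blowUp hθ0]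
  simp only [Function.comp_apply]
  rw [← snd_blowUp hθ0 hs hv hse, ← proj_blowUp hθ0]
  exact congrArg (TotalSpace.mk _) (e'.symm_apply_apply_mk h8 _)

variable [T2Space B]

theorem tendsto_blowUp_normalDeriv {v : TotalSpace F E}
    (hθ : ContMDiffAt (𝓘(ℝ, EB).prod 𝓘(ℝ, F)) (𝓘(ℝ, EB).prod 𝓘(ℝ, F')) ∞ θ ⟨v.proj, 0⟩) :
    Filter.Tendsto (fun s => blowUp θ s v) (𝓝[≠] 0) (𝓝 (blowUp θ 0 v)) := by
  have h := tendsto_blowUp hθ0 (mem_baseSet_trivializationAt F E v.proj)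
    (mem_baseSet_trivializationAt F' E' v.proj) hθ
  convert h using 2
  rw [blowUp_zero, normalDeriv]
  refine congrArg (TotalSpace.mk v.proj) ?_
  simp only [ContinuousLinearMap.comp_apply]
  rw [Trivialization.symmL_apply _ (mem_baseSet_trivializationAt F' E' v.proj),
    Trivialization.continuousLinearMapAt_apply, Trivialization.linearMapAt_apply,
    if_pos (mem_baseSet_trivializationAt F E v.proj)]

theorem snd_blowUp_zero {e : Trivialization F (π F E)} {e' : Trivialization F' (π F' E')}
    [MemTrivializationAtlas e] [MemTrivializationAtlas e'] {v : TotalSpace F E}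
    (hv : v.proj ∈ e.baseSet) (hv' : v.proj ∈ e'.baseSet)
    (hθ : ContMDiffAt (𝓘(ℝ, EB).prod 𝓘(ℝ, F)) (𝓘(ℝ, EB).prod 𝓘(ℝ, F')) ∞ θ ⟨v.proj, 0⟩) :
    (e' (blowUp θ 0 v)).2 = fderiv ℝ (localRep e e' θ v.proj) 0 (e v).2 := by
  have := t2Space_totalSpace (F := F') (E := E')
  rw [tendsto_nhds_unique (tendsto_blowUp_normalDeriv hθ0 hθ) (tendsto_blowUp hθ0 hv hv' hθ)]
  exact congrArg Prod.snd (e'.apply_mk_symm hv' _)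

variable [CompleteSpace F']

/-- Away from `s = 0` the definition is a composition of smooth maps. Near `s = 0` the fibre
component is the integral over `r ∈ [0, 1]` of the fibre derivative of `θ` at `r s v` applied to
`v`, which is smooth in the parameters. -/
theorem contMDiffAt_blowUp {N : Set (TotalSpace F E)} (hN : IsOpen N)
    (hN0 : ∀ x : B, (⟨x, 0⟩ : TotalSpace F E) ∈ N)
    (hθ : ∀ v ∈ N, ContMDiffAt (𝓘(ℝ, EB).prod 𝓘(ℝ, F)) (𝓘(ℝ, EB).prod 𝓘(ℝ, F')) ∞ θ v)
    {s : ℝ} {v : TotalSpace F E} (hv : fiberSmul s v ∈ N) :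
    ContMDiffAt (𝓘(ℝ, ℝ).prod (𝓘(ℝ, EB).prod 𝓘(ℝ, F))) (𝓘(ℝ, EB).prod 𝓘(ℝ, F')) ∞
      (uncurry (blowUp θ)) (s, v) := by
  have hsm := contMDiff_fiberSmul (EB := EB) (F := F) (E := E)
  have hθs : ContMDiffAt (𝓘(ℝ, ℝ).prod (𝓘(ℝ, EB).prod 𝓘(ℝ, F))) (𝓘(ℝ, EB).prod 𝓘(ℝ, F')) ∞
      (fun p : ℝ × TotalSpace F E => θ (fiberSmul p.1 p.2)) (s, v) :=
    ContMDiffAt.comp (g := θ) (f := fun p : ℝ × TotalSpace F E => fiberSmul p.1 p.2) (s, v)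
      (hθ _ hv) (hsm (s, v))
  by_cases hs : s = 0
  swap
  · have h1 : ContMDiffAt (𝓘(ℝ, ℝ).prod (𝓘(ℝ, EB).prod 𝓘(ℝ, F))) 𝓘(ℝ, ℝ) ∞
        (fun p : ℝ × TotalSpace F E => p.1⁻¹) (s, v) :=
      ContMDiffAt.comp (g := fun x : ℝ => x⁻¹) (s, v)
        (contDiffAt_inv ℝ hs).contMDiffAt contMDiffAt_fst
    have h2 := (contMDiff_fiberSmul (EB := EB) (F := F') (E := E')).contMDiffAt.comp (s, v)
      (h1.prodMk hθs)
    refine h2.congr_of_eventuallyEq ?_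
    filter_upwards [(continuous_fst.continuousAt (x := (s, v))).eventually_ne hs] with p hp
    exact blowUp_of_ne θ hp p.2
  subst hs
  set x₀ := v.proj with hx₀
  set e := trivializationAt F E x₀ with he
  set e' := trivializationAt F' E' x₀ with he'
  have hx : v.proj ∈ e.baseSet := mem_baseSet_trivializationAt F E x₀
  have hx' : v.proj ∈ e'.baseSet := mem_baseSet_trivializationAt F' E' x₀
  have hb0 : (blowUp θ 0 v).proj = x₀ := by rw [blowUp_zero]
  have hproj : ContMDiffAt (𝓘(ℝ, ℝ).prod (𝓘(ℝ, EB).prod 𝓘(ℝ, F))) 𝓘(ℝ, EB) ∞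
      (fun p : ℝ × TotalSpace F E => (uncurry (blowUp θ) p).proj) (0, v) := by
    have := (contMDiff_proj (IB := 𝓘(ℝ, EB)) (n := ∞) E').contMDiffAt.comp (0, v) hθs
    exact this.congr_of_eventuallyEq (Filter.Eventually.of_forall fun p => proj_blowUp hθ0 p.1 p.2)
  refine (e'.contMDiffAt_iff (f := uncurry (blowUp θ)) (x₀ := (0, v))
    (e'.mem_source.2 (by simp only [uncurry_apply_pair]; rw [hb0]; exact hx'))).2 ⟨hproj, ?_⟩
  -- Compactness of `[0, 1]` keeps the entire segment of integration in the domain of smoothness and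
  -- in one pair of trivializations.
  have hgood : ∀ᶠ p : ℝ × TotalSpace F E in 𝓝 (0, v), ∀ r ∈ Icc (0 : ℝ) 1,
      p.2.proj ∈ e.baseSet ∧ fiberSmul (r * p.1) p.2 ∈ N ∧
        (θ (fiberSmul (r * p.1) p.2)).proj ∈ e'.baseSet := by
    refine isCompact_Icc.eventually_forall_of_forall_eventually
      (P := fun (p : ℝ × TotalSpace F E) (r : ℝ) => p.2.proj ∈ e.baseSet ∧
        fiberSmul (r * p.1) p.2 ∈ N ∧ (θ (fiberSmul (r * p.1) p.2)).proj ∈ e'.baseSet) fun r _ => ?_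
    have hc : ContinuousAt (fun z : (ℝ × TotalSpace F E) × ℝ => fiberSmul (z.2 * z.1.1) z.1.2)
        ((0, v), r) := (hsm.continuous.comp (by fun_prop :
          Continuous fun z : (ℝ × TotalSpace F E) × ℝ => (z.2 * z.1.1, z.1.2))).continuousAt
    have h0 : fiberSmul (r * 0) v = ⟨x₀, 0⟩ := by rw [mul_zero, fiberSmul_zero]
    have h1 : N ∩ θ ⁻¹' ((fun w : TotalSpace F' E' => w.proj) ⁻¹' e'.baseSet) ∈
        𝓝 (⟨x₀, 0⟩ : TotalSpace F E) := by
      refine Filter.inter_mem (hN.mem_nhds (hN0 _)) ((hθ _ (hN0 _)).continuousAt ?_)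
      rw [hθ0]
      exact (e'.open_baseSet.preimage (FiberBundle.continuous_proj F' E')).mem_nhds hx'
    have h2 : ∀ᶠ z : (ℝ × TotalSpace F E) × ℝ in 𝓝 ((0, v), r), z.1.2.proj ∈ e.baseSet :=
      ((e.open_baseSet.preimage (FiberBundle.continuous_proj F E)).preimage
        (continuous_snd.comp continuous_fst)).mem_nhds hx
    filter_upwards [h2, hc (by simp only; rw [h0]; exact h1)] with z hz1 hz2
    exact ⟨hz1, hz2.1, hz2.2⟩
  have hrep : ∀ p : ℝ × TotalSpace F E, (∀ r ∈ Icc (0 : ℝ) 1,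
      p.2.proj ∈ e.baseSet ∧ fiberSmul (r * p.1) p.2 ∈ N ∧
        (θ (fiberSmul (r * p.1) p.2)).proj ∈ e'.baseSet) → ∀ r ∈ Icc (0 : ℝ) 1,
      ContMDiffAt (𝓘(ℝ, EB).prod 𝓘(ℝ, F)) 𝓘(ℝ, F') ∞ (uncurry (localRep e e' θ))
        (p.2.proj, (r * p.1) • (e p.2).2) ∧
      ContDiffAt ℝ ∞ (localRep e e' θ p.2.proj) ((r * p.1) • (e p.2).2) := by
    intro p hp r hr
    obtain ⟨h1, h2, h3⟩ := hp r hr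
    have h4 : (⟨p.2.proj, e.symm p.2.proj ((r * p.1) • (e p.2).2)⟩ : TotalSpace F E) =
        fiberSmul (r * p.1) p.2 := by
      rw [← trivialization_snd_fiberSmul h1]
      exact congrArg (TotalSpace.mk p.2.proj) (e.symm_apply_apply_mk h1 ((r * p.1) • p.2.snd))
    exact ⟨contMDiffAt_localRep h1 (by rw [h4]; exact hθ _ h2) (by rw [h4]; exact h3),
      contDiffAt_localRep h1 (by rw [h4]; exact hθ _ h2) (by rw [h4]; exact h3)⟩
  have hint : ContMDiffAt (𝓘(ℝ, ℝ).prod (𝓘(ℝ, EB).prod 𝓘(ℝ, F))) 𝓘(ℝ, F') ∞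
      (fun p : ℝ × TotalSpace F E => ∫ r : ℝ, fderiv ℝ (localRep e e' θ p.2.proj)
        ((r * p.1) • (e p.2).2) (e p.2).2 ∂(volume.restrict (Icc (0 : ℝ) 1))) (0, v) := by
    refine contMDiffAt_integral (J := 𝓘(ℝ, ℝ)) (K := Icc (0 : ℝ) 1) isCompact_Icc
      (by rw [Measure.restrict_apply measurableSet_Icc.compl]; simp)
      (F := fun (r : ℝ) (p : ℝ × TotalSpace F E) => fderiv ℝ (localRep e e' θ p.2.proj)
        ((r * p.1) • (e p.2).2) (e p.2).2) ?_
    filter_upwards [hgood] with p hp r hr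
    have h1 := (hrep p hp r hr).1.fderiv_param
    have hsnd : ContMDiffAt (𝓘(ℝ, ℝ).prod (𝓘(ℝ, ℝ).prod (𝓘(ℝ, EB).prod 𝓘(ℝ, F)))) 𝓘(ℝ, F) ∞
        (fun q : ℝ × (ℝ × TotalSpace F E) => (e q.2.2).2) (r, p) := by
      have h3 : ContMDiffAt (𝓘(ℝ, EB).prod 𝓘(ℝ, F)) 𝓘(ℝ, F) ∞ (fun w => (e w).2) p.2 :=
        contMDiffAt_snd.comp p.2 (contMDiffAt_trivialization (hp r hr).1)
      exact ContMDiffAt.comp (g := fun w => (e w).2) (f := fun q : ℝ × (ℝ × TotalSpace F E) => q.2.2)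
        (r, p) h3 (contMDiffAt_snd.snd)
    have hbase : ContMDiffAt (𝓘(ℝ, ℝ).prod (𝓘(ℝ, ℝ).prod (𝓘(ℝ, EB).prod 𝓘(ℝ, F)))) 𝓘(ℝ, EB) ∞
        (fun q : ℝ × (ℝ × TotalSpace F E) => q.2.2.proj) (r, p) :=
      ContMDiffAt.comp (g := fun w : TotalSpace F E => w.proj)
        (f := fun q : ℝ × (ℝ × TotalSpace F E) => q.2.2) (r, p)
        (contMDiff_proj (IB := 𝓘(ℝ, EB)) (n := ∞) E).contMDiffAt (contMDiffAt_snd.snd)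
    have hmul : ContMDiffAt (𝓘(ℝ, ℝ).prod (𝓘(ℝ, ℝ).prod (𝓘(ℝ, EB).prod 𝓘(ℝ, F)))) 𝓘(ℝ, ℝ) ∞
        (fun q : ℝ × (ℝ × TotalSpace F E) => q.1 * q.2.1) (r, p) :=
      contMDiffAt_fst.mul (contMDiffAt_snd.fst)
    have h2 := ContMDiffAt.comp
      (g := fun p : B × F => fderiv ℝ (localRep e e' θ p.1) p.2)
      (f := fun q : ℝ × (ℝ × TotalSpace F E) => (q.2.2.proj, (q.1 * q.2.1) • (e q.2.2).2))
      (r, p) h1 (hbase.prodMk (hmul.smul hsnd))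
    exact h2.clm_apply hsnd
  refine hint.congr_of_eventuallyEq ?_
  filter_upwards [hgood] with p hp
  obtain ⟨s, w⟩ := p
  have hp0 := hp 0 (by simp)
  have hp1 := hp 1 (by simp)
  simp only [zero_mul, one_mul, fiberSmul_zero, hθ0] at hp0 hp1
  simp only [uncurry_apply_pair]
  by_cases hs : s = 0
  · subst hs
    rw [snd_blowUp_zero hθ0 hp0.1 hp0.2.2 (hθ _ (hN0 _))]
    simp
  · rw [snd_blowUp hθ0 hs hp1.1 hp1.2.2,
      integral_fderiv_segment (fun r hr => (hrep _ hp r hr).2)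
        (localRep_zero hθ0 hp0.1 hp0.2.2) hs]

theorem continuousAt_blowUp_left {N : Set (TotalSpace F E)} (hN : IsOpen N)
    (hN0 : ∀ x : B, (⟨x, 0⟩ : TotalSpace F E) ∈ N)
    (hθ : ∀ v ∈ N, ContMDiffAt (𝓘(ℝ, EB).prod 𝓘(ℝ, F)) (𝓘(ℝ, EB).prod 𝓘(ℝ, F')) ∞ θ v)
    (v : TotalSpace F E) : ContinuousAt (fun s => blowUp θ s v) 0 :=
  (contMDiffAt_blowUp hθ0 hN hN0 hθ (s := 0) (v := v)
    (by rw [fiberSmul_zero]; exact hN0 _)).continuousAt.comp (f := fun s : ℝ => (s, v))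
    (by fun_prop)

theorem eq_blowUp_zero_of_eventually {v : TotalSpace F E}
    (hθ : ContMDiffAt (𝓘(ℝ, EB).prod 𝓘(ℝ, F)) (𝓘(ℝ, EB).prod 𝓘(ℝ, F')) ∞ θ ⟨v.proj, 0⟩)
    {w : TotalSpace F' E'} (h : ∀ᶠ s in 𝓝[≠] (0 : ℝ), blowUp θ s v = w) : blowUp θ 0 v = w := by
  have := t2Space_totalSpace (F := F') (E := E')
  exact tendsto_nhds_unique (tendsto_blowUp_normalDeriv hθ0 hθ)
    ((tendsto_const_nhds (x := w)).congr' (h.mono fun s hs => hs.symm))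

omit [CompleteSpace F'] hθ0 [T2Space B] [VectorBundle ℝ F' E'] [ContMDiffVectorBundle ∞ F' E' 𝓘(ℝ, EB)] [ContMDiffVectorBundle ∞ F E 𝓘(ℝ, EB)] [IsManifold 𝓘(ℝ, EB) ∞ B] in
theorem eventually_fiberSmul_mem
    (hsm : Continuous fun p : ℝ × TotalSpace F E => fiberSmul p.1 p.2) {N : Set (TotalSpace F E)} (hN : IsOpen N)
    (hN0 : ∀ x : B, (⟨x, 0⟩ : TotalSpace F E) ∈ N) (v : TotalSpace F E) :
    ∀ᶠ s in 𝓝 (0 : ℝ), fiberSmul s v ∈ N := by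
  have h4 : ContinuousAt (fun s : ℝ => fiberSmul s v) 0 :=
    (hsm.comp
      (by fun_prop : Continuous fun s : ℝ => (s, v))).continuousAt
  exact h4 (hN.mem_nhds (by simp only [fiberSmul_zero]; exact hN0 _))

/-- For `s ≠ 0` the scalings cancel. The case `s = 0` follows by continuity, so no chain rule for
normal derivatives is needed. -/
theorem blowUp_blowUp [CompleteSpace F] {θ' : TotalSpace F' E' → TotalSpace F E}
    (hθ0' : ∀ x : B, θ' ⟨x, 0⟩ = ⟨x, 0⟩) {N : Set (TotalSpace F E)} (hN : IsOpen N)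
    (hN0 : ∀ x : B, (⟨x, 0⟩ : TotalSpace F E) ∈ N)
    (hθ : ∀ v ∈ N, ContMDiffAt (𝓘(ℝ, EB).prod 𝓘(ℝ, F)) (𝓘(ℝ, EB).prod 𝓘(ℝ, F')) ∞ θ v)
    {N' : Set (TotalSpace F' E')} (hN' : IsOpen N')
    (hN0' : ∀ x : B, (⟨x, 0⟩ : TotalSpace F' E') ∈ N')
    (hθ' : ∀ v ∈ N', ContMDiffAt (𝓘(ℝ, EB).prod 𝓘(ℝ, F')) (𝓘(ℝ, EB).prod 𝓘(ℝ, F)) ∞ θ' v)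
    (hinv : ∀ v ∈ N, θ' (θ v) = v) {s : ℝ} {v : TotalSpace F E} (hv : fiberSmul s v ∈ N) :
    blowUp θ' s (blowUp θ s v) = v := by
  have key : ∀ s : ℝ, s ≠ 0 → fiberSmul s v ∈ N → blowUp θ' s (blowUp θ s v) = v := by
    intro s hs hv
    rw [blowUp_of_ne θ hs, blowUp_of_ne θ' hs, fiberSmul_fiberSmul, mul_inv_cancel₀ hs,
      fiberSmul_one, hinv _ hv, fiberSmul_fiberSmul, inv_mul_cancel₀ hs, fiberSmul_one]
  by_cases hs : s = 0
  · subst hs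
    have := t2Space_totalSpace (F := F) (E := E)
    have h1 := continuousAt_blowUp_left hθ0 hN hN0 hθ v
    have h2 : ContinuousAt (fun s => blowUp θ' s (blowUp θ s v)) 0 :=
      ContinuousAt.comp (g := uncurry (blowUp θ')) (f := fun s => (s, blowUp θ s v))
        (contMDiffAt_blowUp hθ0' hN' hN0' hθ' (s := 0) (v := blowUp θ 0 v)
          (by rw [fiberSmul_zero]; exact hN0' _)).continuousAt (continuousAt_id.prodMk h1)
    refine tendsto_nhds_unique (h2.tendsto.mono_left (nhdsWithin_le_nhds (s := {(0 : ℝ)}ᶜ)))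
      ((tendsto_const_nhds (x := v)).congr' ?_)
    filter_upwards [self_mem_nhdsWithin,
      nhdsWithin_le_nhds (eventually_fiberSmul_mem
        (contMDiff_fiberSmul (EB := EB)).continuous hN hN0 v)] with s hs hv
    exact (key s hs hv).symm
  · exact key s hs hv

/-- Equivariance of `θ` under a pair of fibre-linear maps passes to the blow-up. -/
theorem blowUp_equivariant {N : Set (TotalSpace F E)} (hN : IsOpen N)
    (hN0 : ∀ x : B, (⟨x, 0⟩ : TotalSpace F E) ∈ N)
    (hθ : ∀ v ∈ N, ContMDiffAt (𝓘(ℝ, EB).prod 𝓘(ℝ, F)) (𝓘(ℝ, EB).prod 𝓘(ℝ, F')) ∞ θ v)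
    {T : TotalSpace F E → TotalSpace F E} {T' : TotalSpace F' E' → TotalSpace F' E'}
    (hT : ∀ s v, T (fiberSmul s v) = fiberSmul s (T v))
    (hT' : ∀ s v, T' (fiberSmul s v) = fiberSmul s (T' v)) (hTc : Continuous T')
    (hTθ : ∀ v ∈ N, θ (T v) = T' (θ v)) {s : ℝ} {v : TotalSpace F E} (hv : fiberSmul s v ∈ N) :
    blowUp θ s (T v) = T' (blowUp θ s v) := by
  have key : ∀ s : ℝ, s ≠ 0 → fiberSmul s v ∈ N → blowUp θ s (T v) = T' (blowUp θ s v) := by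
    intro s hs hv
    rw [blowUp_of_ne θ hs, blowUp_of_ne θ hs, ← hT, hTθ _ hv, hT']
  by_cases hs : s = 0
  · subst hs
    have := t2Space_totalSpace (F := F') (E := E')
    have h1 := continuousAt_blowUp_left hθ0 hN hN0 hθ v
    have h2 := continuousAt_blowUp_left hθ0 hN hN0 hθ (T v)
    refine tendsto_nhds_unique (h2.tendsto.mono_left (nhdsWithin_le_nhds (s := {(0 : ℝ)}ᶜ)))
      (((hTc.continuousAt.comp h1).tendsto.mono_left nhdsWithin_le_nhds).congr' ?_)
    filter_upwards [self_mem_nhdsWithin,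
      nhdsWithin_le_nhds (eventually_fiberSmul_mem
        (contMDiff_fiberSmul (EB := EB)).continuous hN hN0 v)] with s hs hv
    exact (key s hs hv).symm
  · exact key s hs hv

end BlowUp

/-! ### The polar factor of a fibrewise linear map between bundles with metrics. -/

section PolarBundle

open Function Bundle.ContMDiffRiemannianMetric

variable {EB : Type*} [NormedAddCommGroup EB] [NormedSpace ℝ EB]
  {B : Type*} [TopologicalSpace B] [ChartedSpace EB B] [IsManifold 𝓘(ℝ, EB) ∞ B]
  {F : Type*} [NormedAddCommGroup F] [NormedSpace ℝ F]
  {E : B → Type*} [TopologicalSpace (TotalSpace F E)]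
  [∀ x, AddCommGroup (E x)] [∀ x, Module ℝ (E x)] [∀ x, TopologicalSpace (E x)]
  [∀ x, IsTopologicalAddGroup (E x)] [∀ x, ContinuousConstSMul ℝ (E x)]
  [FiberBundle F E] [VectorBundle ℝ F E] [ContMDiffVectorBundle ∞ F E 𝓘(ℝ, EB)]
  {F' : Type*} [NormedAddCommGroup F'] [NormedSpace ℝ F']
  {E' : B → Type*} [TopologicalSpace (TotalSpace F' E')]
  [∀ x, AddCommGroup (E' x)] [∀ x, Module ℝ (E' x)] [∀ x, TopologicalSpace (E' x)]
  [∀ x, IsTopologicalAddGroup (E' x)] [∀ x, ContinuousConstSMul ℝ (E' x)]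
  [FiberBundle F' E'] [VectorBundle ℝ F' E'] [ContMDiffVectorBundle ∞ F' E' 𝓘(ℝ, EB)]
  (g : ContMDiffRiemannianMetric 𝓘(ℝ, EB) ∞ F E)
  (g' : ContMDiffRiemannianMetric 𝓘(ℝ, EB) ∞ F' E')
  (L : ∀ x, E x →L[ℝ] E' x)

/-- A fibrewise linear map in trivializations. -/
def coordMap (e : Trivialization F (π F E)) (e' : Trivialization F' (π F' E'))
    [MemTrivializationAtlas e] [MemTrivializationAtlas e'] (x : B) : F →L[ℝ] F' :=
  e'.continuousLinearMapAt ℝ x ∘L L x ∘L e.symmL ℝ x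

variable {L} in
theorem coordMap_apply {e : Trivialization F (π F E)} {e' : Trivialization F' (π F' E')}
    [MemTrivializationAtlas e] [MemTrivializationAtlas e'] {x : B} (hx : x ∈ e.baseSet)
    (hx' : x ∈ e'.baseSet) (u : F) :
    coordMap L e e' x u = (e' ⟨x, L x (e.symm x u)⟩).2 := by
  simp [coordMap, hx, hx']

/-- The form `g'(L u, L w)` in trivializations. -/
def pullForm (e : Trivialization F (π F E)) (e' : Trivialization F' (π F' E'))
    [MemTrivializationAtlas e] [MemTrivializationAtlas e'] (x : B) : F →L[ℝ] F →L[ℝ] ℝ :=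
  ContinuousLinearMap.precomp ℝ (coordMap L e e' x) ∘L g'.localForm e' x ∘L coordMap L e e' x

variable {L} in
theorem pullForm_apply {e : Trivialization F (π F E)} {e' : Trivialization F' (π F' E')}
    [MemTrivializationAtlas e] [MemTrivializationAtlas e'] {x : B} (hx : x ∈ e.baseSet)
    (hx' : x ∈ e'.baseSet) (u w : F) :
    pullForm g' L e e' x u w = g'.inner x (L x (e.symm x u)) (L x (e.symm x w)) := by
  have h1 : ∀ v : E' x, e'.symm x (e' ⟨x, v⟩).2 = v := fun v => e'.symm_apply_apply_mk hx' v
  have h2 : pullForm g' L e e' x u w =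
      g'.localForm e' x (coordMap L e e' x u) (coordMap L e e' x w) := rfl
  rw [h2, localForm_apply g' e' hx', coordMap_apply hx hx', coordMap_apply hx hx', h1, h1]

/-- The polar factor of a fibrewise linear map, in trivializations. -/
def localPolarFactor (e : Trivialization F (π F E)) (e' : Trivialization F' (π F' E'))
    [MemTrivializationAtlas e] [MemTrivializationAtlas e'] (x : B) : F →L[ℝ] F :=
  polarFactor (g.localForm e x) (pullForm g' L e e' x)

/-- The polar factor of the fibrewise linear map `L`: the `g`-self-adjoint positive
`Q` for which `L ∘ Q` is isometric. -/
def polarMap (x : B) : E x →ₗ[ℝ] E x :=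
  ((trivializationAt F E x).linearEquivAt ℝ x (mem_baseSet_trivializationAt F E x)).symm ∘ₗ
    (localPolarFactor g g' L (trivializationAt F E x) (trivializationAt F' E' x) x).toLinearMap ∘ₗ
    ((trivializationAt F E x).linearEquivAt ℝ x (mem_baseSet_trivializationAt F E x)).toLinearMap

/-- The straight path of fibrewise linear maps from the identity to the polar factor. -/
def polarPath (t : ℝ) (v : TotalSpace F E) : TotalSpace F E :=
  ⟨v.proj, (1 - Real.smoothTransition t) • v.snd +
    Real.smoothTransition t • polarMap g g' L v.proj v.snd⟩

/-- The straight path to the polar factor, in trivializations. -/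
def polarPathCoord (e : Trivialization F (π F E)) (e' : Trivialization F' (π F' E'))
    [MemTrivializationAtlas e] [MemTrivializationAtlas e'] (t : ℝ) (x : B) : F →L[ℝ] F :=
  (1 - Real.smoothTransition t) • ContinuousLinearMap.id ℝ F +
    Real.smoothTransition t • localPolarFactor g g' L e e' x

/-- The inverse of `polarPath`. -/
def polarPathInv (t : ℝ) (v : TotalSpace F E) : TotalSpace F E :=
  ⟨v.proj, (trivializationAt F E v.proj).symm v.proj
    ((polarPathCoord g g' L (trivializationAt F E v.proj) (trivializationAt F' E' v.proj) t
      v.proj).inverse (trivializationAt F E v.proj v).2)⟩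

theorem polarPath_zero (v : TotalSpace F E) : polarPath g g' L 0 v = v := by
  simp [polarPath]

theorem polarPath_one (v : TotalSpace F E) :
    polarPath g g' L 1 v = ⟨v.proj, polarMap g g' L v.proj v.snd⟩ := by
  simp [polarPath]

theorem polarPath_fiberSmul (t c : ℝ) (v : TotalSpace F E) :
    polarPath g g' L t (fiberSmul c v) = fiberSmul c (polarPath g g' L t v) := by
  refine congrArg (TotalSpace.mk v.proj) ?_
  change (1 - Real.smoothTransition t) • (c • v.snd) +
    Real.smoothTransition t • polarMap g g' L v.proj (c • v.snd) = c • (_ + _)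
  rw [map_smul, smul_add, smul_comm c, smul_comm c]

variable {L} [FiniteDimensional ℝ F] (hL : ∀ x, Injective (L x))
include hL

theorem isPosForm_pullForm {e : Trivialization F (π F E)} {e' : Trivialization F' (π F' E')}
    [MemTrivializationAtlas e] [MemTrivializationAtlas e'] {x : B} (hx : x ∈ e.baseSet)
    (hx' : x ∈ e'.baseSet) : IsPosForm (pullForm g' L e e' x) where
  symm u w := by rw [pullForm_apply g' hx hx', pullForm_apply g' hx hx']; exact g'.symm _ _ _
  pos u hu := by
    rw [pullForm_apply g' hx hx']
    refine g'.pos _ _ fun h => hu ?_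
    have h1 : e.symm x u = 0 := hL x (h.trans (map_zero _).symm)
    have h2 := e.apply_mk_symm hx u
    rw [h1] at h2
    have h3 := congrArg Prod.snd (e.zeroSection ℝ hx)
    simp only [zeroSection] at h3
    rw [h2] at h3
    exact h3

/-- Two different fibres and two pairs of trivializations are allowed at once: `T = id` gives
independence of trivializations, and the action of a group element gives equivariance. -/
theorem localPolarFactor_naturality {e₁ e₂ : Trivialization F (π F E)}
    {e₁' e₂' : Trivialization F' (π F' E')}
    [MemTrivializationAtlas e₁] [MemTrivializationAtlas e₁'] [MemTrivializationAtlas e₂]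
    [MemTrivializationAtlas e₂'] {x y : B} (hx : x ∈ e₁.baseSet) (hx' : x ∈ e₁'.baseSet)
    (hy : y ∈ e₂.baseSet) (hy' : y ∈ e₂'.baseSet) (T : E x ≃ₗ[ℝ] E y)
    (h1 : ∀ u w, g.inner y (T u) (T w) = g.inner x u w)
    (h2 : ∀ u w, g'.inner y (L y (T u)) (L y (T w)) = g'.inner x (L x u) (L x w)) (v : E x) :
    localPolarFactor g g' L e₂ e₂' y (e₂ ⟨y, T v⟩).2 =
      (e₂ ⟨y, T (e₁.symm x (localPolarFactor g g' L e₁ e₁' x (e₁ ⟨x, v⟩).2))⟩).2 := by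
  have hs : ∀ w : E y, e₂.symm y (e₂ ⟨y, w⟩).2 = w := fun w => e₂.symm_apply_apply_mk hy w
  have hs1 : ∀ w : E x, e₁.symm x (e₁ ⟨x, w⟩).2 = w := fun w => e₁.symm_apply_apply_mk hx w
  let T' : F ≃ₗ[ℝ] F := (e₁.linearEquivAt ℝ x hx).symm.trans (T.trans (e₂.linearEquivAt ℝ y hy))
  have hT' : ∀ u, T' u = (e₂ ⟨y, T (e₁.symm x u)⟩).2 := fun u => by
    simp only [T', LinearEquiv.trans_apply, Trivialization.linearEquivAt_apply,
      Trivialization.linearEquivAt_symm_apply]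
  have h := polarFactor_naturality (g.isPosForm_localForm e₁ hx) (isPosForm_pullForm g' hL hx hx')
    (g.isPosForm_localForm e₂ hy) (isPosForm_pullForm g' hL hy hy') T'
    (fun u w => by
      rw [localForm_apply g _ hy, localForm_apply g _ hx, hT', hT', hs, hs, h1])
    (fun u w => by
      rw [pullForm_apply g' hy hy', pullForm_apply g' hx hx', hT', hT', hs, hs, h2])
    (e₁ ⟨x, v⟩).2
  rw [hT', hT', hs1] at h
  exact h

theorem snd_polarMap {e : Trivialization F (π F E)} {e' : Trivialization F' (π F' E')}
    [MemTrivializationAtlas e] [MemTrivializationAtlas e'] {x : B} (hx : x ∈ e.baseSet)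
    (hx' : x ∈ e'.baseSet) (v : E x) :
    (e ⟨x, polarMap g g' L x v⟩).2 = localPolarFactor g g' L e e' x (e ⟨x, v⟩).2 :=
  (localPolarFactor_naturality g g' hL (mem_baseSet_trivializationAt F E x)
    (mem_baseSet_trivializationAt F' E' x) hx hx' (LinearEquiv.refl ℝ (E x)) (fun _ _ => rfl)
    (fun _ _ => rfl) v).symm

theorem polarMap_naturality {x y : B} (T : E x ≃ₗ[ℝ] E y)
    (h1 : ∀ u w, g.inner y (T u) (T w) = g.inner x u w)
    (h2 : ∀ u w, g'.inner y (L y (T u)) (L y (T w)) = g'.inner x (L x u) (L x w)) (v : E x) :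
    polarMap g g' L y (T v) = T (polarMap g g' L x v) := by
  have hy := mem_baseSet_trivializationAt F E y
  have h := localPolarFactor_naturality g g' hL (mem_baseSet_trivializationAt F E x)
    (mem_baseSet_trivializationAt F' E' x) hy (mem_baseSet_trivializationAt F' E' y) T h1 h2 v
  have h3 := congrArg ((trivializationAt F E y).symm y) h
  have hs : ∀ w : E y, (trivializationAt F E y).symm y (trivializationAt F E y ⟨y, w⟩).2 = w :=
    fun w => (trivializationAt F E y).symm_apply_apply_mk hy w
  rw [hs] at h3
  exact h3

theorem polarMap_isometry (x : B) (u w : E x) :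
    g'.inner x (L x (polarMap g g' L x u)) (L x (polarMap g g' L x w)) = g.inner x u w := by
  have hx := mem_baseSet_trivializationAt F E x
  have hx' := mem_baseSet_trivializationAt F' E' x
  set e := trivializationAt F E x
  set e' := trivializationAt F' E' x
  have hs : ∀ w : E x, e.symm x (e ⟨x, w⟩).2 = w := fun w => e.symm_apply_apply_mk hx w
  have h := polarFactor_isometry (g.isPosForm_localForm e hx) (isPosForm_pullForm g' hL hx hx')
    (e ⟨x, u⟩).2 (e ⟨x, w⟩).2
  rw [localForm_apply g _ hx, pullForm_apply g' hx hx', hs, hs] at h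
  exact h

/-- This is what leaves the given isomorphism `ψ₀` unchanged over `U`: where the derivative is
already isometric there is nothing to correct. -/
theorem polarMap_of_isometry {x : B}
    (h : ∀ u w, g'.inner x (L x u) (L x w) = g.inner x u w) (v : E x) :
    polarMap g g' L x v = v := by
  have hx := mem_baseSet_trivializationAt F E x
  have hx' := mem_baseSet_trivializationAt F' E' x
  have h1 : pullForm g' L (trivializationAt F E x) (trivializationAt F' E' x) x =
      g.localForm (trivializationAt F E x) x := by
    ext u w
    rw [localForm_apply g _ hx, pullForm_apply g' hx hx', h]
  have h2 := polarFactor_self (g.isPosForm_localForm (trivializationAt F E x) hx)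
    (trivializationAt F E x ⟨x, v⟩).2
  have h3 : polarMap g g' L x v = (trivializationAt F E x).symm x
    (localPolarFactor g g' L (trivializationAt F E x) (trivializationAt F' E' x) x
      (trivializationAt F E x ⟨x, v⟩).2) := rfl
  rw [h3, localPolarFactor, h1, h2]
  exact (trivializationAt F E x).symm_apply_apply_mk hx v

theorem snd_polarPath {e : Trivialization F (π F E)} {e' : Trivialization F' (π F' E')}
    [MemTrivializationAtlas e] [MemTrivializationAtlas e'] {v : TotalSpace F E}
    (hx : v.proj ∈ e.baseSet) (hx' : v.proj ∈ e'.baseSet) (t : ℝ) :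
    (e (polarPath g g' L t v)).2 = polarPathCoord g g' L e e' t v.proj (e v).2 := by
  have h := (e.linear ℝ hx)
  have h1 := snd_polarMap g g' hL hx hx' v.snd
  rw [polarPath]
  refine (h.map_add _ _).trans ?_
  rw [h.map_smul, h.map_smul, h1]
  rfl

theorem isInvertible_polarPathCoord {e : Trivialization F (π F E)}
    {e' : Trivialization F' (π F' E')}
    [MemTrivializationAtlas e] [MemTrivializationAtlas e'] {x : B}
    (hx : x ∈ e.baseSet) (hx' : x ∈ e'.baseSet) (t : ℝ) :
    (polarPathCoord g g' L e e' t x).IsInvertible :=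
  isInvertible_polarFactor_path (g.isPosForm_localForm e hx) (isPosForm_pullForm g' hL hx hx')
    ⟨Real.smoothTransition.nonneg t, Real.smoothTransition.le_one t⟩

omit hL [FiniteDimensional ℝ F] in
theorem totalSpace_ext_snd {e : Trivialization F (π F E)} {v w : TotalSpace F E}
    (hv : v.proj ∈ e.baseSet) (h : v.proj = w.proj) (h2 : (e v).2 = (e w).2) : v = w :=
  e.injOn (e.mem_source.2 hv) (e.mem_source.2 (h ▸ hv))
    (Prod.ext ((e.coe_fst' hv).trans (h.trans (e.coe_fst' (h ▸ hv)).symm)) h2)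

theorem polarPath_polarPathInv (t : ℝ) (v : TotalSpace F E) :
    polarPath g g' L t (polarPathInv g g' L t v) = v := by
  have hx := mem_baseSet_trivializationAt F E v.proj
  have hx' := mem_baseSet_trivializationAt F' E' v.proj
  refine totalSpace_ext_snd (e := trivializationAt F E v.proj) hx rfl ?_
  rw [snd_polarPath g g' hL (v := polarPathInv g g' L t v) hx hx']
  rw [polarPathInv, Trivialization.apply_mk_symm _ hx]
  exact (isInvertible_polarPathCoord g g' hL hx hx' t).self_apply_inverse _

/-- The inverse is defined pointwise with the preferred trivialization at each point. Uniqueness of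
inverses gives the same formula in a fixed one, as smoothness requires. -/
theorem snd_polarPathInv {e : Trivialization F (π F E)} {e' : Trivialization F' (π F' E')}
    [MemTrivializationAtlas e] [MemTrivializationAtlas e'] {v : TotalSpace F E}
    (hx : v.proj ∈ e.baseSet) (hx' : v.proj ∈ e'.baseSet) (t : ℝ) :
    (e (polarPathInv g g' L t v)).2 = (polarPathCoord g g' L e e' t v.proj).inverse (e v).2 := by
  have h := snd_polarPath g g' hL (v := polarPathInv g g' L t v) hx hx' t
  rw [polarPath_polarPathInv g g' hL] at h
  rw [h]
  exact ((isInvertible_polarPathCoord g g' hL hx hx' t).inverse_apply_self _).symm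

theorem polarPathInv_polarPath (t : ℝ) (v : TotalSpace F E) :
    polarPathInv g g' L t (polarPath g g' L t v) = v := by
  have hx := mem_baseSet_trivializationAt F E v.proj
  have hx' := mem_baseSet_trivializationAt F' E' v.proj
  refine totalSpace_ext_snd (e := trivializationAt F E v.proj) hx rfl ?_
  rw [snd_polarPathInv g g' hL (v := polarPath g g' L t v) hx hx', snd_polarPath g g' hL hx hx']
  exact (isInvertible_polarPathCoord g g' hL hx hx' t).inverse_apply_self _

theorem polarMap_bijective (x : B) : Bijective (polarMap g g' L x) := by
  constructor
  · intro u w h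
    have h1 : polarPath g g' L 1 ⟨x, u⟩ = polarPath g g' L 1 (⟨x, w⟩ : TotalSpace F E) := by
      rw [polarPath_one, polarPath_one, h]
    have h2 := congrArg (polarPathInv g g' L 1) h1
    rw [polarPathInv_polarPath g g' hL, polarPathInv_polarPath g g' hL] at h2
    exact TotalSpace.mk_inj.1 h2
  · intro w
    have h := polarPath_polarPathInv g g' hL 1 (⟨x, w⟩ : TotalSpace F E)
    rw [polarPath_one] at h
    exact ⟨(polarPathInv g g' L 1 (⟨x, w⟩ : TotalSpace F E)).snd, TotalSpace.mk_inj.1 h⟩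

theorem polarPathInv_fiberSmul (t c : ℝ) (v : TotalSpace F E) :
    polarPathInv g g' L t (fiberSmul c v) = fiberSmul c (polarPathInv g g' L t v) := by
  conv_lhs => rw [← polarPath_polarPathInv g g' hL t v, ← polarPath_fiberSmul]
  exact polarPathInv_polarPath g g' hL t _

variable [T2Space B]

-- A linear map is its own derivative, so the coordinate matrix is the fibre derivative of the
-- bundle map at `0`, and this is smooth in the base point.
omit [T2Space B] hL [FiniteDimensional ℝ F] in
theorem contMDiffAt_coordMap (hLs : ContMDiff (𝓘(ℝ, EB).prod 𝓘(ℝ, F)) (𝓘(ℝ, EB).prod 𝓘(ℝ, F')) ∞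
      (fun v : TotalSpace F E => (⟨v.proj, L v.proj v.snd⟩ : TotalSpace F' E')))
    {e : Trivialization F (π F E)} {e' : Trivialization F' (π F' E')}
    [MemTrivializationAtlas e] [MemTrivializationAtlas e'] {x : B}
    (hx : x ∈ e.baseSet) (hx' : x ∈ e'.baseSet) :
    ContMDiffAt 𝓘(ℝ, EB) 𝓘(ℝ, F →L[ℝ] F') ∞ (coordMap L e e') x := by
  have h1 := contMDiffAt_localRep (EB := EB) (e := e) (e' := e') (u := 0)
    (θ := fun v : TotalSpace F E => (⟨v.proj, L v.proj v.snd⟩ : TotalSpace F' E')) hx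
    (hLs _) hx'
  have h2 := ContMDiffAt.comp (f := fun x : B => (x, (0 : F))) x h1.fderiv_param
    (contMDiffAt_id.prodMk contMDiffAt_const)
  refine h2.congr_of_eventuallyEq ?_
  filter_upwards [e.open_baseSet.mem_nhds hx, e'.open_baseSet.mem_nhds hx'] with y hy hy'
  have h3 : localRep e e' (fun v : TotalSpace F E => (⟨v.proj, L v.proj v.snd⟩ :
      TotalSpace F' E')) y = coordMap L e e' y := by
    funext u
    rw [coordMap_apply hy hy', localRep]
  simp only [comp_apply, h3]
  exact ((coordMap L e e' y).fderiv).symm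

omit [T2Space B] hL [FiniteDimensional ℝ F] in
theorem contMDiffAt_pullForm (hLs : ContMDiff (𝓘(ℝ, EB).prod 𝓘(ℝ, F)) (𝓘(ℝ, EB).prod 𝓘(ℝ, F')) ∞
      (fun v : TotalSpace F E => (⟨v.proj, L v.proj v.snd⟩ : TotalSpace F' E'))) (x : B) :
    ContMDiffAt 𝓘(ℝ, EB) 𝓘(ℝ, F →L[ℝ] F →L[ℝ] ℝ) ∞
      (pullForm g' L (trivializationAt F E x) (trivializationAt F' E' x)) x := by
  have hC := contMDiffAt_coordMap hLs (mem_baseSet_trivializationAt F E x)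
    (mem_baseSet_trivializationAt F' E' x)
  have h1 : ContMDiffAt 𝓘(ℝ, EB) 𝓘(ℝ, F →L[ℝ] F' →L[ℝ] ℝ) ∞
      (fun y => g'.localForm (trivializationAt F' E' x) y ∘L
        coordMap L (trivializationAt F E x) (trivializationAt F' E' x) y) x :=
    (g'.contMDiffAt_localForm x).clm_comp hC
  have h2 : ContMDiffAt 𝓘(ℝ, EB) 𝓘(ℝ, (F' →L[ℝ] ℝ) →L[ℝ] (F →L[ℝ] ℝ)) ∞
      (fun y => ContinuousLinearMap.precomp ℝ
        (coordMap L (trivializationAt F E x) (trivializationAt F' E' x) y)) x :=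
    hC.clm_precomp
  exact h2.clm_comp h1

set_option synthInstance.maxHeartbeats 200000 in
theorem contMDiffAt_localPolarFactor
    (hLs : ContMDiff (𝓘(ℝ, EB).prod 𝓘(ℝ, F)) (𝓘(ℝ, EB).prod 𝓘(ℝ, F')) ∞
      (fun v : TotalSpace F E => (⟨v.proj, L v.proj v.snd⟩ : TotalSpace F' E'))) (x : B) :
    ContMDiffAt 𝓘(ℝ, EB) 𝓘(ℝ, F →L[ℝ] F) ∞
      (localPolarFactor g g' L (trivializationAt F E x) (trivializationAt F' E' x)) x := by
  have h4 := (contDiffAt_polarFactor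
    (g.isPosForm_localForm (trivializationAt F E x) (mem_baseSet_trivializationAt F E x))
    (isPosForm_pullForm g' hL (mem_baseSet_trivializationAt F E x)
      (mem_baseSet_trivializationAt F' E' x))).contMDiffAt_prod
  exact ContMDiffAt.comp (f := fun y => (g.localForm (trivializationAt F E x) y,
      pullForm g' L (trivializationAt F E x) (trivializationAt F' E' x) y)) x h4
    ((g.contMDiffAt_localForm x).prodMk (contMDiffAt_pullForm g' hLs x))

theorem contMDiffAt_polarPathCoord
    (hLs : ContMDiff (𝓘(ℝ, EB).prod 𝓘(ℝ, F)) (𝓘(ℝ, EB).prod 𝓘(ℝ, F')) ∞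
      (fun v : TotalSpace F E => (⟨v.proj, L v.proj v.snd⟩ : TotalSpace F' E')))
    (t : ℝ) (v : TotalSpace F E) :
    ContMDiffAt (𝓘(ℝ, ℝ).prod (𝓘(ℝ, EB).prod 𝓘(ℝ, F))) 𝓘(ℝ, F →L[ℝ] F) ∞
      (fun p : ℝ × TotalSpace F E => polarPathCoord g g' L (trivializationAt F E v.proj)
        (trivializationAt F' E' v.proj) p.1 p.2.proj) (t, v) := by
  have hζ : ContMDiffAt (𝓘(ℝ, ℝ).prod (𝓘(ℝ, EB).prod 𝓘(ℝ, F))) 𝓘(ℝ, ℝ) ∞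
      (fun p : ℝ × TotalSpace F E => Real.smoothTransition p.1) (t, v) :=
    ContMDiffAt.comp (t, v) Real.smoothTransition.contDiff.contMDiff.contMDiffAt contMDiffAt_fst
  have hb : ContMDiffAt (𝓘(ℝ, ℝ).prod (𝓘(ℝ, EB).prod 𝓘(ℝ, F))) 𝓘(ℝ, EB) ∞
      (fun p : ℝ × TotalSpace F E => p.2.proj) (t, v) :=
    (contMDiff_proj E).contMDiffAt.comp (t, v) contMDiffAt_snd
  have hP := ContMDiffAt.comp (f := fun p : ℝ × TotalSpace F E => p.2.proj) (t, v)
    (contMDiffAt_localPolarFactor g g' hL hLs v.proj) hb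
  exact ((contMDiffAt_const.sub hζ).smul contMDiffAt_const).add (hζ.smul hP)

theorem contMDiff_polarPath
    (hLs : ContMDiff (𝓘(ℝ, EB).prod 𝓘(ℝ, F)) (𝓘(ℝ, EB).prod 𝓘(ℝ, F')) ∞
      (fun v : TotalSpace F E => (⟨v.proj, L v.proj v.snd⟩ : TotalSpace F' E'))) :
    ContMDiff (𝓘(ℝ, ℝ).prod (𝓘(ℝ, EB).prod 𝓘(ℝ, F))) (𝓘(ℝ, EB).prod 𝓘(ℝ, F)) ∞
      (uncurry (polarPath g g' L)) := by
  rintro ⟨t, v⟩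
  have hx := mem_baseSet_trivializationAt F E v.proj
  have hx' := mem_baseSet_trivializationAt F' E' v.proj
  have hb : ContMDiffAt (𝓘(ℝ, ℝ).prod (𝓘(ℝ, EB).prod 𝓘(ℝ, F))) 𝓘(ℝ, EB) ∞
      (fun p : ℝ × TotalSpace F E => p.2.proj) (t, v) :=
    (contMDiff_proj E).contMDiffAt.comp (t, v) contMDiffAt_snd
  refine ((trivializationAt F E v.proj).contMDiffAt_iff (f := uncurry (polarPath g g' L))
    (x₀ := (t, v)) (Trivialization.mem_source _ |>.2 hx)).2 ⟨hb, ?_⟩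
  have hs : ContMDiffAt (𝓘(ℝ, ℝ).prod (𝓘(ℝ, EB).prod 𝓘(ℝ, F))) 𝓘(ℝ, F) ∞
      (fun p : ℝ × TotalSpace F E => (trivializationAt F E v.proj p.2).2) (t, v) :=
    contMDiffAt_snd.comp (t, v) ((contMDiffAt_trivialization hx).comp (t, v) contMDiffAt_snd)
  refine ((contMDiffAt_polarPathCoord g g' hL hLs t v).clm_apply hs).congr_of_eventuallyEq ?_
  filter_upwards [hb.continuousAt ((trivializationAt F E v.proj).open_baseSet.mem_nhds hx),
    hb.continuousAt ((trivializationAt F' E' v.proj).open_baseSet.mem_nhds hx')] with p hp hp'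
  exact snd_polarPath g g' hL hp hp' p.1

theorem contMDiff_polarPathInv
    (hLs : ContMDiff (𝓘(ℝ, EB).prod 𝓘(ℝ, F)) (𝓘(ℝ, EB).prod 𝓘(ℝ, F')) ∞
      (fun v : TotalSpace F E => (⟨v.proj, L v.proj v.snd⟩ : TotalSpace F' E'))) :
    ContMDiff (𝓘(ℝ, ℝ).prod (𝓘(ℝ, EB).prod 𝓘(ℝ, F))) (𝓘(ℝ, EB).prod 𝓘(ℝ, F)) ∞
      (uncurry (polarPathInv g g' L)) := by
  rintro ⟨t, v⟩
  have := FiniteDimensional.complete ℝ F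
  have hx := mem_baseSet_trivializationAt F E v.proj
  have hx' := mem_baseSet_trivializationAt F' E' v.proj
  have hb : ContMDiffAt (𝓘(ℝ, ℝ).prod (𝓘(ℝ, EB).prod 𝓘(ℝ, F))) 𝓘(ℝ, EB) ∞
      (fun p : ℝ × TotalSpace F E => p.2.proj) (t, v) :=
    (contMDiff_proj E).contMDiffAt.comp (t, v) contMDiffAt_snd
  refine ((trivializationAt F E v.proj).contMDiffAt_iff (f := uncurry (polarPathInv g g' L))
    (x₀ := (t, v)) (Trivialization.mem_source _ |>.2 hx)).2 ⟨hb, ?_⟩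
  have hs : ContMDiffAt (𝓘(ℝ, ℝ).prod (𝓘(ℝ, EB).prod 𝓘(ℝ, F))) 𝓘(ℝ, F) ∞
      (fun p : ℝ × TotalSpace F E => (trivializationAt F E v.proj p.2).2) (t, v) :=
    contMDiffAt_snd.comp (t, v) ((contMDiffAt_trivialization hx).comp (t, v) contMDiffAt_snd)
  have hA := contMDiffAt_polarPathCoord g g' hL hLs t v
  have hI := ContMDiffAt.comp (g := ContinuousLinearMap.inverse)
    (f := fun p : ℝ × TotalSpace F E => polarPathCoord g g' L (trivializationAt F E v.proj)
        (trivializationAt F' E' v.proj) p.1 p.2.proj) (t, v)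
    (isInvertible_polarPathCoord g g' hL hx hx' t).contDiffAt_map_inverse.contMDiffAt hA
  refine (hI.clm_apply hs).congr_of_eventuallyEq ?_
  filter_upwards [hb.continuousAt ((trivializationAt F E v.proj).open_baseSet.mem_nhds hx),
    hb.continuousAt ((trivializationAt F' E' v.proj).open_baseSet.mem_nhds hx')] with p hp hp'
  exact snd_polarPathInv g g' hL hp hp' p.1

end PolarBundle

/-! ### Globalizing a local isotopy by stopping its clock. -/

section CutoffIsotopy

open Function

variable {G : Type*} [Group G]
  {EM : Type*} [NormedAddCommGroup EM] [NormedSpace ℝ EM] [CompleteSpace EM]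
  {M : Type*} [TopologicalSpace M] [ChartedSpace EM M] [IsManifold 𝓘(ℝ, EM) ∞ M] [MulAction G M]

/-- A local isotopy `Φ` with inverse `Ψ`, stopped by a cutoff function `χ` of its time parameter,
is a global isotopy, provided that `χ` grows with speed less than one along the curves of `Ψ`. -/
theorem exists_equivariantDiffeotopy_of_local {Φ Ψ : ℝ → M → M} {Ω₀ Ω₁ K : Set M} {χ : M → ℝ}
    (hΩ₀ : IsOpen Ω₀) (hΩ₁ : IsOpen Ω₁)
    (hΦ : ∀ t, ∀ x ∈ Ω₀, ContMDiffAt (𝓘(ℝ, ℝ).prod 𝓘(ℝ, EM)) 𝓘(ℝ, EM) ∞ (uncurry Φ) (t, x))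
    (hΨ : ∀ t, ∀ y ∈ Ω₁, ContMDiffAt (𝓘(ℝ, ℝ).prod 𝓘(ℝ, EM)) 𝓘(ℝ, EM) ∞ (uncurry Ψ) (t, y))
    (hmaps : ∀ t, ∀ x ∈ Ω₀, Φ t x ∈ Ω₁) (hΨΦ : ∀ t, ∀ x ∈ Ω₀, Ψ t (Φ t x) = x)
    (hΦΨ : ∀ t, ∀ y ∈ Ω₁, Φ t (Ψ t y) = y) (hΦ0 : ∀ x ∈ Ω₀, Φ 0 x = x)
    (hΨ0 : ∀ y ∈ Ω₁, Ψ 0 y = y)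
    (hΩ₀_smul : ∀ (g : G), ∀ x ∈ Ω₀, g • x ∈ Ω₀)
    (hΦ_smul : ∀ t (g : G), ∀ x ∈ Ω₀, Φ t (g • x) = g • Φ t x)
    (hχ : ContMDiff 𝓘(ℝ, EM) 𝓘(ℝ, ℝ) ∞ χ) (hχ0 : ∀ x, 0 ≤ χ x) (hχ1 : ∀ x, χ x ≤ 1)
    (hχ_smul : ∀ (g : G) x, χ (g • x) = χ x)
    (hK : IsClosed K) (hKΩ : K ⊆ Ω₀) (hχK : ∀ x ∉ K, χ x = 0)
    (hK' : IsClosed (⋃ t ∈ Icc (0 : ℝ) 1, Φ t '' K))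
    (hderiv : ∀ t ∈ Icc (0 : ℝ) 1, ∀ x ∈ K, deriv (fun t' => χ (Ψ t' (Φ t x))) t < 1) :
    ∃ H : EquivariantDiffeotopy G EM M,
      (∀ t, ∀ x ∈ K, H.toDiffeo t x = Φ (t * χ x) x) ∧ ∀ t, ∀ x ∉ K, H.toDiffeo t x = x := by
  classical
  set K' : Set M := ⋃ t ∈ Icc (0 : ℝ) 1, Φ t '' K with hK'def
  have hKK' : ∀ t ∈ Icc (0 : ℝ) 1, ∀ x ∈ K, Φ t x ∈ K' := fun t ht x hx =>
    mem_iUnion₂.2 ⟨t, ht, x, hx, rfl⟩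
  have hK'Ω : K' ⊆ Ω₁ := by
    refine iUnion₂_subset fun t _ => ?_
    rintro _ ⟨x, hx, rfl⟩
    exact hmaps t x (hKΩ hx)
  have hK0 : ∀ x ∈ K, x ∈ K' := fun x hx => by
    have := hKK' 0 (by simp) x hx
    rwa [hΦ0 x (hKΩ hx)] at this
  have hmem : ∀ x, χ x ≠ 0 → x ∈ K := fun x hx => by_contra fun h => hx (hχK x h)
  -- the time function along a curve of the inverse family
  have hcurve : ∀ y ∈ Ω₁, ∀ t, DifferentiableAt ℝ (fun t' => χ (Ψ t' y)) t := fun y hy t => by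
    have h1 : ContMDiffAt 𝓘(ℝ, ℝ) 𝓘(ℝ, EM) ∞ (fun t' => Ψ t' y) t :=
      ContMDiffAt.comp (f := fun t' : ℝ => (t', y)) t (hΨ t y hy)
        (contMDiffAt_id.prodMk contMDiffAt_const)
    exact (hχ.contMDiffAt.comp t h1).contDiffAt.differentiableAt (by simp)
  have hcurve_deriv : ∀ y ∈ Ω₁, ∀ t ∈ Icc (0 : ℝ) 1, deriv (fun t' => χ (Ψ t' y)) t < 1 := by
    intro y hy t ht
    -- Where `χ` vanishes along the curve it is minimal, so its derivative is `0`. Elsewhere `Ψ t y`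
    -- lies in `K`, and the slope hypothesis applies at this point.
    by_cases h : χ (Ψ t y) = 0
    · have : IsLocalMin (fun t' => χ (Ψ t' y)) t :=
        Filter.Eventually.of_forall fun t' => by simp only [h]; exact hχ0 _
      rw [this.deriv_eq_zero]; exact one_pos
    · have := hderiv t ht _ (hmem _ h)
      rwa [hΦΨ t y hy] at this
  have hslope : ∀ s ∈ Icc (0 : ℝ) 1, ∀ y ∈ Ω₁, ∀ t ∈ Icc (0 : ℝ) 1,
      0 < deriv (fun t' => t' - s * χ (Ψ t' y)) t := by
    intro s hs y hy t ht
    have h1 : HasDerivAt (fun t' => t' - s * χ (Ψ t' y))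
        (1 - s * deriv (fun t' => χ (Ψ t' y)) t) t :=
      (hasDerivAt_id t).sub ((hcurve y hy t).hasDerivAt.const_mul s)
    rw [h1.deriv]
    have h2 := hcurve_deriv y hy t ht
    nlinarith [hs.1, hs.2, mul_nonneg hs.1 (sub_nonneg.2 h2.le)]
  have hcont : ∀ s : ℝ, ∀ y ∈ Ω₁, Continuous fun t' => t' - s * χ (Ψ t' y) := fun s y hy =>
    continuous_id.sub (continuous_const.mul
      (continuous_iff_continuousAt.2 fun t => (hcurve y hy t).continuousAt))
  have hmono : ∀ s ∈ Icc (0 : ℝ) 1, ∀ y ∈ Ω₁,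
      StrictMonoOn (fun t' => t' - s * χ (Ψ t' y)) (Icc 0 1) := fun s hs y hy =>
    strictMonoOn_of_deriv_pos (convex_Icc 0 1) (hcont s y hy).continuousOn
      fun t ht => hslope s hs y hy t (interior_subset ht)
  have hroot : ∀ s ∈ Icc (0 : ℝ) 1, ∀ y ∈ Ω₁, ∃ t ∈ Icc (0 : ℝ) 1, t = s * χ (Ψ t y) := by
    intro s hs y hy
    have h0 : (0 : ℝ) - s * χ (Ψ 0 y) ≤ 0 := by nlinarith [hs.1, hχ0 (Ψ 0 y), mul_nonneg hs.1 (hχ0 (Ψ 0 y))]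
    have h1 : (0 : ℝ) ≤ 1 - s * χ (Ψ 1 y) := by
      have := mul_le_one₀ hs.2 (hχ0 (Ψ 1 y)) (hχ1 (Ψ 1 y)); linarith
    obtain ⟨t, ht, h⟩ := intermediate_value_Icc zero_le_one (hcont s y hy).continuousOn ⟨h0, h1⟩
    exact ⟨t, ht, sub_eq_zero.1 h⟩
  -- `τ s y` is the time that the clock shows at the preimage of `y` under the stopped isotopy;
  -- strict monotonicity of `t - s χ(Ψ t y)` makes it unique.
  choose! τ hτ hτeq using hroot
  have huniq : ∀ s ∈ Icc (0 : ℝ) 1, ∀ y ∈ Ω₁, ∀ t ∈ Icc (0 : ℝ) 1, t = s * χ (Ψ t y) →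
      τ s y = t := fun s hs y hy t ht h =>
    (hmono s hs y hy).injOn (hτ s hs y hy) ht
      ((sub_eq_zero.2 (hτeq s hs y hy)).trans (sub_eq_zero.2 h).symm)
  -- the isotopy
  let fwd : ℝ → M → M := fun s x => if x ∈ K then Φ (s * χ x) x else x
  have fwd_of_mem : ∀ s, ∀ x ∈ Ω₀, fwd s x = Φ (s * χ x) x := by
    intro s x hx
    by_cases h : x ∈ K
    · exact if_pos h
    · simp only [fwd, if_neg h, hχK x h, mul_zero, hΦ0 x hx]
  have fwd_of_notMem : ∀ s, ∀ x ∉ K, fwd s x = x := fun s x hx => if_neg hx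
  have fwd_smooth : ContMDiff (𝓘(ℝ, EM).prod 𝓘(ℝ, ℝ)) 𝓘(ℝ, EM) ∞
      (fun p : M × ℝ => fwd p.2 p.1) := by
    rintro ⟨x, s⟩
    by_cases hx : x ∈ Ω₀
    · have h1 : ContMDiffAt (𝓘(ℝ, EM).prod 𝓘(ℝ, ℝ)) 𝓘(ℝ, ℝ) ∞
          (fun p : M × ℝ => p.2 * χ p.1) (x, s) :=
        contMDiffAt_snd.mul (hχ.contMDiffAt.comp (x, s) contMDiffAt_fst)
      have h2 := ContMDiffAt.comp (f := fun p : M × ℝ => (p.2 * χ p.1, p.1)) (x, s)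
        (hΦ (s * χ x) x hx) (h1.prodMk contMDiffAt_fst)
      refine h2.congr_of_eventuallyEq ?_
      filter_upwards [(hΩ₀.preimage continuous_fst).mem_nhds hx] with p hp
      exact fwd_of_mem p.2 p.1 hp
    · refine (contMDiffAt_fst (p := (x, s))).congr_of_eventuallyEq ?_
      filter_upwards [(hK.isOpen_compl.preimage continuous_fst).mem_nhds
        (show x ∈ Kᶜ from fun h => hx (hKΩ h))] with p hp
      exact fwd_of_notMem p.2 p.1 hp
  let bwd : ℝ → M → M := fun s y => if y ∈ K' then Ψ (τ s y) y else y
  have bwd_of_mem : ∀ s ∈ Icc (0 : ℝ) 1, ∀ y ∈ Ω₁, bwd s y = Ψ (τ s y) y := by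
    intro s hs y hy
    by_cases h : y ∈ K'
    · exact if_pos h
    · have h1 : χ (Ψ (τ s y) y) = 0 := by
        by_contra h2
        have h3 := hKK' _ (hτ s hs y hy) _ (hmem _ h2)
        rw [hΦΨ _ y hy] at h3
        exact h h3
      have h4 : τ s y = 0 := by rw [hτeq s hs y hy, h1, mul_zero]
      simp only [bwd, if_neg h, h4, hΨ0 y hy]
  have bwd_smooth : ∀ s ∈ Icc (0 : ℝ) 1, ContMDiff 𝓘(ℝ, EM) 𝓘(ℝ, EM) ∞ (bwd s) := by
    intro s hs y
    by_cases hy : y ∈ Ω₁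
    · have h1 : ContMDiffAt (𝓘(ℝ, EM).prod 𝓘(ℝ, ℝ)) 𝓘(ℝ, EM) ∞
          (fun p : M × ℝ => Ψ p.2 p.1) (y, τ s y) :=
        ContMDiffAt.comp (f := fun p : M × ℝ => (p.2, p.1)) (y, τ s y) (hΨ _ y hy)
          (contMDiffAt_snd.prodMk contMDiffAt_fst)
      have h2 : ContMDiffAt (𝓘(ℝ, EM).prod 𝓘(ℝ, ℝ)) 𝓘(ℝ, ℝ) ∞
          (uncurry fun (y : M) (t : ℝ) => t - s * χ (Ψ t y)) (y, τ s y) :=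
        contMDiffAt_snd.sub (contMDiffAt_const.mul (hχ.contMDiffAt.comp (y, τ s y) h1))
      obtain ⟨σ, hσ, hσ0, hσe⟩ := exists_contMDiffAt_implicit h2
        (sub_eq_zero.2 (hτeq s hs y hy)) (hslope s hs y hy _ (hτ s hs y hy)).ne'
      have h3 : ContMDiffAt 𝓘(ℝ, EM) 𝓘(ℝ, EM) ∞ (fun y => Ψ (σ y) y) y :=
        ContMDiffAt.comp (f := fun y : M => (y, σ y)) y (by rw [hσ0]; exact h1)
          (contMDiffAt_id.prodMk hσ)
      refine h3.congr_of_eventuallyEq ?_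
      -- The equation itself forces the implicit solution `σ` into `[0, 1]`; hence it is `τ s` near
      -- `y` by uniqueness, and `τ s` is smooth.
      filter_upwards [hσe, hΩ₁.mem_nhds hy] with z hz hzΩ
      have h4 : σ z = s * χ (Ψ (σ z) z) := sub_eq_zero.1 hz
      have h5 : σ z ∈ Icc (0 : ℝ) 1 := by
        rw [h4]
        exact ⟨mul_nonneg hs.1 (hχ0 _), mul_le_one₀ hs.2 (hχ0 _) (hχ1 _)⟩
      rw [bwd_of_mem s hs z hzΩ, huniq s hs z hzΩ _ h5 h4]
    · refine (contMDiffAt_id (x := y)).congr_of_eventuallyEq ?_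
      filter_upwards [hK'.isOpen_compl.mem_nhds (show y ∈ K'ᶜ from fun h => hy (hK'Ω h))] with z hz
      exact if_neg hz
  have left_inv : ∀ s ∈ Icc (0 : ℝ) 1, LeftInverse (bwd s) (fwd s) := by
    intro s hs x
    by_cases hx : x ∈ K
    · have hσ : s * χ x ∈ Icc (0 : ℝ) 1 :=
        ⟨mul_nonneg hs.1 (hχ0 _), mul_le_one₀ hs.2 (hχ0 _) (hχ1 _)⟩
      have hy := hmaps (s * χ x) x (hKΩ hx)
      rw [fwd_of_mem s x (hKΩ hx), bwd_of_mem s hs _ hy,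
        huniq s hs _ hy _ hσ (by rw [hΨΦ _ x (hKΩ hx)]), hΨΦ _ x (hKΩ hx)]
    · rw [fwd_of_notMem s x hx]
      by_cases hx' : x ∈ K'
      · have hy := hK'Ω hx'
        rw [bwd_of_mem s hs x hy, huniq s hs x hy 0 (by simp)
          (by rw [hΨ0 x hy, hχK x hx, mul_zero]), hΨ0 x hy]
      · exact if_neg hx'
  have right_inv : ∀ s ∈ Icc (0 : ℝ) 1, RightInverse (bwd s) (fwd s) := by
    intro s hs y
    by_cases hy : y ∈ K'
    · have hyΩ := hK'Ω hy
      rw [bwd_of_mem s hs y hyΩ]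
      by_cases hx : Ψ (τ s y) y ∈ K
      · rw [fwd_of_mem s _ (hKΩ hx), ← hτeq s hs y hyΩ, hΦΨ _ y hyΩ]
      · rw [fwd_of_notMem s _ hx, hτeq s hs y hyΩ, hχK _ hx, mul_zero, hΨ0 y hyΩ]
    · have h1 : bwd s y = y := if_neg hy
      rw [h1, fwd_of_notMem s y fun h => hy (hK0 y h)]
  have fwd_smul : ∀ s (g : G) x, fwd s (g • x) = g • fwd s x := by
    intro s g x
    by_cases hx : x ∈ Ω₀
    · rw [fwd_of_mem s _ (hΩ₀_smul g x hx), fwd_of_mem s x hx, hχ_smul, hΦ_smul _ g x hx]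
    · have hgx : g • x ∉ Ω₀ := fun h => hx (by simpa using hΩ₀_smul g⁻¹ _ h)
      rw [fwd_of_notMem s x fun h => hx (hKΩ h), fwd_of_notMem s _ fun h => hgx (hKΩ h)]
  let H : EquivariantDiffeotopy G EM M :=
    { toDiffeo := fun t =>
        { toFun := fwd t
          invFun := bwd t
          left_inv := left_inv t t.2
          right_inv := right_inv t t.2
          contMDiff_toFun := fwd_smooth.comp (contMDiff_id.prodMk contMDiff_const)
          contMDiff_invFun := bwd_smooth t t.2 }
      contMDiff := fwd_smooth.comp
        (contMDiff_fst.prodMk (contMDiff_subtypeVal_Icc.comp contMDiff_snd))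
      zero := fun x => by
        change fwd (0 : unitInterval) x = x
        by_cases hx : x ∈ K
        · rw [fwd_of_mem _ x (hKΩ hx)]; simp [hΦ0 x (hKΩ hx)]
        · exact fwd_of_notMem _ x hx
      map_smul := fun t g x => fwd_smul t g x }
  exact ⟨H, fun t x hx => fwd_of_mem t x (hKΩ hx), fun t x hx => fwd_of_notMem t x hx⟩

end CutoffIsotopy

/-! ### Consequences of the axioms of a `G`-vector bundle. -/

section GVectorBundle

variable (EG ES : Type*) [NormedAddCommGroup EG] [NormedSpace ℝ EG]
  [NormedAddCommGroup ES] [NormedSpace ℝ ES]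
  {G : Type*} [Group G] [TopologicalSpace G] [ChartedSpace EG G]
  {S : Type*} [TopologicalSpace S] [ChartedSpace ES S] [MulAction G S]
  {F : Type*} [NormedAddCommGroup F] [NormedSpace ℝ F]
  {E : S → Type*} [TopologicalSpace (TotalSpace F E)]
  [∀ x, AddCommGroup (E x)] [∀ x, Module ℝ (E x)] [∀ x, TopologicalSpace (E x)]
  [FiberBundle F E] [MulAction G (TotalSpace F E)] [IsGVectorBundle EG ES G F E]

include EG ES

namespace IsGVectorBundle

theorem exists_linearEquiv (g : G) (x : S) : ∃ T : E x ≃ₗ[ℝ] E (g • x),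
    ∀ v : E x, g • (⟨x, v⟩ : TotalSpace F E) = ⟨g • x, T v⟩ := by
  obtain ⟨T, hT⟩ := smul_linear (EG := EG) (ES := ES) (F := F) (E := E) g x
  have hbij : Function.Bijective T := by
    constructor
    · intro u w h
      have h1 : g • (⟨x, u⟩ : TotalSpace F E) = g • ⟨x, w⟩ := by rw [hT, hT, h]
      exact TotalSpace.mk_inj.1 (MulAction.injective g h1)
    · intro w
      obtain ⟨T', hT'⟩ := smul_linear (EG := EG) (ES := ES) (F := F) (E := E) g⁻¹ (g • x)
      have h1 : g • g⁻¹ • (⟨g • x, w⟩ : TotalSpace F E) = ⟨g • x, w⟩ := smul_inv_smul g _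
      have h2 : (g⁻¹ • (⟨g • x, w⟩ : TotalSpace F E)).proj = x := by
        rw [hT']; exact inv_smul_smul g x
      generalize g⁻¹ • (⟨g • x, w⟩ : TotalSpace F E) = z at h1 h2
      obtain ⟨y, u⟩ := z
      obtain rfl : y = x := h2
      rw [hT] at h1
      exact ⟨u, TotalSpace.mk_inj.1 h1⟩
  exact ⟨LinearEquiv.ofBijective T hbij, hT⟩

theorem proj_smul (g : G) (v : TotalSpace F E) : (g • v).proj = g • v.proj := by
  obtain ⟨T, hT⟩ := exists_linearEquiv EG ES (F := F) (E := E) g v.proj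
  exact congrArg TotalSpace.proj (hT v.snd)

theorem smul_fiberSmul (g : G) (c : ℝ) (v : TotalSpace F E) :
    g • fiberSmul c v = fiberSmul c (g • v) := by
  obtain ⟨T, hT⟩ := exists_linearEquiv EG ES (F := F) (E := E) g v.proj
  have h1 : g • v = ⟨g • v.proj, T v.snd⟩ := hT v.snd
  rw [h1, fiberSmul, hT, map_smul]; rfl

theorem continuous_smul (g : G) : Continuous fun v : TotalSpace F E => g • v :=
  (contMDiff_smul (EG := EG) (ES := ES) (G := G) (F := F) (E := E)).continuous.comp
    (by fun_prop : Continuous fun v : TotalSpace F E => (g, v))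

end IsGVectorBundle

end GVectorBundle

/-! ### Transition maps of tubular neighbourhoods and their fibre derivatives. -/

namespace TubularNeighborhood

open IsGVectorBundle Function Bundle.ContMDiffRiemannianMetric

variable {G : Type*} [Group G]
  {EM : Type*} [NormedAddCommGroup EM] [NormedSpace ℝ EM]
  {ES : Type*} [NormedAddCommGroup ES] [NormedSpace ℝ ES]
  {M : Type*} [TopologicalSpace M] [ChartedSpace EM M] [MulAction G M]
  {S : SubMulAction G M} [ChartedSpace ES S] [IsManifold 𝓘(ℝ, ES) ∞ S]
  {F : Type*} [NormedAddCommGroup F] [NormedSpace ℝ F]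
  {E : S → Type*} [TopologicalSpace (TotalSpace F E)]
  [∀ x, AddCommGroup (E x)] [∀ x, Module ℝ (E x)] [∀ x, TopologicalSpace (E x)]
  [∀ x, IsTopologicalAddGroup (E x)] [∀ x, ContinuousConstSMul ℝ (E x)]
  [FiberBundle F E] [VectorBundle ℝ F E] [ContMDiffVectorBundle ∞ F E 𝓘(ℝ, ES)]
  [MulAction G (TotalSpace F E)]
  {F' : Type*} [NormedAddCommGroup F'] [NormedSpace ℝ F']
  {E' : S → Type*} [TopologicalSpace (TotalSpace F' E')]
  [∀ x, AddCommGroup (E' x)] [∀ x, Module ℝ (E' x)] [∀ x, TopologicalSpace (E' x)]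
  [∀ x, IsTopologicalAddGroup (E' x)] [∀ x, ContinuousConstSMul ℝ (E' x)]
  [FiberBundle F' E'] [VectorBundle ℝ F' E'] [ContMDiffVectorBundle ∞ F' E' 𝓘(ℝ, ES)]
  [MulAction G (TotalSpace F' E')]

section Single

variable (T : TubularNeighborhood G EM ES S F E)

theorem mem_source_iff {v : TotalSpace F E} : v ∈ T.φ.source ↔ T.metric.normSq v < T.ε v.proj := by
  rw [T.φ_source]; rfl

theorem zero_mem_source (x : S) : (⟨x, 0⟩ : TotalSpace F E) ∈ T.φ.source := by
  rw [mem_source_iff, normSq_zero]; exact T.ε_pos x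

theorem contMDiffAt_φ {v : TotalSpace F E} (hv : v ∈ T.φ.source) :
    ContMDiffAt (𝓘(ℝ, ES).prod 𝓘(ℝ, F)) 𝓘(ℝ, EM) ∞ T.φ v :=
  T.φ_smooth.contMDiffAt (T.φ.open_source.mem_nhds hv)

theorem contMDiffAt_φ_symm {y : M} (hy : y ∈ T.φ.target) :
    ContMDiffAt 𝓘(ℝ, EM) (𝓘(ℝ, ES).prod 𝓘(ℝ, F)) ∞ T.φ.symm y :=
  T.φ_symm_smooth.contMDiffAt (T.φ.open_target.mem_nhds hy)

theorem coe_mem_target (x : S) : (x : M) ∈ T.φ.target := by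
  rw [← T.φ_zero x]; exact T.φ.map_source (T.zero_mem_source x)

theorem φ_symm_coe (x : S) : T.φ.symm (x : M) = ⟨x, 0⟩ := by
  rw [← T.φ_zero x, T.φ.left_inv (T.zero_mem_source x)]

theorem normSq_smul (g : G) (v : TotalSpace F E) :
    T.metric.normSq (g • v) = T.metric.normSq v := T.metric_smul g v

include T in
theorem contMDiff_subtype_val :
    ContMDiff 𝓘(ℝ, ES) 𝓘(ℝ, EM) ∞ (Subtype.val : S → M) := by
  intro x
  have h : ContMDiff 𝓘(ℝ, ES) (𝓘(ℝ, ES).prod 𝓘(ℝ, F)) ∞ (zeroSection F E) :=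
    contMDiff_zeroSection ℝ E
  refine ((T.contMDiffAt_φ (T.zero_mem_source x)).comp x h.contMDiffAt).congr_of_eventuallyEq ?_
  exact Filter.Eventually.of_forall fun y => (T.φ_zero y).symm

section Action

variable (EG : Type*) [NormedAddCommGroup EG] [NormedSpace ℝ EG]
  [TopologicalSpace G] [ChartedSpace EG G] [IsGVectorBundle EG ES G F E]

include EG

theorem smul_mem_source (g : G) {v : TotalSpace F E} (hv : v ∈ T.φ.source) :
    g • v ∈ T.φ.source := by
  rw [mem_source_iff] at hv ⊢
  rwa [normSq_smul, proj_smul EG ES, T.ε_smul]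

theorem smul_mem_target (g : G) {y : M} (hy : y ∈ T.φ.target) : g • y ∈ T.φ.target := by
  have h := T.φ.map_source (T.smul_mem_source EG g (T.φ.map_target hy))
  rwa [T.φ_smul g _ (T.φ.map_target hy), T.φ.right_inv hy] at h

theorem φ_symm_smul (g : G) {y : M} (hy : y ∈ T.φ.target) :
    T.φ.symm (g • y) = g • T.φ.symm y := by
  have h := T.φ_smul g _ (T.φ.map_target hy)
  rw [T.φ.right_inv hy] at h
  rw [← h, T.φ.left_inv (T.smul_mem_source EG g (T.φ.map_target hy))]

theorem metric_linearEquiv {g : G} {x : S} {L : E x ≃ₗ[ℝ] E (g • x)}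
    (hL : ∀ v : E x, g • (⟨x, v⟩ : TotalSpace F E) = ⟨g • x, L v⟩) (u w : E x) :
    T.metric.inner (g • x) (L u) (L w) = T.metric.inner x u w := by
  have hq : ∀ v : E x, T.metric.inner (g • x) (L v) (L v) = T.metric.inner x v v := fun v => by
    have h := T.normSq_smul g (⟨x, v⟩ : TotalSpace F E)
    rw [hL] at h
    exact h
  have h1 := hq (u + w)
  simp only [map_add, _root_.add_apply, hq u, hq w] at h1
  have h2 := T.metric.symm (g • x) (L u) (L w)
  have h3 := T.metric.symm x u w
  linarith

end Action

end Single

section Transition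

variable (T₀ : TubularNeighborhood G EM ES S F E) (T₁ : TubularNeighborhood G EM ES S F' E')

/-- The transition map `φ₁⁻¹ ∘ φ₀` between two tubular neighbourhoods. -/
def transition (v : TotalSpace F E) : TotalSpace F' E' := T₁.φ.symm (T₀.φ v)

/-- The domain of the transition map. -/
def transitionDomain : Set (TotalSpace F E) := T₀.φ.source ∩ T₀.φ ⁻¹' T₁.φ.target

theorem isOpen_transitionDomain : IsOpen (T₀.transitionDomain T₁) :=
  T₀.φ.isOpen_inter_preimage T₁.φ.open_target

theorem zero_mem_transitionDomain (x : S) :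
    (⟨x, 0⟩ : TotalSpace F E) ∈ T₀.transitionDomain T₁ :=
  ⟨T₀.zero_mem_source x, by rw [mem_preimage, T₀.φ_zero]; exact T₁.coe_mem_target x⟩

theorem transition_zero (x : S) : T₀.transition T₁ ⟨x, 0⟩ = ⟨x, 0⟩ := by
  rw [transition, T₀.φ_zero, T₁.φ_symm_coe]

variable {T₀ T₁}

theorem φ_transition {v : TotalSpace F E} (hv : v ∈ T₀.transitionDomain T₁) :
    T₁.φ (T₀.transition T₁ v) = T₀.φ v := T₁.φ.right_inv hv.2

theorem transition_mem {v : TotalSpace F E} (hv : v ∈ T₀.transitionDomain T₁) :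
    T₀.transition T₁ v ∈ T₁.transitionDomain T₀ :=
  ⟨T₁.φ.map_target hv.2, by
    rw [mem_preimage, φ_transition hv]; exact T₀.φ.map_source hv.1⟩

theorem transition_transition {v : TotalSpace F E} (hv : v ∈ T₀.transitionDomain T₁) :
    T₁.transition T₀ (T₀.transition T₁ v) = v := by
  rw [transition, φ_transition hv, T₀.φ.left_inv hv.1]

theorem contMDiffAt_transition {v : TotalSpace F E} (hv : v ∈ T₀.transitionDomain T₁) :
    ContMDiffAt (𝓘(ℝ, ES).prod 𝓘(ℝ, F)) (𝓘(ℝ, ES).prod 𝓘(ℝ, F')) ∞ (T₀.transition T₁) v :=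
  ContMDiffAt.comp v (T₁.contMDiffAt_φ_symm hv.2) (T₀.contMDiffAt_φ hv.1)

theorem CompatibleWith.apply_φ {P : Type*} {f : M → P} (h₀ : T₀.CompatibleWith f)
    {v : TotalSpace F E} (hv : v ∈ T₀.φ.source) : f (T₀.φ v) = f v.proj := by
  have h := h₀ _ (T₀.φ.map_source hv)
  rw [projection, T₀.φ.left_inv hv] at h
  exact h.symm

/-- Both embeddings satisfy `f ∘ φ = f ∘ π`. So the transition map may move base points, but only
inside the fibres of `f`; this is the source of the compatibility of the isotopy. -/
theorem CompatibleWith.apply_transition {P : Type*} {f : M → P} (h₀ : T₀.CompatibleWith f)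
    (h₁ : T₁.CompatibleWith f) {v : TotalSpace F E} (hv : v ∈ T₀.transitionDomain T₁) :
    f (T₀.transition T₁ v).proj = f v.proj := by
  rw [← h₀.apply_φ hv.1, ← φ_transition hv, h₁.apply_φ (transition_mem hv).1]

theorem IsoOver.transition_eq {U : Set S} (ψ : T₀.IsoOver T₁ U) {x : S} (hx : x ∈ U) {v : E x}
    (hv : T₀.metric.inner x v v < ψ.δ ⟨x, hx⟩) :
    (⟨x, v⟩ : TotalSpace F E) ∈ T₀.transitionDomain T₁ ∧
      T₀.transition T₁ ⟨x, v⟩ = ⟨x, ψ.ψ ⟨x, hx⟩ v⟩ := by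
  have h1 := ψ.φ_comp ⟨x, hx⟩ v hv
  have h2 : (⟨x, ψ.ψ ⟨x, hx⟩ v⟩ : TotalSpace F' E') ∈ T₁.φ.source := by
    rw [mem_source_iff]
    exact (ψ.isometry ⟨x, hx⟩ v v).trans_lt (hv.trans_le ((ψ.δ_le _).trans (min_le_right _ _)))
  refine ⟨⟨?_, ?_⟩, ?_⟩
  · rw [mem_source_iff]
    exact hv.trans_le ((ψ.δ_le _).trans (min_le_left _ _))
  · rw [mem_preimage, ← h1]; exact T₁.φ.map_source h2
  · rw [transition, ← h1, T₁.φ.left_inv h2]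

section Action

variable {EG : Type*} [NormedAddCommGroup EG] [NormedSpace ℝ EG]
  [TopologicalSpace G] [ChartedSpace EG G] [IsGVectorBundle EG ES G F E]
  [IsGVectorBundle EG ES G F' E']

variable (EG) in
include EG in
theorem smul_mem_transitionDomain (g : G) {v : TotalSpace F E}
    (hv : v ∈ T₀.transitionDomain T₁) : g • v ∈ T₀.transitionDomain T₁ :=
  ⟨T₀.smul_mem_source EG g hv.1, by
    rw [mem_preimage, T₀.φ_smul g v hv.1]; exact T₁.smul_mem_target EG g hv.2⟩

variable (EG) in
include EG in
theorem transition_smul (g : G) {v : TotalSpace F E} (hv : v ∈ T₀.transitionDomain T₁) :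
    T₀.transition T₁ (g • v) = g • T₀.transition T₁ v := by
  rw [transition, T₀.φ_smul g v hv.1, T₁.φ_symm_smul EG g hv.2]; rfl

end Action

end Transition

section NormalDeriv

variable [T2Space M] [FiniteDimensional ℝ F] [FiniteDimensional ℝ F']
  (T₀ : TubularNeighborhood G EM ES S F E) (T₁ : TubularNeighborhood G EM ES S F' E')

/-- The family `s⁻¹ θ(s v)` for the transition map `θ`. -/
def scaledTransition (s : ℝ) (v : TotalSpace F E) : TotalSpace F' E' :=
  blowUp (T₀.transition T₁) s v

/-- The fibrewise derivative of the transition map. -/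
def fiberDeriv (x : S) : E x →L[ℝ] E' x := normalDeriv F E F' E' (T₀.transition T₁) x

theorem scaledTransition_zero (v : TotalSpace F E) :
    T₀.scaledTransition T₁ 0 v = ⟨v.proj, T₀.fiberDeriv T₁ v.proj v.snd⟩ := blowUp_zero _ v

theorem scaledTransition_one (v : TotalSpace F E) :
    T₀.scaledTransition T₁ 1 v = T₀.transition T₁ v := blowUp_one _ v

theorem proj_scaledTransition (s : ℝ) (v : TotalSpace F E) :
    (T₀.scaledTransition T₁ s v).proj = (T₀.transition T₁ (fiberSmul s v)).proj :=
  proj_blowUp (T₀.transition_zero T₁) s v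

theorem scaledTransition_fiberSmul (s c : ℝ) (v : TotalSpace F E) :
    T₀.scaledTransition T₁ s (fiberSmul c v) = fiberSmul c (T₀.scaledTransition T₁ (s * c) v) :=
  blowUp_fiberSmul (T₀.transition_zero T₁) s c v

variable {T₀ T₁}

theorem contMDiffAt_scaledTransition {s : ℝ} {v : TotalSpace F E}
    (hv : fiberSmul s v ∈ T₀.transitionDomain T₁) :
    ContMDiffAt (𝓘(ℝ, ℝ).prod (𝓘(ℝ, ES).prod 𝓘(ℝ, F))) (𝓘(ℝ, ES).prod 𝓘(ℝ, F')) ∞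
      (uncurry (T₀.scaledTransition T₁)) (s, v) := by
  have := FiniteDimensional.complete ℝ F'
  exact contMDiffAt_blowUp (T₀.transition_zero T₁) (T₀.isOpen_transitionDomain T₁)
    (T₀.zero_mem_transitionDomain T₁) (fun v hv => contMDiffAt_transition hv) hv

theorem scaledTransition_scaledTransition {s : ℝ} {v : TotalSpace F E}
    (hv : fiberSmul s v ∈ T₀.transitionDomain T₁) :
    T₁.scaledTransition T₀ s (T₀.scaledTransition T₁ s v) = v := by
  have := FiniteDimensional.complete ℝ F
  have := FiniteDimensional.complete ℝ F'
  exact blowUp_blowUp (T₀.transition_zero T₁) (T₁.transition_zero T₀)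
    (T₀.isOpen_transitionDomain T₁) (T₀.zero_mem_transitionDomain T₁)
    (fun v hv => contMDiffAt_transition hv) (T₁.isOpen_transitionDomain T₀)
    (T₁.zero_mem_transitionDomain T₀) (fun v hv => contMDiffAt_transition hv)
    (fun v hv => transition_transition hv) hv

variable (T₀ T₁) in
theorem fiberDeriv_fiberDeriv (x : S) (v : E x) :
    T₁.fiberDeriv T₀ x (T₀.fiberDeriv T₁ x v) = v := by
  have h := scaledTransition_scaledTransition (T₀ := T₀) (T₁ := T₁) (s := 0) (v := ⟨x, v⟩)
    (by rw [fiberSmul_zero]; exact T₀.zero_mem_transitionDomain T₁ _)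
  rw [scaledTransition_zero, scaledTransition_zero] at h
  exact TotalSpace.mk_inj.1 h

variable (T₀ T₁) in
theorem fiberDeriv_injective (x : S) : Injective (T₀.fiberDeriv T₁ x) :=
  LeftInverse.injective (T₀.fiberDeriv_fiberDeriv T₁ x)

variable (T₀ T₁) in
theorem contMDiff_fiberDeriv :
    ContMDiff (𝓘(ℝ, ES).prod 𝓘(ℝ, F)) (𝓘(ℝ, ES).prod 𝓘(ℝ, F')) ∞
      (fun v : TotalSpace F E => (⟨v.proj, T₀.fiberDeriv T₁ v.proj v.snd⟩ : TotalSpace F' E')) := by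
  intro v
  have h := ContMDiffAt.comp (f := fun v : TotalSpace F E => ((0 : ℝ), v)) v
    (contMDiffAt_scaledTransition (T₀ := T₀) (T₁ := T₁) (s := 0) (v := v)
      (by rw [fiberSmul_zero]; exact T₀.zero_mem_transitionDomain T₁ _))
    (contMDiffAt_const.prodMk contMDiffAt_id)
  exact h.congr_of_eventuallyEq
    (Filter.Eventually.of_forall fun w => (T₀.scaledTransition_zero T₁ w).symm)

/-- Over `U` the transition map is linear on small vectors, and conjugating a linear map by scaling
changes nothing. The value at `s = 0` is the limit of this constant family. -/
theorem IsoOver.scaledTransition_eq {U : Set S} (ψ : T₀.IsoOver T₁ U) {x : S} (hx : x ∈ U)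
    {v : E x} {s : ℝ} (hv : s ^ 2 * T₀.metric.inner x v v < ψ.δ ⟨x, hx⟩) :
    T₀.scaledTransition T₁ s ⟨x, v⟩ = ⟨x, ψ.ψ ⟨x, hx⟩ v⟩ := by
  have key : ∀ s : ℝ, s ≠ 0 → s ^ 2 * T₀.metric.inner x v v < ψ.δ ⟨x, hx⟩ →
      T₀.scaledTransition T₁ s ⟨x, v⟩ = ⟨x, ψ.ψ ⟨x, hx⟩ v⟩ := by
    intro s hs hv
    have h1 : T₀.metric.inner x (s • v) (s • v) < ψ.δ ⟨x, hx⟩ := by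
      have := T₀.metric.normSq_fiberSmul s (⟨x, v⟩ : TotalSpace F E)
      exact (show T₀.metric.inner x (s • v) (s • v) = s ^ 2 * T₀.metric.inner x v v from
        this).trans_lt hv
    rw [scaledTransition, blowUp_of_ne _ hs, fiberSmul_mk s, (ψ.transition_eq hx h1).2, map_smul,
      fiberSmul_mk, smul_smul, inv_mul_cancel₀ hs, one_smul]
  by_cases hs : s = 0
  · subst hs
    have := FiniteDimensional.complete ℝ F'
    refine eq_blowUp_zero_of_eventually (T₀.transition_zero T₁)
      (contMDiffAt_transition (T₀.zero_mem_transitionDomain T₁ _)) ?_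
    have h2 : ∀ᶠ s : ℝ in 𝓝 0, s ^ 2 * T₀.metric.inner x v v < ψ.δ ⟨x, hx⟩ :=
      Filter.Tendsto.eventually_lt_const (ψ.δ_pos ⟨x, hx⟩)
        ((by fun_prop : Continuous fun s : ℝ => s ^ 2 * T₀.metric.inner x v v).tendsto' 0 0
          (by simp))
    filter_upwards [self_mem_nhdsWithin, nhdsWithin_le_nhds h2] with s hs h
    exact key s hs h
  · exact key s hs hv

theorem IsoOver.fiberDeriv_eq {U : Set S} (ψ : T₀.IsoOver T₁ U) {x : S} (hx : x ∈ U) (v : E x) :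
    T₀.fiberDeriv T₁ x v = ψ.ψ ⟨x, hx⟩ v := by
  have h := ψ.scaledTransition_eq hx (v := v) (s := 0) (by simpa using ψ.δ_pos ⟨x, hx⟩)
  rw [scaledTransition_zero] at h
  exact TotalSpace.mk_inj.1 h

section Action

variable (EG : Type*) [NormedAddCommGroup EG] [NormedSpace ℝ EG]
  [TopologicalSpace G] [ChartedSpace EG G] [IsGVectorBundle EG ES G F E]
  [IsGVectorBundle EG ES G F' E']

include EG

theorem scaledTransition_smul (g : G) {s : ℝ} {v : TotalSpace F E}
    (hv : fiberSmul s v ∈ T₀.transitionDomain T₁) :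
    T₀.scaledTransition T₁ s (g • v) = g • T₀.scaledTransition T₁ s v := by
  have := FiniteDimensional.complete ℝ F'
  exact blowUp_equivariant (T₀.transition_zero T₁) (T₀.isOpen_transitionDomain T₁)
    (T₀.zero_mem_transitionDomain T₁) (fun v hv => contMDiffAt_transition hv)
    (T := fun v => g • v) (T' := fun w => g • w) (fun s v => smul_fiberSmul EG ES g s v)
    (fun s v => smul_fiberSmul EG ES g s v) (continuous_smul EG ES g)
    (fun v hv => transition_smul EG g hv) hv

theorem fiberDeriv_smul (g : G) (v : TotalSpace F E) :
    (⟨(g • v).proj, T₀.fiberDeriv T₁ (g • v).proj (g • v).snd⟩ : TotalSpace F' E') =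
      g • (⟨v.proj, T₀.fiberDeriv T₁ v.proj v.snd⟩ : TotalSpace F' E') := by
  have h := scaledTransition_smul (T₀ := T₀) (T₁ := T₁) EG g (s := 0) (v := v)
    (by rw [fiberSmul_zero]; exact T₀.zero_mem_transitionDomain T₁ _)
  rwa [scaledTransition_zero, scaledTransition_zero] at h

end Action

end NormalDeriv

end TubularNeighborhood

/-! ### The path from the transition map to a fibrewise isometry. -/

/-- The paths depend on time only through `Real.smoothTransition`. They are thus defined for all
real times, and conditions on them need checking only on the compact interval. -/
theorem Real.smoothTransition.exists_mem_Icc (t : ℝ) :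
    ∃ t' ∈ Icc (0 : ℝ) 1, Real.smoothTransition t' = Real.smoothTransition t := by
  rcases le_total t 0 with h | h
  · exact ⟨0, by simp, by rw [Real.smoothTransition.zero, Real.smoothTransition.zero_of_nonpos h]⟩
  rcases le_total 1 t with h' | h'
  · exact ⟨1, by simp, by rw [Real.smoothTransition.one, Real.smoothTransition.one_of_one_le h']⟩
  · exact ⟨t, ⟨h, h'⟩, rfl⟩

theorem isOpen_setOf_forall_mem_of_isCompact {X Y : Type*} [TopologicalSpace X] [TopologicalSpace Y]
    {K : Set X} (hK : IsCompact K) {W : Set (X × Y)} (hW : IsOpen W) :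
    IsOpen {y | ∀ x ∈ K, (x, y) ∈ W} := by
  refine isOpen_iff_mem_nhds.2 fun y hy => ?_
  refine hK.eventually_forall_of_forall_eventually (P := fun y x => (x, y) ∈ W) fun x hx => ?_
  exact (hW.preimage continuous_swap).mem_nhds (hy x hx)

namespace TubularNeighborhood

open IsGVectorBundle Function Bundle.ContMDiffRiemannianMetric

variable {G : Type*} [Group G]
  {EM : Type*} [NormedAddCommGroup EM] [NormedSpace ℝ EM]
  {ES : Type*} [NormedAddCommGroup ES] [NormedSpace ℝ ES]
  {M : Type*} [TopologicalSpace M] [ChartedSpace EM M] [MulAction G M]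
  {S : SubMulAction G M} [ChartedSpace ES S] [IsManifold 𝓘(ℝ, ES) ∞ S]
  {F : Type*} [NormedAddCommGroup F] [NormedSpace ℝ F]
  {E : S → Type*} [TopologicalSpace (TotalSpace F E)]
  [∀ x, AddCommGroup (E x)] [∀ x, Module ℝ (E x)] [∀ x, TopologicalSpace (E x)]
  [∀ x, IsTopologicalAddGroup (E x)] [∀ x, ContinuousConstSMul ℝ (E x)]
  [FiberBundle F E] [VectorBundle ℝ F E] [ContMDiffVectorBundle ∞ F E 𝓘(ℝ, ES)]
  [MulAction G (TotalSpace F E)]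
  {F' : Type*} [NormedAddCommGroup F'] [NormedSpace ℝ F']
  {E' : S → Type*} [TopologicalSpace (TotalSpace F' E')]
  [∀ x, AddCommGroup (E' x)] [∀ x, Module ℝ (E' x)] [∀ x, TopologicalSpace (E' x)]
  [∀ x, IsTopologicalAddGroup (E' x)] [∀ x, ContinuousConstSMul ℝ (E' x)]
  [FiberBundle F' E'] [VectorBundle ℝ F' E'] [ContMDiffVectorBundle ∞ F' E' 𝓘(ℝ, ES)]
  [MulAction G (TotalSpace F' E')]
  [T2Space M] [FiniteDimensional ℝ F] [FiniteDimensional ℝ F']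
  (T₀ : TubularNeighborhood G EM ES S F E) (T₁ : TubularNeighborhood G EM ES S F' E')

/-- The straight path from the identity to the polar factor of the fibre derivative. -/
def polar (t : ℝ) (v : TotalSpace F E) : TotalSpace F E :=
  polarPath T₀.metric T₁.metric (T₀.fiberDeriv T₁) t v

/-- The inverse of `polar`. -/
def polarInv (t : ℝ) (v : TotalSpace F E) : TotalSpace F E :=
  polarPathInv T₀.metric T₁.metric (T₀.fiberDeriv T₁) t v

/-- The isometric part of the fibre derivative of the transition map. -/
def fiberIsometry (x : S) : E x →ₗ[ℝ] E' x :=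
  (T₀.fiberDeriv T₁ x).toLinearMap ∘ₗ polarMap T₀.metric T₁.metric (T₀.fiberDeriv T₁) x

/-- The scaled path from the transition map (at time `0`) to a fibrewise isometry (at time `1`). -/
def path (t s : ℝ) (v : TotalSpace F E) : TotalSpace F' E' :=
  T₀.scaledTransition T₁ ((1 - Real.smoothTransition t) * s) (T₀.polar T₁ t v)

/-- The inverse of `path`. -/
def pathInv (t s : ℝ) (w : TotalSpace F' E') : TotalSpace F E :=
  T₀.polarInv T₁ t (T₁.scaledTransition T₀ ((1 - Real.smoothTransition t) * s) w)

theorem proj_polar (t : ℝ) (v : TotalSpace F E) : (T₀.polar T₁ t v).proj = v.proj := rfl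

theorem proj_polarInv (t : ℝ) (v : TotalSpace F E) : (T₀.polarInv T₁ t v).proj = v.proj := rfl

theorem polar_fiberSmul (t c : ℝ) (v : TotalSpace F E) :
    T₀.polar T₁ t (fiberSmul c v) = fiberSmul c (T₀.polar T₁ t v) :=
  polarPath_fiberSmul _ _ _ t c v

theorem polarInv_fiberSmul (t c : ℝ) (v : TotalSpace F E) :
    T₀.polarInv T₁ t (fiberSmul c v) = fiberSmul c (T₀.polarInv T₁ t v) :=
  polarPathInv_fiberSmul _ _ (T₀.fiberDeriv_injective T₁) t c v

theorem polarInv_polar (t : ℝ) (v : TotalSpace F E) : T₀.polarInv T₁ t (T₀.polar T₁ t v) = v :=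
  polarPathInv_polarPath _ _ (T₀.fiberDeriv_injective T₁) t v

theorem polar_polarInv (t : ℝ) (v : TotalSpace F E) : T₀.polar T₁ t (T₀.polarInv T₁ t v) = v :=
  polarPath_polarPathInv _ _ (T₀.fiberDeriv_injective T₁) t v

theorem contMDiff_polar : ContMDiff (𝓘(ℝ, ℝ).prod (𝓘(ℝ, ES).prod 𝓘(ℝ, F)))
    (𝓘(ℝ, ES).prod 𝓘(ℝ, F)) ∞ (uncurry (T₀.polar T₁)) :=
  contMDiff_polarPath _ _ (T₀.fiberDeriv_injective T₁) (T₀.contMDiff_fiberDeriv T₁)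

theorem contMDiff_polarInv : ContMDiff (𝓘(ℝ, ℝ).prod (𝓘(ℝ, ES).prod 𝓘(ℝ, F)))
    (𝓘(ℝ, ES).prod 𝓘(ℝ, F)) ∞ (uncurry (T₀.polarInv T₁)) :=
  contMDiff_polarPathInv _ _ (T₀.fiberDeriv_injective T₁) (T₀.contMDiff_fiberDeriv T₁)

theorem polar_zero (v : TotalSpace F E) : T₀.polar T₁ 0 v = v := polarPath_zero _ _ _ v

theorem polarInv_zero (v : TotalSpace F E) : T₀.polarInv T₁ 0 v = v := by
  conv_lhs => rw [← T₀.polar_zero T₁ v, T₀.polarInv_polar]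

variable {T₀ T₁} in
theorem IsoOver.fiberDeriv_isometry {U : Set S} (ψ : T₀.IsoOver T₁ U) {x : S} (hx : x ∈ U)
    (u w : E x) : T₁.metric.inner x (T₀.fiberDeriv T₁ x u) (T₀.fiberDeriv T₁ x w) =
      T₀.metric.inner x u w := by
  rw [ψ.fiberDeriv_eq hx, ψ.fiberDeriv_eq hx]; exact ψ.isometry ⟨x, hx⟩ u w

variable {T₀ T₁} in
theorem IsoOver.polar_eq {U : Set S} (ψ : T₀.IsoOver T₁ U) {v : TotalSpace F E}
    (hx : v.proj ∈ U) (t : ℝ) : T₀.polar T₁ t v = v := by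
  refine congrArg (TotalSpace.mk v.proj) ?_
  rw [polarMap_of_isometry _ _ (T₀.fiberDeriv_injective T₁) (ψ.fiberDeriv_isometry hx),
    ← add_smul, sub_add_cancel, one_smul]

variable {T₀ T₁} in
theorem IsoOver.fiberIsometry_eq {U : Set S} (ψ : T₀.IsoOver T₁ U) {x : S} (hx : x ∈ U) (v : E x) :
    T₀.fiberIsometry T₁ x v = ψ.ψ ⟨x, hx⟩ v := by
  rw [fiberIsometry, LinearMap.comp_apply,
    polarMap_of_isometry _ _ (T₀.fiberDeriv_injective T₁) (ψ.fiberDeriv_isometry hx)]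
  exact ψ.fiberDeriv_eq hx v

theorem fiberIsometry_bijective (x : S) : Bijective (T₀.fiberIsometry T₁ x) := by
  have h : Bijective (T₀.fiberDeriv T₁ x) :=
    ⟨T₀.fiberDeriv_injective T₁ x, RightInverse.surjective (T₁.fiberDeriv_fiberDeriv T₀ x)⟩
  exact h.comp (polarMap_bijective T₀.metric T₁.metric (T₀.fiberDeriv_injective T₁) x)

theorem fiberIsometry_isometry (x : S) (u w : E x) :
    T₁.metric.inner x (T₀.fiberIsometry T₁ x u) (T₀.fiberIsometry T₁ x w) =
      T₀.metric.inner x u w :=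
  polarMap_isometry T₀.metric T₁.metric (T₀.fiberDeriv_injective T₁) x u w

/-- This scaling law is the reason for the extra parameter `s`: the path of a short vector `s w` is
`s` times a path of the unit vector `w`, and for `s → 0` the latter converges to a path of linear
maps. -/
theorem path_fiberSmul (t s c : ℝ) (v : TotalSpace F E) :
    T₀.path T₁ t s (fiberSmul c v) = fiberSmul c (T₀.path T₁ t (s * c) v) := by
  rw [path, polar_fiberSmul, scaledTransition_fiberSmul, mul_assoc]; rfl

theorem pathInv_fiberSmul (t s c : ℝ) (w : TotalSpace F' E') :
    T₀.pathInv T₁ t s (fiberSmul c w) = fiberSmul c (T₀.pathInv T₁ t (s * c) w) := by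
  rw [pathInv, scaledTransition_fiberSmul, polarInv_fiberSmul, mul_assoc]; rfl

theorem path_time_zero (v : TotalSpace F E) : T₀.path T₁ 0 1 v = T₀.transition T₁ v := by
  rw [path, polar_zero, Real.smoothTransition.zero, sub_zero, mul_one, scaledTransition_one]

theorem pathInv_time_zero (w : TotalSpace F' E') : T₀.pathInv T₁ 0 1 w = T₁.transition T₀ w := by
  rw [pathInv, polarInv_zero, Real.smoothTransition.zero, sub_zero, mul_one, scaledTransition_one]

theorem path_time_one (s : ℝ) (v : TotalSpace F E) :
    T₀.path T₁ 1 s v = ⟨v.proj, T₀.fiberIsometry T₁ v.proj v.snd⟩ := by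
  rw [path, Real.smoothTransition.one, sub_self, zero_mul, scaledTransition_zero, polar,
    polarPath_one]
  rfl

theorem contMDiff_fiberIsometry :
    ContMDiff (𝓘(ℝ, ES).prod 𝓘(ℝ, F)) (𝓘(ℝ, ES).prod 𝓘(ℝ, F')) ∞
      (fun v : TotalSpace F E =>
        (⟨v.proj, T₀.fiberIsometry T₁ v.proj v.snd⟩ : TotalSpace F' E')) := by
  have h1 : ContMDiff (𝓘(ℝ, ES).prod 𝓘(ℝ, F)) (𝓘(ℝ, ES).prod 𝓘(ℝ, F)) ∞ (T₀.polar T₁ 1) :=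
    (T₀.contMDiff_polar T₁).comp (contMDiff_const.prodMk contMDiff_id)
  refine ((T₀.contMDiff_fiberDeriv T₁).comp h1).congr fun v => ?_
  rw [comp_apply, polar, polarPath_one]; rfl

theorem path_of_eq {t t' : ℝ} (h : Real.smoothTransition t' = Real.smoothTransition t) (s : ℝ)
    (v : TotalSpace F E) : T₀.path T₁ t' s v = T₀.path T₁ t s v := by
  simp only [path, polar, polarPath, h]

theorem pathInv_of_eq {t t' : ℝ} (h : Real.smoothTransition t' = Real.smoothTransition t) (s : ℝ)
    (w : TotalSpace F' E') : T₀.pathInv T₁ t' s w = T₀.pathInv T₁ t s w := by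
  have h1 : ∀ v, T₀.polarInv T₁ t' v = T₀.polarInv T₁ t v := fun v => by
    simp only [polarInv, polarPathInv, polarPathCoord, h]
  rw [pathInv, pathInv, h, h1]

theorem proj_path (t s : ℝ) (v : TotalSpace F E) : (T₀.path T₁ t s v).proj =
    (T₀.transition T₁ (fiberSmul ((1 - Real.smoothTransition t) * s) (T₀.polar T₁ t v))).proj :=
  proj_scaledTransition _ _ _ _

theorem path_zero_section (t s : ℝ) (x : S) : T₀.path T₁ t s ⟨x, 0⟩ = ⟨x, 0⟩ := by
  have h := T₀.path_fiberSmul T₁ t s 0 (⟨x, 0⟩ : TotalSpace F E)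
  rw [fiberSmul_zero_section, fiberSmul_zero, mul_zero] at h
  rw [h, proj_path, mul_zero, fiberSmul_zero, transition_zero, proj_polar]

theorem pathInv_zero_section (t s : ℝ) (x : S) : T₀.pathInv T₁ t s ⟨x, 0⟩ = ⟨x, 0⟩ := by
  have h := T₀.pathInv_fiberSmul T₁ t s 0 (⟨x, 0⟩ : TotalSpace F' E')
  rw [fiberSmul_zero_section, fiberSmul_zero, mul_zero] at h
  rw [h, pathInv, proj_polarInv, mul_zero, scaledTransition_zero]

theorem proj_path_zero (t : ℝ) (v : TotalSpace F E) : (T₀.path T₁ t 0 v).proj = v.proj := by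
  rw [path, mul_zero, scaledTransition_zero, proj_polar]

theorem proj_pathInv_zero (t : ℝ) (w : TotalSpace F' E') :
    (T₀.pathInv T₁ t 0 w).proj = w.proj := by
  rw [pathInv, mul_zero, scaledTransition_zero, proj_polarInv]

/-- The domain of smoothness of `path`. -/
def PathDefined (t s : ℝ) (v : TotalSpace F E) : Prop :=
  fiberSmul ((1 - Real.smoothTransition t) * s) (T₀.polar T₁ t v) ∈ T₀.transitionDomain T₁

/-- The domain of smoothness of `pathInv`. -/
def PathInvDefined (t s : ℝ) (w : TotalSpace F' E') : Prop :=
  fiberSmul ((1 - Real.smoothTransition t) * s) w ∈ T₁.transitionDomain T₀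

theorem pathDefined_zero (t : ℝ) (v : TotalSpace F E) : T₀.PathDefined T₁ t 0 v := by
  rw [PathDefined, mul_zero, fiberSmul_zero]; exact T₀.zero_mem_transitionDomain T₁ _

theorem pathInvDefined_zero (t : ℝ) (w : TotalSpace F' E') : T₀.PathInvDefined T₁ t 0 w := by
  rw [PathInvDefined, mul_zero, fiberSmul_zero]; exact T₁.zero_mem_transitionDomain T₀ _

theorem contMDiff_one_sub_smoothTransition_mul {EX X : Type*} [NormedAddCommGroup EX]
    [NormedSpace ℝ EX] [TopologicalSpace X] {HX : Type*} [TopologicalSpace HX]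
    {I : ModelWithCorners ℝ EX HX} [ChartedSpace HX X] {a b : X → ℝ}
    (ha : ContMDiff I 𝓘(ℝ, ℝ) ∞ a) (hb : ContMDiff I 𝓘(ℝ, ℝ) ∞ b) :
    ContMDiff I 𝓘(ℝ, ℝ) ∞ fun x => (1 - Real.smoothTransition (a x)) * b x :=
  (contMDiff_const.sub (Real.smoothTransition.contDiff.contMDiff.comp ha)).mul hb

theorem isOpen_pathDefined :
    IsOpen {p : ℝ × ℝ × TotalSpace F E | T₀.PathDefined T₁ p.1 p.2.1 p.2.2} := by
  have h1 : Continuous fun p : ℝ × ℝ × TotalSpace F E => T₀.polar T₁ p.1 p.2.2 :=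
    (T₀.contMDiff_polar T₁).continuous.comp (by fun_prop :
      Continuous fun p : ℝ × ℝ × TotalSpace F E => (p.1, p.2.2))
  have h2 : Continuous fun p : ℝ × ℝ × TotalSpace F E => (1 - Real.smoothTransition p.1) * p.2.1 :=
    (continuous_const.sub (Real.smoothTransition.continuous.comp continuous_fst)).mul
      (continuous_fst.comp continuous_snd)
  exact (T₀.isOpen_transitionDomain T₁).preimage
    ((contMDiff_fiberSmul (EB := ES)).continuous.comp (h2.prodMk h1))

theorem isOpen_pathInvDefined :
    IsOpen {p : ℝ × ℝ × TotalSpace F' E' | T₀.PathInvDefined T₁ p.1 p.2.1 p.2.2} := by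
  have h2 : Continuous fun p : ℝ × ℝ × TotalSpace F' E' =>
      (1 - Real.smoothTransition p.1) * p.2.1 :=
    (continuous_const.sub (Real.smoothTransition.continuous.comp continuous_fst)).mul
      (continuous_fst.comp continuous_snd)
  exact (T₁.isOpen_transitionDomain T₀).preimage
    ((contMDiff_fiberSmul (EB := ES)).continuous.comp
      (h2.prodMk (continuous_snd.comp continuous_snd)))

variable {T₀ T₁}

theorem contMDiffAt_path {t s : ℝ} {v : TotalSpace F E} (h : T₀.PathDefined T₁ t s v) :
    ContMDiffAt (𝓘(ℝ, ℝ).prod (𝓘(ℝ, ℝ).prod (𝓘(ℝ, ES).prod 𝓘(ℝ, F)))) (𝓘(ℝ, ES).prod 𝓘(ℝ, F')) ∞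
      (fun p : ℝ × ℝ × TotalSpace F E => T₀.path T₁ p.1 p.2.1 p.2.2) (t, s, v) := by
  have h1 : ContMDiff (𝓘(ℝ, ℝ).prod (𝓘(ℝ, ℝ).prod (𝓘(ℝ, ES).prod 𝓘(ℝ, F))))
      (𝓘(ℝ, ES).prod 𝓘(ℝ, F)) ∞ (fun p : ℝ × ℝ × TotalSpace F E => T₀.polar T₁ p.1 p.2.2) :=
    (T₀.contMDiff_polar T₁).comp (contMDiff_fst.prodMk (contMDiff_snd.comp contMDiff_snd))
  have h2 : ContMDiff (𝓘(ℝ, ℝ).prod (𝓘(ℝ, ℝ).prod (𝓘(ℝ, ES).prod 𝓘(ℝ, F)))) 𝓘(ℝ, ℝ) ∞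
      (fun p : ℝ × ℝ × TotalSpace F E => (1 - Real.smoothTransition p.1) * p.2.1) :=
    contMDiff_one_sub_smoothTransition_mul contMDiff_fst (contMDiff_fst.comp contMDiff_snd)
  exact ContMDiffAt.comp (g := uncurry (T₀.scaledTransition T₁))
    (f := fun p : ℝ × ℝ × TotalSpace F E =>
      ((1 - Real.smoothTransition p.1) * p.2.1, T₀.polar T₁ p.1 p.2.2)) (t, s, v)
    (contMDiffAt_scaledTransition h) (h2.prodMk h1).contMDiffAt

theorem contMDiffAt_pathInv {t s : ℝ} {w : TotalSpace F' E'} (h : T₀.PathInvDefined T₁ t s w) :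
    ContMDiffAt (𝓘(ℝ, ℝ).prod (𝓘(ℝ, ℝ).prod (𝓘(ℝ, ES).prod 𝓘(ℝ, F')))) (𝓘(ℝ, ES).prod 𝓘(ℝ, F)) ∞
      (fun p : ℝ × ℝ × TotalSpace F' E' => T₀.pathInv T₁ p.1 p.2.1 p.2.2) (t, s, w) := by
  have h2 : ContMDiff (𝓘(ℝ, ℝ).prod (𝓘(ℝ, ℝ).prod (𝓘(ℝ, ES).prod 𝓘(ℝ, F')))) 𝓘(ℝ, ℝ) ∞
      (fun p : ℝ × ℝ × TotalSpace F' E' => (1 - Real.smoothTransition p.1) * p.2.1) :=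
    contMDiff_one_sub_smoothTransition_mul contMDiff_fst (contMDiff_fst.comp contMDiff_snd)
  have h3 : ContMDiffAt (𝓘(ℝ, ℝ).prod (𝓘(ℝ, ℝ).prod (𝓘(ℝ, ES).prod 𝓘(ℝ, F'))))
      (𝓘(ℝ, ES).prod 𝓘(ℝ, F)) ∞ (fun p : ℝ × ℝ × TotalSpace F' E' =>
        T₁.scaledTransition T₀ ((1 - Real.smoothTransition p.1) * p.2.1) p.2.2) (t, s, w) :=
    ContMDiffAt.comp (g := uncurry (T₁.scaledTransition T₀))
      (f := fun p : ℝ × ℝ × TotalSpace F' E' =>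
        ((1 - Real.smoothTransition p.1) * p.2.1, p.2.2)) (t, s, w)
      (contMDiffAt_scaledTransition h)
      (h2.prodMk (contMDiff_snd.comp contMDiff_snd)).contMDiffAt
  exact (T₀.contMDiff_polarInv T₁).contMDiffAt.comp (t, s, w) (contMDiffAt_fst.prodMk h3)

theorem pathInv_path {t s : ℝ} {v : TotalSpace F E} (h : T₀.PathDefined T₁ t s v) :
    T₀.pathInv T₁ t s (T₀.path T₁ t s v) = v := by
  rw [pathInv, path, scaledTransition_scaledTransition h, polarInv_polar]

theorem path_pathInv {t s : ℝ} {w : TotalSpace F' E'} (h : T₀.PathInvDefined T₁ t s w) :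
    T₀.path T₁ t s (T₀.pathInv T₁ t s w) = w := by
  rw [path, pathInv, polar_polarInv, scaledTransition_scaledTransition h]

theorem CompatibleWith.apply_path {P : Type*} {f : M → P} (h₀ : T₀.CompatibleWith f)
    (h₁ : T₁.CompatibleWith f) {t s : ℝ} {v : TotalSpace F E} (h : T₀.PathDefined T₁ t s v) :
    f (T₀.path T₁ t s v).proj = f v.proj := by
  rw [proj_path, h₀.apply_transition h₁ h]; rfl

/-- Both ingredients are stationary over `U`: the polar factor is the identity, and rescaling by a
factor in `[0, 1]` does not affect the linear transition map. -/
theorem IsoOver.path_eq {U : Set S} (ψ : T₀.IsoOver T₁ U) {v : TotalSpace F E} (hx : v.proj ∈ U)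
    (hv : T₀.metric.normSq v < ψ.δ ⟨v.proj, hx⟩) (t : ℝ) :
    T₀.path T₁ t 1 v = ⟨v.proj, T₀.fiberIsometry T₁ v.proj v.snd⟩ := by
  have h0 : 0 ≤ 1 - Real.smoothTransition t := sub_nonneg.2 (Real.smoothTransition.le_one t)
  have h1 : 1 - Real.smoothTransition t ≤ 1 := sub_le_self 1 (Real.smoothTransition.nonneg t)
  rw [path, ψ.polar_eq hx, mul_one, ψ.fiberIsometry_eq hx]
  refine ψ.scaledTransition_eq hx (lt_of_le_of_lt ?_ hv)
  exact mul_le_of_le_one_left (T₀.metric.normSq_nonneg v) (pow_le_one₀ h0 h1)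

section Action

variable (EG : Type*) [NormedAddCommGroup EG] [NormedSpace ℝ EG]
  [TopologicalSpace G] [ChartedSpace EG G] [IsGVectorBundle EG ES G F E]
  [IsGVectorBundle EG ES G F' E']

include EG

variable (T₀ T₁) in
theorem polar_smul (g : G) (t : ℝ) (v : TotalSpace F E) :
    T₀.polar T₁ t (g • v) = g • T₀.polar T₁ t v := by
  obtain ⟨A, hA⟩ := exists_linearEquiv EG ES (F := F) (E := E) g v.proj
  obtain ⟨A', hA'⟩ := exists_linearEquiv EG ES (F := F') (E := E') g v.proj
  have hL : ∀ u : E v.proj, T₀.fiberDeriv T₁ (g • v.proj) (A u) = A' (T₀.fiberDeriv T₁ v.proj u) := by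
    intro u
    have h := fiberDeriv_smul (T₀ := T₀) (T₁ := T₁) EG g (⟨v.proj, u⟩ : TotalSpace F E)
    rw [hA, hA'] at h
    exact TotalSpace.mk_inj.1 h
  have h1 : g • v = ⟨g • v.proj, A v.snd⟩ := hA v.snd
  rw [h1]
  have h2 := polarMap_naturality T₀.metric T₁.metric (T₀.fiberDeriv_injective T₁) A
    (fun u w => T₀.metric_linearEquiv EG hA u w)
    (fun u w => by rw [hL, hL]; exact T₁.metric_linearEquiv EG hA' _ _) v.snd
  rw [polar, polar, polarPath, polarPath, hA, h2, map_add, map_smul, map_smul]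

variable (T₀ T₁) in
theorem pathDefined_smul (g : G) {t s : ℝ} {v : TotalSpace F E} (h : T₀.PathDefined T₁ t s v) :
    T₀.PathDefined T₁ t s (g • v) := by
  rw [PathDefined, T₀.polar_smul T₁ EG, ← smul_fiberSmul EG ES]
  exact smul_mem_transitionDomain EG g h

variable (T₀ T₁) in
theorem pathInvDefined_smul (g : G) {t s : ℝ} {w : TotalSpace F' E'}
    (h : T₀.PathInvDefined T₁ t s w) : T₀.PathInvDefined T₁ t s (g • w) := by
  rw [PathInvDefined, ← smul_fiberSmul EG ES]
  exact smul_mem_transitionDomain EG g h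

theorem path_smul (g : G) {t s : ℝ} {v : TotalSpace F E} (h : T₀.PathDefined T₁ t s v) :
    T₀.path T₁ t s (g • v) = g • T₀.path T₁ t s v := by
  rw [path, T₀.polar_smul T₁ EG, scaledTransition_smul EG g h]; rfl

theorem pathInv_smul (g : G) {t s : ℝ} {w : TotalSpace F' E'} (h : T₀.PathInvDefined T₁ t s w) :
    T₀.pathInv T₁ t s (g • w) = g • T₀.pathInv T₁ t s w := by
  have h1 : ∀ v : TotalSpace F E, T₀.polarInv T₁ t (g • v) = g • T₀.polarInv T₁ t v := fun v => by
    conv_lhs => rw [← T₀.polar_polarInv T₁ t v, ← T₀.polar_smul T₁ EG, polarInv_polar]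
  rw [pathInv, scaledTransition_smul EG g h, h1]; rfl

variable (T₀ T₁) in
theorem fiberIsometry_smul (g : G) (v : TotalSpace F E) :
    (⟨(g • v).proj, T₀.fiberIsometry T₁ (g • v).proj (g • v).snd⟩ : TotalSpace F' E') =
      g • (⟨v.proj, T₀.fiberIsometry T₁ v.proj v.snd⟩ : TotalSpace F' E') := by
  rw [← path_time_one T₀ T₁ 0, ← path_time_one T₀ T₁ 0,
    path_smul EG g (T₀.pathDefined_zero T₁ 1 v)]

end Action

end TubularNeighborhood

/-! ### Bounds near `s = 0`, uniform on compact sets. -/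

section UniformBounds

variable {X : Type*} [TopologicalSpace X]

theorem IsCompact.exists_abs_le_of_continuousAt {C : Set X} (hC : IsCompact C) {D : X × ℝ → ℝ}
    (hD : ∀ x ∈ C, ContinuousAt D (x, 0)) :
    ∃ c > 0, ∃ K, ∀ x ∈ C, ∀ s, |s| ≤ c → |D (x, s)| ≤ K := by
  refine hC.induction_on (p := fun C => ∃ c > 0, ∃ K, ∀ x ∈ C, ∀ s, |s| ≤ c → |D (x, s)| ≤ K)
    ⟨1, one_pos, 0, by simp⟩ ?_ ?_ ?_
  · rintro s t hst ⟨c, hc, K, h⟩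
    exact ⟨c, hc, K, fun x hx => h x (hst hx)⟩
  · rintro s t ⟨c, hc, K, h⟩ ⟨c', hc', K', h'⟩
    refine ⟨min c c', lt_min hc hc', max K K', fun x hx r hr => hx.elim (fun hx => ?_) fun hx => ?_⟩
    · exact (h x hx r (hr.trans (min_le_left _ _))).trans (le_max_left _ _)
    · exact (h' x hx r (hr.trans (min_le_right _ _))).trans (le_max_right _ _)
  · intro x hx
    have h1 : ∀ᶠ p in 𝓝 (x, (0 : ℝ)), |D p| < |D (x, 0)| + 1 :=
      (hD x hx).abs.tendsto.eventually_lt_const (lt_add_one _)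
    rw [nhds_prod_eq, Filter.eventually_prod_iff] at h1
    obtain ⟨P, hP, R, hR, h⟩ := h1
    obtain ⟨r, hr, hrR⟩ := Metric.eventually_nhds_iff.1 hR
    refine ⟨{x | P x}, mem_nhdsWithin_of_mem_nhds hP, r / 2, half_pos hr, |D (x, 0)| + 1,
      fun y hy s hs => (h hy (hrR ?_)).le⟩
    rw [Real.dist_eq, sub_zero]; linarith

/-- The `s`-derivative is bounded near each point `(x, 0)`, and the mean value inequality gives a
linear bound from the zero at `s = 0`. Compactness makes the constants uniform. -/
theorem IsCompact.exists_abs_le_mul_of_contMDiffAt {EX HX : Type*} [NormedAddCommGroup EX]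
    [NormedSpace ℝ EX] [TopologicalSpace HX] {I : ModelWithCorners ℝ EX HX} [ChartedSpace HX X]
    [IsManifold I ∞ X] {C : Set X} (hC : IsCompact C) {D : X → ℝ → ℝ}
    (hD : ∀ x ∈ C, ContMDiffAt (I.prod 𝓘(ℝ, ℝ)) 𝓘(ℝ, ℝ) ∞ (Function.uncurry D) (x, 0))
    (hD0 : ∀ x, D x 0 = 0) : ∃ c > 0, ∃ K, ∀ x ∈ C, ∀ s, |s| ≤ c → |D x s| ≤ K * |s| := by
  refine hC.induction_on (p := fun C => ∃ c > 0, ∃ K, ∀ x ∈ C, ∀ s, |s| ≤ c → |D x s| ≤ K * |s|)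
    ⟨1, one_pos, 0, by simp⟩ ?_ ?_ ?_
  · rintro s t hst ⟨c, hc, K, h⟩
    exact ⟨c, hc, K, fun x hx => h x (hst hx)⟩
  · rintro s t ⟨c, hc, K, h⟩ ⟨c', hc', K', h'⟩
    refine ⟨min c c', lt_min hc hc', max K K', fun x hx r hr => hx.elim (fun hx => ?_) fun hx => ?_⟩
    · exact (h x hx r (hr.trans (min_le_left _ _))).trans (by gcongr; exact le_max_left _ _)
    · exact (h' x hx r (hr.trans (min_le_right _ _))).trans (by gcongr; exact le_max_right _ _)
  · intro x hx
    have : IsManifold I 1 X := IsManifold.of_le (m := 1) (n := ∞) (by simp)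
    have h1 : ∀ᶠ p in 𝓝 (x, (0 : ℝ)), |deriv (D p.1) p.2| < |deriv (D x) 0| + 1 :=
      (hD x hx).deriv_param.continuousAt.abs.tendsto.eventually_lt_const (lt_add_one _)
    have h2 : ∀ᶠ p in 𝓝 (x, (0 : ℝ)),
        ContMDiffAt (I.prod 𝓘(ℝ, ℝ)) 𝓘(ℝ, ℝ) 1 (Function.uncurry D) p :=
      (contMDiffAt_iff_contMDiffAt_nhds (by simp)).1 ((hD x hx).of_le (by simp))
    have h3 := h1.and h2
    rw [nhds_prod_eq, Filter.eventually_prod_iff] at h3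
    obtain ⟨P, hP, R, hR, h⟩ := h3
    obtain ⟨r, hr, hrR⟩ := Metric.eventually_nhds_iff.1 hR
    refine ⟨{x | P x}, mem_nhdsWithin_of_mem_nhds hP, r / 2, half_pos hr, |deriv (D x) 0| + 1,
      fun y hy s hs => ?_⟩
    have hball : ∀ z ∈ Metric.ball (0 : ℝ) r, DifferentiableAt ℝ (D y) z ∧
        ‖deriv (D y) z‖ ≤ |deriv (D x) 0| + 1 := fun z hz => by
      obtain ⟨h4, h5⟩ := h hy (hrR hz)
      refine ⟨?_, h4.le⟩
      have h6 : ContMDiffAt 𝓘(ℝ, ℝ) 𝓘(ℝ, ℝ) 1 (D y) z :=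
        ContMDiffAt.comp (f := fun z : ℝ => (y, z)) z h5 (contMDiffAt_const.prodMk contMDiffAt_id)
      exact h6.contDiffAt.differentiableAt one_ne_zero
    have h7 := (convex_ball (0 : ℝ) r).norm_image_sub_le_of_norm_deriv_le
      (fun z hz => (hball z hz).1) (fun z hz => (hball z hz).2) (Metric.mem_ball_self hr)
      (y := s) (by rw [Metric.mem_ball, Real.dist_eq, sub_zero]; linarith)
    simpa [hD0] using h7

end UniformBounds

/-! ### The local isotopy of `M` and the speeds along its inverse curves. -/

namespace TubularNeighborhood

open IsGVectorBundle Function Bundle.ContMDiffRiemannianMetric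

variable {G : Type*} [Group G]
  {EM : Type*} [NormedAddCommGroup EM] [NormedSpace ℝ EM]
  {ES : Type*} [NormedAddCommGroup ES] [NormedSpace ℝ ES]
  {M : Type*} [TopologicalSpace M] [ChartedSpace EM M] [MulAction G M]
  {S : SubMulAction G M} [ChartedSpace ES S] [IsManifold 𝓘(ℝ, ES) ∞ S]
  {F : Type*} [NormedAddCommGroup F] [NormedSpace ℝ F]
  {E : S → Type*} [TopologicalSpace (TotalSpace F E)]
  [∀ x, AddCommGroup (E x)] [∀ x, Module ℝ (E x)] [∀ x, TopologicalSpace (E x)]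
  [∀ x, IsTopologicalAddGroup (E x)] [∀ x, ContinuousConstSMul ℝ (E x)]
  [FiberBundle F E] [VectorBundle ℝ F E] [ContMDiffVectorBundle ∞ F E 𝓘(ℝ, ES)]
  [MulAction G (TotalSpace F E)]
  {F' : Type*} [NormedAddCommGroup F'] [NormedSpace ℝ F']
  {E' : S → Type*} [TopologicalSpace (TotalSpace F' E')]
  [∀ x, AddCommGroup (E' x)] [∀ x, Module ℝ (E' x)] [∀ x, TopologicalSpace (E' x)]
  [∀ x, IsTopologicalAddGroup (E' x)] [∀ x, ContinuousConstSMul ℝ (E' x)]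
  [FiberBundle F' E'] [VectorBundle ℝ F' E'] [ContMDiffVectorBundle ∞ F' E' 𝓘(ℝ, ES)]
  [MulAction G (TotalSpace F' E')]
  [T2Space M] [FiniteDimensional ℝ F] [FiniteDimensional ℝ F']
  (T₀ : TubularNeighborhood G EM ES S F E) (T₁ : TubularNeighborhood G EM ES S F' E')

/-- The vectors on which the inverse isotopy is defined. -/
def invDomain : Set (TotalSpace F' E') :=
  T₁.φ.source ∩ {w | ∀ t ∈ Icc (0 : ℝ) 1, T₀.PathInvDefined T₁ t 1 w ∧
    T₀.pathInv T₁ t 1 w ∈ T₀.φ.source}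

/-- The vectors on which the isotopy is defined. -/
def pathDomain : Set (TotalSpace F E) :=
  T₀.φ.source ∩ {v | ∀ t ∈ Icc (0 : ℝ) 1, T₀.PathDefined T₁ t 1 v ∧
    T₀.path T₁ t 1 v ∈ T₀.invDomain T₁}

/-- The isotopy of a neighbourhood of `S` joining the identity to `φ₁ ∘ ψ ∘ φ₀⁻¹`, with `ψ` the
isometric part of the fibre derivative of the transition map. -/
def isotopy (t : ℝ) (x : M) : M := T₁.φ (T₀.path T₁ t 1 (T₀.φ.symm x))

/-- The inverse of `isotopy`. -/
def isotopyInv (t : ℝ) (y : M) : M := T₀.φ (T₀.pathInv T₁ t 1 (T₁.φ.symm y))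

theorem isOpen_invDomain : IsOpen (T₀.invDomain T₁) := by
  have h1 : IsOpen {p : ℝ × TotalSpace F' E' | T₀.PathInvDefined T₁ p.1 1 p.2} :=
    (T₀.isOpen_pathInvDefined T₁).preimage (by fun_prop :
      Continuous fun p : ℝ × TotalSpace F' E' => (p.1, (1 : ℝ), p.2))
  have h2 : ContinuousOn (fun p : ℝ × TotalSpace F' E' => T₀.pathInv T₁ p.1 1 p.2)
      {p : ℝ × TotalSpace F' E' | T₀.PathInvDefined T₁ p.1 1 p.2} := fun p hp =>
    ((contMDiffAt_pathInv hp).continuousAt.comp (f := fun p : ℝ × TotalSpace F' E' =>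
      (p.1, (1 : ℝ), p.2)) (by fun_prop)).continuousWithinAt
  exact T₁.φ.open_source.inter (isOpen_setOf_forall_mem_of_isCompact isCompact_Icc
    (h2.isOpen_inter_preimage h1 T₀.φ.open_source))

theorem isOpen_pathDomain : IsOpen (T₀.pathDomain T₁) := by
  have h1 : IsOpen {p : ℝ × TotalSpace F E | T₀.PathDefined T₁ p.1 1 p.2} :=
    (T₀.isOpen_pathDefined T₁).preimage (by fun_prop :
      Continuous fun p : ℝ × TotalSpace F E => (p.1, (1 : ℝ), p.2))
  have h2 : ContinuousOn (fun p : ℝ × TotalSpace F E => T₀.path T₁ p.1 1 p.2)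
      {p : ℝ × TotalSpace F E | T₀.PathDefined T₁ p.1 1 p.2} := fun p hp =>
    ((contMDiffAt_path hp).continuousAt.comp (f := fun p : ℝ × TotalSpace F E =>
      (p.1, (1 : ℝ), p.2)) (by fun_prop)).continuousWithinAt
  exact T₀.φ.open_source.inter (isOpen_setOf_forall_mem_of_isCompact isCompact_Icc
    (h2.isOpen_inter_preimage h1 (T₀.isOpen_invDomain T₁)))

theorem pathDefined_of_smul {t s c : ℝ} {v : TotalSpace F E} :
    T₀.PathDefined T₁ t s (fiberSmul c v) ↔ T₀.PathDefined T₁ t (s * c) v := by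
  rw [PathDefined, PathDefined, polar_fiberSmul, fiberSmul_fiberSmul, mul_assoc]

theorem pathInvDefined_of_smul {t s c : ℝ} {w : TotalSpace F' E'} :
    T₀.PathInvDefined T₁ t s (fiberSmul c w) ↔ T₀.PathInvDefined T₁ t (s * c) w := by
  rw [PathInvDefined, PathInvDefined, fiberSmul_fiberSmul, mul_assoc]

theorem zero_mem_invDomain (x : S) : (⟨x, 0⟩ : TotalSpace F' E') ∈ T₀.invDomain T₁ := by
  refine ⟨T₁.zero_mem_source x, fun t _ => ⟨?_, ?_⟩⟩
  · rw [← fiberSmul_zero_section 0 x, pathInvDefined_of_smul, mul_zero]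
    exact T₀.pathInvDefined_zero T₁ t _
  · rw [pathInv_zero_section]; exact T₀.zero_mem_source x

theorem zero_mem_pathDomain (x : S) : (⟨x, 0⟩ : TotalSpace F E) ∈ T₀.pathDomain T₁ := by
  refine ⟨T₀.zero_mem_source x, fun t _ => ⟨?_, ?_⟩⟩
  · rw [← fiberSmul_zero_section 0 x, pathDefined_of_smul, mul_zero]
    exact T₀.pathDefined_zero T₁ t _
  · rw [path_zero_section]; exact T₀.zero_mem_invDomain T₁ x

variable {T₀ T₁}

theorem pathInv_mem {w : TotalSpace F' E'} (hw : w ∈ T₀.invDomain T₁) (t : ℝ) :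
    T₀.PathInvDefined T₁ t 1 w ∧ T₀.pathInv T₁ t 1 w ∈ T₀.φ.source := by
  obtain ⟨t', ht', h⟩ := Real.smoothTransition.exists_mem_Icc t
  have h1 := hw.2 t' ht'
  rw [pathInv_of_eq T₀ T₁ h] at h1
  refine ⟨?_, h1.2⟩
  have h2 := h1.1
  rwa [PathInvDefined, h] at h2

theorem path_mem {v : TotalSpace F E} (hv : v ∈ T₀.pathDomain T₁) (t : ℝ) :
    T₀.PathDefined T₁ t 1 v ∧ T₀.path T₁ t 1 v ∈ T₀.invDomain T₁ := by
  obtain ⟨t', ht', h⟩ := Real.smoothTransition.exists_mem_Icc t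
  have h1 := hv.2 t' ht'
  rw [path_of_eq T₀ T₁ h] at h1
  refine ⟨?_, h1.2⟩
  have h2 := h1.1
  rwa [PathDefined, h, show T₀.polar T₁ t' v = T₀.polar T₁ t v by
    simp only [polar, polarPath, h]] at h2

theorem isotopy_φ {v : TotalSpace F E} (hv : v ∈ T₀.pathDomain T₁) (t : ℝ) :
    T₀.isotopy T₁ t (T₀.φ v) = T₁.φ (T₀.path T₁ t 1 v) := by
  rw [isotopy, T₀.φ.left_inv hv.1]

theorem isotopyInv_φ {w : TotalSpace F' E'} (hw : w ∈ T₀.invDomain T₁) (t : ℝ) :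
    T₀.isotopyInv T₁ t (T₁.φ w) = T₀.φ (T₀.pathInv T₁ t 1 w) := by
  rw [isotopyInv, T₁.φ.left_inv hw.1]

theorem isotopyInv_isotopy_φ {v : TotalSpace F E} (hv : v ∈ T₀.pathDomain T₁) (t' t : ℝ) :
    T₀.isotopyInv T₁ t' (T₀.isotopy T₁ t (T₀.φ v)) =
      T₀.φ (T₀.pathInv T₁ t' 1 (T₀.path T₁ t 1 v)) := by
  rw [isotopy_φ hv, isotopyInv_φ (path_mem hv t).2]

theorem isotopyInv_isotopy {v : TotalSpace F E} (hv : v ∈ T₀.pathDomain T₁) (t : ℝ) :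
    T₀.isotopyInv T₁ t (T₀.isotopy T₁ t (T₀.φ v)) = T₀.φ v := by
  rw [isotopyInv_isotopy_φ hv, pathInv_path (path_mem hv t).1]

theorem isotopy_isotopyInv {w : TotalSpace F' E'} (hw : w ∈ T₀.invDomain T₁) (t : ℝ) :
    T₀.isotopy T₁ t (T₀.isotopyInv T₁ t (T₁.φ w)) = T₁.φ w := by
  rw [isotopyInv_φ hw, isotopy, T₀.φ.left_inv (pathInv_mem hw t).2,
    path_pathInv (pathInv_mem hw t).1]

theorem isotopy_zero {v : TotalSpace F E} (hv : v ∈ T₀.pathDomain T₁) :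
    T₀.isotopy T₁ 0 (T₀.φ v) = T₀.φ v := by
  have h := (path_mem hv 0).1
  rw [PathDefined, polar_zero, Real.smoothTransition.zero, sub_zero, mul_one, fiberSmul_one] at h
  rw [isotopy_φ hv, path_time_zero, φ_transition h]

theorem isotopyInv_zero {w : TotalSpace F' E'} (hw : w ∈ T₀.invDomain T₁) :
    T₀.isotopyInv T₁ 0 (T₁.φ w) = T₁.φ w := by
  have h := (pathInv_mem hw 0).1
  rw [PathInvDefined, Real.smoothTransition.zero, sub_zero, mul_one, fiberSmul_one] at h
  rw [isotopyInv_φ hw, pathInv_time_zero, φ_transition h]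

theorem contMDiffAt_isotopy {v : TotalSpace F E} (hv : v ∈ T₀.pathDomain T₁) (t : ℝ) :
    ContMDiffAt (𝓘(ℝ, ℝ).prod 𝓘(ℝ, EM)) 𝓘(ℝ, EM) ∞ (uncurry (T₀.isotopy T₁)) (t, T₀.φ v) := by
  have h1 : ContMDiffAt (𝓘(ℝ, ℝ).prod 𝓘(ℝ, EM)) (𝓘(ℝ, ES).prod 𝓘(ℝ, F)) ∞
      (fun p : ℝ × M => T₀.φ.symm p.2) (t, T₀.φ v) :=
    ContMDiffAt.comp (g := T₀.φ.symm) (f := fun p : ℝ × M => p.2) (t, T₀.φ v)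
      (T₀.contMDiffAt_φ_symm (T₀.φ.map_source hv.1)) contMDiffAt_snd
  have h2 : ContMDiffAt (𝓘(ℝ, ℝ).prod 𝓘(ℝ, EM)) (𝓘(ℝ, ES).prod 𝓘(ℝ, F')) ∞
      (fun p : ℝ × M => T₀.path T₁ p.1 1 (T₀.φ.symm p.2)) (t, T₀.φ v) :=
    ContMDiffAt.comp (f := fun p : ℝ × M => (p.1, (1 : ℝ), T₀.φ.symm p.2)) (t, T₀.φ v)
      (by
        have := contMDiffAt_path (path_mem hv t).1
        rwa [← T₀.φ.left_inv hv.1] at this)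
      (contMDiffAt_fst.prodMk (contMDiffAt_const.prodMk h1))
  exact ContMDiffAt.comp (g := T₁.φ) (t, T₀.φ v)
    (T₁.contMDiffAt_φ (by rw [T₀.φ.left_inv hv.1]; exact (path_mem hv t).2.1)) h2

theorem contMDiffAt_isotopyInv {w : TotalSpace F' E'} (hw : w ∈ T₀.invDomain T₁) (t : ℝ) :
    ContMDiffAt (𝓘(ℝ, ℝ).prod 𝓘(ℝ, EM)) 𝓘(ℝ, EM) ∞ (uncurry (T₀.isotopyInv T₁)) (t, T₁.φ w) := by
  have h1 : ContMDiffAt (𝓘(ℝ, ℝ).prod 𝓘(ℝ, EM)) (𝓘(ℝ, ES).prod 𝓘(ℝ, F')) ∞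
      (fun p : ℝ × M => T₁.φ.symm p.2) (t, T₁.φ w) :=
    ContMDiffAt.comp (g := T₁.φ.symm) (f := fun p : ℝ × M => p.2) (t, T₁.φ w)
      (T₁.contMDiffAt_φ_symm (T₁.φ.map_source hw.1)) contMDiffAt_snd
  have h2 : ContMDiffAt (𝓘(ℝ, ℝ).prod 𝓘(ℝ, EM)) (𝓘(ℝ, ES).prod 𝓘(ℝ, F)) ∞
      (fun p : ℝ × M => T₀.pathInv T₁ p.1 1 (T₁.φ.symm p.2)) (t, T₁.φ w) :=
    ContMDiffAt.comp (f := fun p : ℝ × M => (p.1, (1 : ℝ), T₁.φ.symm p.2)) (t, T₁.φ w)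
      (by
        have := contMDiffAt_pathInv (pathInv_mem hw t).1
        rwa [← T₁.φ.left_inv hw.1] at this)
      (contMDiffAt_fst.prodMk (contMDiffAt_const.prodMk h1))
  exact ContMDiffAt.comp (g := T₀.φ) (t, T₁.φ w)
    (T₀.contMDiffAt_φ (by rw [T₁.φ.left_inv hw.1]; exact (pathInv_mem hw t).2)) h2

theorem CompatibleWith.apply_isotopy {P : Type*} {f : M → P} (h₀ : T₀.CompatibleWith f)
    (h₁ : T₁.CompatibleWith f) {v : TotalSpace F E} (hv : v ∈ T₀.pathDomain T₁) (t : ℝ) :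
    f (T₀.isotopy T₁ t (T₀.φ v)) = f (T₀.φ v) := by
  rw [isotopy_φ hv, h₁.apply_φ (path_mem hv t).2.1, h₀.apply_path h₁ (path_mem hv t).1,
    h₀.apply_φ hv.1]

theorem isotopy_coe (t : ℝ) (x : S) : T₀.isotopy T₁ t (x : M) = x := by
  rw [isotopy, φ_symm_coe, path_zero_section, T₁.φ_zero]

section Action

variable (EG : Type*) [NormedAddCommGroup EG] [NormedSpace ℝ EG]
  [TopologicalSpace G] [ChartedSpace EG G] [IsGVectorBundle EG ES G F E]
  [IsGVectorBundle EG ES G F' E']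

include EG

theorem smul_mem_invDomain (g : G) {w : TotalSpace F' E'} (hw : w ∈ T₀.invDomain T₁) :
    g • w ∈ T₀.invDomain T₁ :=
  ⟨T₁.smul_mem_source EG g hw.1, fun t ht => ⟨T₀.pathInvDefined_smul T₁ EG g (hw.2 t ht).1, by
    rw [pathInv_smul EG g (hw.2 t ht).1]; exact T₀.smul_mem_source EG g (hw.2 t ht).2⟩⟩

theorem smul_mem_pathDomain (g : G) {v : TotalSpace F E} (hv : v ∈ T₀.pathDomain T₁) :
    g • v ∈ T₀.pathDomain T₁ :=
  ⟨T₀.smul_mem_source EG g hv.1, fun t ht => ⟨T₀.pathDefined_smul T₁ EG g (hv.2 t ht).1, by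
    rw [path_smul EG g (hv.2 t ht).1]; exact smul_mem_invDomain EG g (hv.2 t ht).2⟩⟩

theorem isotopy_smul (g : G) {v : TotalSpace F E} (hv : v ∈ T₀.pathDomain T₁) (t : ℝ) :
    T₀.isotopy T₁ t (g • T₀.φ v) = g • T₀.isotopy T₁ t (T₀.φ v) := by
  rw [← T₀.φ_smul g v hv.1, isotopy_φ (smul_mem_pathDomain EG g hv), isotopy_φ hv,
    path_smul EG g (path_mem hv t).1, T₁.φ_smul g _ (path_mem hv t).2.1]

end Action

variable (T₀ T₁) in
/-- The speed at time `t` of a function along the curve of the inverse path through `s v`, rescaled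
by `s⁻¹`. -/
def curveDeriv (h : TotalSpace F E → ℝ) (p : ℝ × TotalSpace F E) (s : ℝ) : ℝ :=
  deriv (fun t' => h (T₀.pathInv T₁ t' s (T₀.path T₁ p.1 s p.2))) p.1

theorem hasDerivAt_curve {h : TotalSpace F E → ℝ}
    (hh : ContMDiff (𝓘(ℝ, ES).prod 𝓘(ℝ, F)) 𝓘(ℝ, ℝ) ∞ h) {t s : ℝ} {v : TotalSpace F E}
    (hi : T₀.PathInvDefined T₁ t s (T₀.path T₁ t s v)) :
    HasDerivAt (fun t' => h (T₀.pathInv T₁ t' s (T₀.path T₁ t s v)))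
      (T₀.curveDeriv T₁ h (t, v) s) t := by
  have h1 : ContMDiffAt 𝓘(ℝ, ℝ) (𝓘(ℝ, ES).prod 𝓘(ℝ, F)) ∞
      (fun t' => T₀.pathInv T₁ t' s (T₀.path T₁ t s v)) t :=
    ContMDiffAt.comp (f := fun t' : ℝ => (t', s, T₀.path T₁ t s v)) t (contMDiffAt_pathInv hi)
      (contMDiffAt_id.prodMk contMDiffAt_const)
  exact ((hh.contMDiffAt.comp t h1).contDiffAt.differentiableAt (by simp)).hasDerivAt

/-- At `s = 0` both paths are defined for every vector, short or not. So the rescaled speed is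
smooth there, and this extends estimates on unit vectors to all short vectors. -/
theorem contMDiffAt_curveDeriv {h : TotalSpace F E → ℝ}
    (hh : ContMDiff (𝓘(ℝ, ES).prod 𝓘(ℝ, F)) 𝓘(ℝ, ℝ) ∞ h) (t : ℝ) (v : TotalSpace F E) :
    ContMDiffAt ((𝓘(ℝ, ℝ).prod (𝓘(ℝ, ES).prod 𝓘(ℝ, F))).prod 𝓘(ℝ, ℝ)) 𝓘(ℝ, ℝ) ∞
      (uncurry (T₀.curveDeriv T₁ h)) ((t, v), 0) := by
  have h1 : ContMDiffAt (((𝓘(ℝ, ℝ).prod (𝓘(ℝ, ES).prod 𝓘(ℝ, F))).prod 𝓘(ℝ, ℝ)).prod 𝓘(ℝ, ℝ))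
      (𝓘(ℝ, ES).prod 𝓘(ℝ, F')) ∞
      (fun q : ((ℝ × TotalSpace F E) × ℝ) × ℝ => T₀.path T₁ q.1.1.1 q.1.2 q.1.1.2)
      (((t, v), 0), t) :=
    ContMDiffAt.comp (f := fun q : ((ℝ × TotalSpace F E) × ℝ) × ℝ => (q.1.1.1, q.1.2, q.1.1.2))
      (((t, v), 0), t) (contMDiffAt_path (T₀.pathDefined_zero T₁ t v))
      ((contMDiff_fst.comp (contMDiff_fst.comp contMDiff_fst)).prodMk
        ((contMDiff_snd.comp contMDiff_fst).prodMk
          (contMDiff_snd.comp (contMDiff_fst.comp contMDiff_fst)))).contMDiffAt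
  have h2 : ContMDiffAt (((𝓘(ℝ, ℝ).prod (𝓘(ℝ, ES).prod 𝓘(ℝ, F))).prod 𝓘(ℝ, ℝ)).prod 𝓘(ℝ, ℝ))
      (𝓘(ℝ, ES).prod 𝓘(ℝ, F)) ∞
      (fun q : ((ℝ × TotalSpace F E) × ℝ) × ℝ =>
        T₀.pathInv T₁ q.2 q.1.2 (T₀.path T₁ q.1.1.1 q.1.2 q.1.1.2)) (((t, v), 0), t) :=
    ContMDiffAt.comp (f := fun q : ((ℝ × TotalSpace F E) × ℝ) × ℝ =>
        (q.2, q.1.2, T₀.path T₁ q.1.1.1 q.1.2 q.1.1.2))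
      (((t, v), 0), t) (contMDiffAt_pathInv (T₀.pathInvDefined_zero T₁ t _))
      (contMDiffAt_snd.prodMk
        ((contMDiff_snd.comp contMDiff_fst).contMDiffAt.prodMk h1))
  have h3 : ContMDiffAt (((𝓘(ℝ, ℝ).prod (𝓘(ℝ, ES).prod 𝓘(ℝ, F))).prod 𝓘(ℝ, ℝ)).prod 𝓘(ℝ, ℝ))
      𝓘(ℝ, ℝ) ∞ (uncurry fun (k : (ℝ × TotalSpace F E) × ℝ) (t' : ℝ) =>
        h (T₀.pathInv T₁ t' k.2 (T₀.path T₁ k.1.1 k.2 k.1.2))) (((t, v), 0), t) :=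
    hh.contMDiffAt.comp (((t, v), 0), t) h2
  exact ContMDiffAt.comp (f := fun k : (ℝ × TotalSpace F E) × ℝ => (k, k.1.1)) ((t, v), 0)
    h3.deriv_param (contMDiffAt_id.prodMk (contMDiff_fst.comp contMDiff_fst).contMDiffAt)

-- At `s = 0` the path and its inverse are fibrewise linear over the identity, so base points do not
-- move. For small `s`, functions of the base point therefore change at rate `O(s)`.
variable (T₀ T₁) in
theorem curveDeriv_base_zero (h : S → ℝ) (p : ℝ × TotalSpace F E) :
    T₀.curveDeriv T₁ (fun v => h v.proj) p 0 = 0 := by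
  have h1 : (fun t' => h (T₀.pathInv T₁ t' 0 (T₀.path T₁ p.1 0 p.2)).proj) =
      fun _ => h p.2.proj := by
    funext t'; rw [proj_pathInv_zero, proj_path_zero]
  rw [curveDeriv, h1, deriv_const]

end TubularNeighborhood

/-! ### The slope of the logarithmically slow cutoff. -/

/-- By the product rule the factor `B` contributes at most `K s ≤ 1/4`. The power cutoff contributes
at most `12 C a K ≤ 1/2`: the change of `log q` costs `a K`, and the change of the exponent costs `a
K s |log s²| ≤ 2 a K`. -/
theorem deriv_mul_smoothTransition_rpow_lt_one {C : ℝ}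
    (hC : ∀ x, |deriv Real.smoothTransition x| ≤ C) {B b q g : ℝ → ℝ} {B' b' q' t s K a : ℝ}
    (hB : HasDerivAt B B' t) (hb : HasDerivAt b b' t) (hq : HasDerivAt q q' t)
    (hg : ContDiff ℝ ∞ g) (hqt : q t = 1) (hs : 0 < s) (hs1 : s ≤ 1) (hBt : |B t| ≤ 1)
    (hB' : |B'| ≤ K * s) (hb' : |b'| ≤ K * s) (hq' : |q'| ≤ K) (hg0 : |g (b t)| ≤ a)
    (hg1 : |deriv g (b t)| ≤ a) (hpow : (s ^ 2) ^ g (b t) ≤ 1) (hKs : K * s ≤ 1 / 4)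
    (ha : 12 * C * a * K ≤ 1 / 2) :
    deriv (fun t' => B t' * Real.smoothTransition (2 - 4 * (s ^ 2 * q t') ^ g (b t'))) t < 1 := by
  have hs2 : 0 < s ^ 2 := by positivity
  have hC0 : 0 ≤ C := (abs_nonneg _).trans (hC 0)
  have ha0 : 0 ≤ a := (abs_nonneg _).trans hg0
  have hK0 : 0 ≤ K := (abs_nonneg _).trans hq'
  have hη : HasDerivAt (fun t' => g (b t')) (deriv g (b t) * b') t :=
    ((hg.differentiable (by simp)) (b t)).hasDerivAt.comp t hb
  obtain ⟨d, hd, hdle⟩ := abs_deriv_smoothTransition_rpow_le hC (hq.const_mul (s ^ 2)) hη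
    (by rw [hqt]; linarith) (by rw [hqt, mul_one]; exact hpow)
  have hD : HasDerivAt
      (fun t' => B t' * Real.smoothTransition (2 - 4 * (s ^ 2 * q t') ^ g (b t')))
      (B' * Real.smoothTransition (2 - 4 * (s ^ 2 * q t) ^ g (b t)) + B t * d) t := hB.mul hd
  rw [hD.deriv]
  have hlog : s * |Real.log (s ^ 2)| ≤ 2 := by
    have h1 := Real.abs_log_mul_self_lt s hs hs1
    rw [abs_mul, abs_of_pos hs] at h1
    rw [Real.log_pow, abs_mul]
    norm_num
    nlinarith
  have h1 : |deriv g (b t) * b'| * |Real.log (s ^ 2 * q t)| ≤ a * K * 2 := by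
    rw [hqt, mul_one, abs_mul]
    calc |deriv g (b t)| * |b'| * |Real.log (s ^ 2)| ≤ a * (K * s) * |Real.log (s ^ 2)| := by
          gcongr
      _ = a * K * (s * |Real.log (s ^ 2)|) := by ring
      _ ≤ a * K * 2 := by gcongr
  have h2 : |g (b t)| * (|s ^ 2 * q'| / (s ^ 2 * q t)) ≤ a * K := by
    rw [hqt, mul_one, abs_mul, abs_of_pos hs2, mul_div_cancel_left₀ _ hs2.ne']
    gcongr
  have h3 : |d| ≤ 1 / 2 := by
    calc |d| ≤ 4 * C * (a * K * 2 + a * K) := hdle.trans (by gcongr)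
      _ = 12 * C * a * K := by ring
      _ ≤ 1 / 2 := ha
  have hσ : |Real.smoothTransition (2 - 4 * (s ^ 2 * q t) ^ g (b t))| ≤ 1 := by
    rw [abs_of_nonneg (Real.smoothTransition.nonneg _)]; exact Real.smoothTransition.le_one _
  have h4 : |B' * Real.smoothTransition (2 - 4 * (s ^ 2 * q t) ^ g (b t))| ≤ 1 / 4 := by
    rw [abs_mul]
    calc _ ≤ (K * s) * 1 := by gcongr
      _ ≤ 1 / 4 := by rw [mul_one]; exact hKs
  have h5 : |B t * d| ≤ 1 / 2 := by
    rw [abs_mul]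
    calc _ ≤ 1 * (1 / 2 : ℝ) := by gcongr
      _ = 1 / 2 := one_mul _
  linarith [le_abs_self (B' * Real.smoothTransition (2 - 4 * (s ^ 2 * q t) ^ g (b t))),
    le_abs_self (B t * d)]

namespace TubularNeighborhood

open IsGVectorBundle Function Bundle.ContMDiffRiemannianMetric

variable {G : Type*} [Group G]
  {EM : Type*} [NormedAddCommGroup EM] [NormedSpace ℝ EM]
  {ES : Type*} [NormedAddCommGroup ES] [NormedSpace ℝ ES]
  {M : Type*} [TopologicalSpace M] [ChartedSpace EM M] [MulAction G M]
  {S : SubMulAction G M} [ChartedSpace ES S] [IsManifold 𝓘(ℝ, ES) ∞ S]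
  {F : Type*} [NormedAddCommGroup F] [NormedSpace ℝ F]
  {E : S → Type*} [TopologicalSpace (TotalSpace F E)]
  [∀ x, AddCommGroup (E x)] [∀ x, Module ℝ (E x)] [∀ x, TopologicalSpace (E x)]
  [∀ x, IsTopologicalAddGroup (E x)] [∀ x, ContinuousConstSMul ℝ (E x)]
  [FiberBundle F E] [VectorBundle ℝ F E] [ContMDiffVectorBundle ∞ F E 𝓘(ℝ, ES)]
  [MulAction G (TotalSpace F E)]
  {F' : Type*} [NormedAddCommGroup F'] [NormedSpace ℝ F']
  {E' : S → Type*} [TopologicalSpace (TotalSpace F' E')]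
  [∀ x, AddCommGroup (E' x)] [∀ x, Module ℝ (E' x)] [∀ x, TopologicalSpace (E' x)]
  [∀ x, IsTopologicalAddGroup (E' x)] [∀ x, ContinuousConstSMul ℝ (E' x)]
  [FiberBundle F' E'] [VectorBundle ℝ F' E'] [ContMDiffVectorBundle ∞ F' E' 𝓘(ℝ, ES)]
  [MulAction G (TotalSpace F' E')]
  [T2Space M] [FiniteDimensional ℝ F] [FiniteDimensional ℝ F']
  (T₀ : TubularNeighborhood G EM ES S F E) (T₁ : TubularNeighborhood G EM ES S F' E')

/-- The cutoff function `β σ(2 - 4 |v|^{2 g(b)})` on the total space. -/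
def bundleCutoff (β b : M → ℝ) (g : ℝ → ℝ) (v : TotalSpace F E) : ℝ :=
  β v.proj * Real.smoothTransition (2 - 4 * T₀.metric.normSq v ^ g (b v.proj))

variable {T₀ T₁}

theorem contMDiff_comp_proj {b : M → ℝ} (hb : ContMDiff 𝓘(ℝ, EM) 𝓘(ℝ, ℝ) ∞ b)
    (T₀ : TubularNeighborhood G EM ES S F E) :
    ContMDiff (𝓘(ℝ, ES).prod 𝓘(ℝ, F)) 𝓘(ℝ, ℝ) ∞ (fun v : TotalSpace F E => b v.proj) :=
  hb.comp (T₀.contMDiff_subtype_val.comp (contMDiff_proj E))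

-- The unit sphere bundle over a compact set is compact. The functions `β` and `b` of the base point
-- have speed `0` at `s = 0` and get linear bounds, while the norm only has bounded speed.
variable (T₀ T₁) in
theorem exists_curveDeriv_bounds [FiniteDimensional ℝ ES] {β b : M → ℝ}
    (hβ : ContMDiff 𝓘(ℝ, EM) 𝓘(ℝ, ℝ) ∞ β) (hb : ContMDiff 𝓘(ℝ, EM) 𝓘(ℝ, ℝ) ∞ b)
    {C : Set S} (hC : IsCompact C) :
    ∃ c > 0, ∃ K > 0, ∀ t ∈ Icc (0 : ℝ) 1, ∀ v : TotalSpace F E, v.proj ∈ C →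
      T₀.metric.normSq v = 1 → ∀ s, |s| ≤ c →
      |T₀.curveDeriv T₁ (fun v => β v.proj) (t, v) s| ≤ K * |s| ∧
      |T₀.curveDeriv T₁ (fun v => b v.proj) (t, v) s| ≤ K * |s| ∧
      |T₀.curveDeriv T₁ T₀.metric.normSq (t, v) s| ≤ K := by
  have : LocallyCompactSpace S := Manifold.locallyCompact_of_finiteDimensional 𝓘(ℝ, ES)
  have hq := T₀.metric.contMDiff_normSq
  let D : Set (TotalSpace F E) := {v | v.proj ∈ C ∧ T₀.metric.normSq v ≤ 1} ∩
    {v | T₀.metric.normSq v = 1}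
  have hD : IsCompact (Icc (0 : ℝ) 1 ×ˢ D) := isCompact_Icc.prod
    ((T₀.metric.isCompact_disc hC 1).inter_right (isClosed_eq hq.continuous continuous_const))
  obtain ⟨c₁, hc₁, K₁, h₁⟩ := hD.exists_abs_le_mul_of_contMDiffAt
    (I := 𝓘(ℝ, ℝ).prod (𝓘(ℝ, ES).prod 𝓘(ℝ, F)))
    (D := T₀.curveDeriv T₁ (fun v => β v.proj))
    (fun p _ => contMDiffAt_curveDeriv (contMDiff_comp_proj hβ T₀) p.1 p.2)
    (fun p => T₀.curveDeriv_base_zero T₁ (fun x : S => β x) p)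
  obtain ⟨c₂, hc₂, K₂, h₂⟩ := hD.exists_abs_le_mul_of_contMDiffAt
    (I := 𝓘(ℝ, ℝ).prod (𝓘(ℝ, ES).prod 𝓘(ℝ, F)))
    (D := T₀.curveDeriv T₁ (fun v => b v.proj))
    (fun p _ => contMDiffAt_curveDeriv (contMDiff_comp_proj hb T₀) p.1 p.2)
    (fun p => T₀.curveDeriv_base_zero T₁ (fun x : S => b x) p)
  obtain ⟨c₃, hc₃, K₃, h₃⟩ := hD.exists_abs_le_of_continuousAt
    (D := uncurry (T₀.curveDeriv T₁ T₀.metric.normSq))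
    (fun p _ => (contMDiffAt_curveDeriv hq p.1 p.2).continuousAt)
  refine ⟨min c₁ (min c₂ c₃), by positivity, max (max K₁ K₂) (max K₃ 1),
    lt_max_of_lt_right (lt_max_of_lt_right one_pos), fun t ht v hv hv1 s hs => ?_⟩
  have hmem : (t, v) ∈ Icc (0 : ℝ) 1 ×ˢ D := ⟨ht, ⟨hv, hv1.le⟩, hv1⟩
  refine ⟨(h₁ _ hmem s (hs.trans (min_le_left _ _))).trans ?_,
    (h₂ _ hmem s (hs.trans ((min_le_right _ _).trans (min_le_left _ _)))).trans ?_,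
    (h₃ _ hmem s (hs.trans ((min_le_right _ _).trans (min_le_right _ _)))).trans ?_⟩
  · gcongr; exact (le_max_left _ _).trans (le_max_left _ _)
  · gcongr; exact (le_max_right _ _).trans (le_max_left _ _)
  · exact (le_max_left _ _).trans (le_max_right _ _)

theorem deriv_bundleCutoff_lt_one {C : ℝ} (hC : ∀ x, |deriv Real.smoothTransition x| ≤ C)
    {β b : M → ℝ} {g : ℝ → ℝ}
    (hβ : ContMDiff 𝓘(ℝ, EM) 𝓘(ℝ, ℝ) ∞ β) (hb : ContMDiff 𝓘(ℝ, EM) 𝓘(ℝ, ℝ) ∞ b)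
    (hg : ContDiff ℝ ∞ g) (hβ1 : ∀ x, |β x| ≤ 1) {t : ℝ} {v : TotalSpace F E}
    (hv : v ∈ T₀.pathDomain T₁) {c K a : ℝ}
    (hbound : ∀ w : TotalSpace F E, w.proj = v.proj →
      T₀.metric.normSq w = 1 → ∀ s, |s| ≤ c →
      |T₀.curveDeriv T₁ (fun v => β v.proj) (t, w) s| ≤ K * |s| ∧
      |T₀.curveDeriv T₁ (fun v => b v.proj) (t, w) s| ≤ K * |s| ∧
      |T₀.curveDeriv T₁ T₀.metric.normSq (t, w) s| ≤ K)
    (hc : T₀.metric.normSq v ≤ c ^ 2) (hc0 : 0 ≤ c) (hc1 : c ≤ 1) (hK : 0 ≤ K)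
    (hKc : K * c ≤ 1 / 4)
    (hg0 : |g (b v.proj)| ≤ a) (hg1 : |deriv g (b v.proj)| ≤ a)
    (hpow : T₀.metric.normSq v ^ g (b v.proj) ≤ 1) (ha : 12 * C * a * K ≤ 1 / 2) :
    deriv (fun t' => T₀.bundleCutoff β b g (T₀.pathInv T₁ t' 1 (T₀.path T₁ t 1 v))) t < 1 := by
  by_cases hv0 : v.snd = 0
  · have h1 : v = ⟨v.proj, 0⟩ := congrArg (TotalSpace.mk v.proj) hv0
    have h2 : (fun t' => T₀.bundleCutoff β b g (T₀.pathInv T₁ t' 1 (T₀.path T₁ t 1 v))) =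
        fun _ => T₀.bundleCutoff β b g v := by
      funext t'; rw [h1, path_zero_section, pathInv_zero_section]
    rw [h2, deriv_const]; exact one_pos
  have hq := T₀.metric.contMDiff_normSq
  have hqv := T₀.metric.normSq_pos hv0
  -- Write `v = s w` with `w` a unit vector. By the scaling law the curve through `v` is `s` times
  -- the rescaled curve through `w`, to which the uniform bounds apply.
  set s := Real.sqrt (T₀.metric.normSq v) with hs
  have hs0 : 0 < s := Real.sqrt_pos.2 hqv
  have hs2 : s ^ 2 = T₀.metric.normSq v := Real.sq_sqrt hqv.le
  have hsc : s ≤ c := by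
    rw [hs]; exact Real.sqrt_le_iff.2 ⟨hc0, hc⟩
  set w := fiberSmul s⁻¹ v with hw
  have hvw : v = fiberSmul s w := by
    rw [hw, fiberSmul_fiberSmul, mul_inv_cancel₀ hs0.ne', fiberSmul_one]
  have hw1 : T₀.metric.normSq w = 1 := by
    rw [hw, normSq_fiberSmul, ← hs2, ← mul_pow, inv_mul_cancel₀ hs0.ne', one_pow]
  obtain ⟨hdef, hmem⟩ := path_mem hv t
  have hdef' : T₀.PathDefined T₁ t s w := by
    rwa [hvw, pathDefined_of_smul, one_mul] at hdef
  have hpath : T₀.path T₁ t 1 v = fiberSmul s (T₀.path T₁ t s w) := by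
    conv_lhs => rw [hvw, path_fiberSmul, one_mul]
  have hinv : T₀.PathInvDefined T₁ t s (T₀.path T₁ t s w) := by
    have h1 := (pathInv_mem hmem t).1
    rwa [hpath, pathInvDefined_of_smul, one_mul] at h1
  have hfun : (fun t' => T₀.bundleCutoff β b g (T₀.pathInv T₁ t' 1 (T₀.path T₁ t 1 v))) =
      fun t' => β (T₀.pathInv T₁ t' s (T₀.path T₁ t s w)).proj *
        Real.smoothTransition (2 - 4 *
          (s ^ 2 * T₀.metric.normSq (T₀.pathInv T₁ t' s (T₀.path T₁ t s w))) ^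
            g (b (T₀.pathInv T₁ t' s (T₀.path T₁ t s w)).proj)) := by
    funext t'
    rw [hpath, pathInv_fiberSmul, one_mul, bundleCutoff, normSq_fiberSmul, fiberSmul_proj]
  have hback : T₀.pathInv T₁ t s (T₀.path T₁ t s w) = w := pathInv_path hdef'
  have hwv : w.proj = v.proj := rfl
  obtain ⟨e₁, e₂, e₃⟩ := hbound w hwv hw1 s (by rw [abs_of_pos hs0]; exact hsc)
  rw [abs_of_pos hs0] at e₁ e₂
  rw [hfun]
  refine deriv_mul_smoothTransition_rpow_lt_one hC
    (B := fun t' => β (T₀.pathInv T₁ t' s (T₀.path T₁ t s w)).proj)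
    (b := fun t' => b (T₀.pathInv T₁ t' s (T₀.path T₁ t s w)).proj)
    (q := fun t' => T₀.metric.normSq (T₀.pathInv T₁ t' s (T₀.path T₁ t s w)))
    (hasDerivAt_curve (contMDiff_comp_proj hβ T₀) hinv)
    (hasDerivAt_curve (contMDiff_comp_proj hb T₀) hinv)
    (hasDerivAt_curve hq hinv) hg (by simp only [hback, hw1]) hs0 (hsc.trans hc1) (hβ1 _) e₁ e₂ e₃
    ?_ ?_ ?_ ((mul_le_mul_of_nonneg_left hsc hK).trans hKc) ha
  · simp only [hback, hwv]; exact hg0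
  · simp only [hback, hwv]; exact hg1
  · simp only [hback, hwv, hs2]; exact hpow

-- The power is smooth only where the norm is positive. Near the zero section it is less than `1/4`,
-- since the exponent is positive, and there the cutoff is simply `β`.
variable (T₀) in
theorem contMDiff_bundleCutoff {β b : M → ℝ} {g : ℝ → ℝ}
    (hβ : ContMDiff 𝓘(ℝ, EM) 𝓘(ℝ, ℝ) ∞ β) (hb : ContMDiff 𝓘(ℝ, EM) 𝓘(ℝ, ℝ) ∞ b)
    (hg : ContDiff ℝ ∞ g) (hg0 : ∀ y, 0 < g y) :
    ContMDiff (𝓘(ℝ, ES).prod 𝓘(ℝ, F)) 𝓘(ℝ, ℝ) ∞ (T₀.bundleCutoff β b g) := by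
  have hq := T₀.metric.contMDiff_normSq
  have hβ' := contMDiff_comp_proj hβ T₀
  have hη : ContMDiff (𝓘(ℝ, ES).prod 𝓘(ℝ, F)) 𝓘(ℝ, ℝ) ∞
      (fun v : TotalSpace F E => g (b v.proj)) := hg.contMDiff.comp (contMDiff_comp_proj hb T₀)
  intro v
  rcases (T₀.metric.normSq_nonneg v).eq_or_lt with h0 | h0
  · have hc : ContinuousAt (fun w : TotalSpace F E => T₀.metric.normSq w ^ g (b w.proj)) v :=
      hq.continuous.continuousAt.rpow hη.continuous.continuousAt (Or.inr (hg0 _))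
    refine (hβ' v).congr_of_eventuallyEq ?_
    have h1 : ∀ᶠ w in 𝓝 v, T₀.metric.normSq w ^ g (b w.proj) < 1 / 4 :=
      hc.tendsto.eventually_lt_const (by
        rw [← h0, Real.zero_rpow (hg0 _).ne']; norm_num)
    filter_upwards [h1] with w hw
    rw [bundleCutoff, Real.smoothTransition.one_of_one_le (by linarith), mul_one]
  · have h1 : ContMDiffAt (𝓘(ℝ, ES).prod 𝓘(ℝ, F)) 𝓘(ℝ, ℝ) ∞
        (fun w : TotalSpace F E => T₀.metric.normSq w ^ g (b w.proj)) v :=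
      ContMDiffAt.comp (g := fun p : ℝ × ℝ => p.1 ^ p.2)
        (f := fun w : TotalSpace F E => (T₀.metric.normSq w, g (b w.proj))) v
        (Real.contDiffAt_rpow_of_ne (_, _) h0.ne').contMDiffAt_prod ((hq v).prodMk (hη v))
    exact (hβ' v).mul (Real.smoothTransition.contDiff.contMDiff.contMDiffAt.comp v
      (contMDiffAt_const.sub (contMDiffAt_const.mul h1)))

end TubularNeighborhood

/-! ### Choice of the exponent and the cut-off diffeotopy. -/

/-- Small exponents push the support of the cutoff into a thin disc bundle: if `q > d`, then `q ^ y
≥ d ^ y ≥ d ^ a > 1/2`. -/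
theorem Real.le_of_rpow_le_half {q d y a : ℝ} (hd0 : 0 < d) (hd1 : d ≤ 1)
    (hy : 0 < y) (hya : y ≤ a) (hda : 1 / 2 < d ^ a) (h : q ^ y ≤ 1 / 2) : q ≤ d := by
  by_contra hlt
  have h1 : d ^ y ≤ q ^ y := Real.rpow_le_rpow hd0.le (not_le.1 hlt).le hy.le
  have h2 : d ^ a ≤ d ^ y := Real.rpow_le_rpow_of_exponent_ge hd0 hd1 hya
  linarith

theorem isClosed_of_forall_exists_isCompact {X : Type*} [TopologicalSpace X] [T2Space X] {b : X → ℝ}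
    (hb : Continuous b) {Y : Set X}
    (h : ∀ m : ℝ, ∃ C, IsCompact C ∧ C ⊆ Y ∧ ∀ y ∈ Y, b y < m → y ∈ C) : IsClosed Y := by
  refine isClosed_of_closure_subset fun y hy => ?_
  obtain ⟨C, hC, hCY, hYC⟩ := h (b y + 1)
  have hW : IsOpen {z | b z < b y + 1} := isOpen_lt hb continuous_const
  have h1 : y ∈ closure ({z | b z < b y + 1} ∩ Y) :=
    hW.inter_closure ⟨lt_add_one (b y), hy⟩
  have h2 : {z | b z < b y + 1} ∩ Y ⊆ C := fun z hz => hYC z hz.2 hz.1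
  exact hCY (hC.isClosed.closure_subset_iff.2 h2 h1)

namespace TubularNeighborhood

open IsGVectorBundle Function Bundle.ContMDiffRiemannianMetric

variable {G : Type*} [Group G]
  {EM : Type*} [NormedAddCommGroup EM] [NormedSpace ℝ EM]
  {ES : Type*} [NormedAddCommGroup ES] [NormedSpace ℝ ES]
  {M : Type*} [TopologicalSpace M] [ChartedSpace EM M] [MulAction G M]
  {S : SubMulAction G M} [ChartedSpace ES S] [IsManifold 𝓘(ℝ, ES) ∞ S]
  {F : Type*} [NormedAddCommGroup F] [NormedSpace ℝ F]
  {E : S → Type*} [TopologicalSpace (TotalSpace F E)]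
  [∀ x, AddCommGroup (E x)] [∀ x, Module ℝ (E x)] [∀ x, TopologicalSpace (E x)]
  [∀ x, IsTopologicalAddGroup (E x)] [∀ x, ContinuousConstSMul ℝ (E x)]
  [FiberBundle F E] [VectorBundle ℝ F E] [ContMDiffVectorBundle ∞ F E 𝓘(ℝ, ES)]
  [MulAction G (TotalSpace F E)]
  {F' : Type*} [NormedAddCommGroup F'] [NormedSpace ℝ F']
  {E' : S → Type*} [TopologicalSpace (TotalSpace F' E')]
  [∀ x, AddCommGroup (E' x)] [∀ x, Module ℝ (E' x)] [∀ x, TopologicalSpace (E' x)]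
  [∀ x, IsTopologicalAddGroup (E' x)] [∀ x, ContinuousConstSMul ℝ (E' x)]
  [FiberBundle F' E'] [VectorBundle ℝ F' E'] [ContMDiffVectorBundle ∞ F' E' 𝓘(ℝ, ES)]
  [MulAction G (TotalSpace F' E')]
  [T2Space M] [FiniteDimensional ℝ F] [FiniteDimensional ℝ F']
  (T₀ : TubularNeighborhood G EM ES S F E) (T₁ : TubularNeighborhood G EM ES S F' E')

variable {T₀ T₁}

/-- Over a compact set one number `a`, bounding the exponent and its derivative, achieves both
goals: the support lies in `N`, and the slope is less than one. -/
theorem exists_cutoff_exponent_level [FiniteDimensional ℝ ES] {β b : M → ℝ}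
    (hβ : ContMDiff 𝓘(ℝ, EM) 𝓘(ℝ, ℝ) ∞ β) (hb : ContMDiff 𝓘(ℝ, EM) 𝓘(ℝ, ℝ) ∞ b)
    (hβ1 : ∀ x, |β x| ≤ 1) {N : Set (TotalSpace F E)}
    (hN : ∀ x : S, N ∈ 𝓝 (⟨x, 0⟩ : TotalSpace F E)) (hNd : N ⊆ T₀.pathDomain T₁)
    {C : Set S} (hC : IsCompact C) :
    ∃ a > 0, ∀ g : ℝ → ℝ, ContDiff ℝ ∞ g → ∀ v : TotalSpace F E, v.proj ∈ C →
      0 < g (b v.proj) → g (b v.proj) ≤ a → |deriv g (b v.proj)| ≤ a →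
      T₀.metric.normSq v ^ g (b v.proj) ≤ 1 / 2 → v ∈ N ∧ T₀.metric.normSq v ≤ 1 ∧
        ∀ t ∈ Icc (0 : ℝ) 1, deriv (fun t' =>
          T₀.bundleCutoff β b g (T₀.pathInv T₁ t' 1 (T₀.path T₁ t 1 v))) t < 1 := by
  obtain ⟨Cσ, hCσ0, hCσ⟩ := Real.smoothTransition.exists_deriv_bound
  obtain ⟨c₁, hc₁, h₁⟩ := T₀.metric.exists_disc_subset_of_isCompact hC (fun x _ => hN x)
  obtain ⟨c₂, hc₂, K, hK, h₂⟩ := T₀.exists_curveDeriv_bounds T₁ hβ hb hC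
  -- `c` bounds the length of vectors so that the speed estimates hold and the base contributes at
  -- most `1/4`. The number `d` below bounds the squared length and also keeps the vectors in `N`.
  set c := min (min c₂ 1) (1 / (4 * K)) with hc
  have hc0 : 0 < c := by positivity
  have hcK : K * c ≤ 1 / 4 := by
    calc K * c ≤ K * (1 / (4 * K)) := by gcongr; exact min_le_right _ _
      _ = 1 / 4 := by field_simp
  set d := min c₁ (c ^ 2) with hd
  have hd0 : 0 < d := by positivity
  have hc1 : c ≤ 1 := (min_le_left _ _).trans (min_le_right _ _)
  have hd1 : d ≤ 1 := (min_le_right _ _).trans (pow_le_one₀ hc0.le hc1)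
  -- Both requirements on `a` hold in the limit `a → 0`, where `d ^ a` tends to `1` and the slope
  -- bound tends to `0`.
  have e₁ : ∀ᶠ a in 𝓝[>] (0 : ℝ), 1 / 2 < d ^ a := by
    have : ContinuousAt (fun a : ℝ => d ^ a) 0 := Real.continuousAt_const_rpow hd0.ne'
    exact nhdsWithin_le_nhds (this.tendsto.eventually_const_lt (by rw [Real.rpow_zero]; norm_num))
  have e₂ : ∀ᶠ a in 𝓝[>] (0 : ℝ), 12 * Cσ * a * K < 1 / 2 := by
    have : ContinuousAt (fun a : ℝ => 12 * Cσ * a * K) 0 := by fun_prop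
    exact nhdsWithin_le_nhds (this.tendsto.eventually_lt_const (by norm_num))
  obtain ⟨a, ⟨ha₁, ha₂⟩, ha0⟩ := ((e₁.and e₂).and self_mem_nhdsWithin).exists
  refine ⟨a, ha0, fun g hg v hvC hg0 hga hg' hq => ?_⟩
  have hqd := Real.le_of_rpow_le_half hd0 hd1 hg0 hga ha₁ hq
  have hvN := h₁ v hvC (hqd.trans (min_le_left _ _))
  refine ⟨hvN, hqd.trans hd1, fun t ht => ?_⟩
  refine deriv_bundleCutoff_lt_one hCσ hβ hb hg hβ1 (hNd hvN) (c := c) (K := K) (a := a)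
    (fun w hw hw1 s hs => h₂ t ht w (hw ▸ hvC) hw1 s
      (hs.trans ((min_le_left _ _).trans (min_le_left _ _))))
    (hqd.trans (min_le_right _ _)) hc0.le hc1 hK.le hcK (by rwa [abs_of_pos hg0]) hg'
    (hq.trans (by norm_num)) ha₂.le

/-- Each sublevel set of the exhaustion gives a bound `a n`, and a function decaying below all of
them handles every point. The level `n + 1` is used because `b` takes values in `[n, n + 1]` where
the bound `a n` is in force. -/
theorem exists_cutoff_exponent [FiniteDimensional ℝ ES] {β b : M → ℝ}
    (hβ : ContMDiff 𝓘(ℝ, EM) 𝓘(ℝ, ℝ) ∞ β) (hb : ContMDiff 𝓘(ℝ, EM) 𝓘(ℝ, ℝ) ∞ b)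
    (hβ1 : ∀ x, |β x| ≤ 1) (hb0 : ∀ x, 0 ≤ b x) (hbc : ∀ m, IsCompact {x : S | b x ≤ m})
    {N : Set (TotalSpace F E)}
    (hN : ∀ x : S, N ∈ 𝓝 (⟨x, 0⟩ : TotalSpace F E)) (hNd : N ⊆ T₀.pathDomain T₁) :
    ∃ g : ℝ → ℝ, ContDiff ℝ ∞ g ∧ (∀ y, 0 < g y) ∧ ∀ v : TotalSpace F E,
      T₀.metric.normSq v ^ g (b v.proj) ≤ 1 / 2 → v ∈ N ∧ T₀.metric.normSq v ≤ 1 ∧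
        ∀ t ∈ Icc (0 : ℝ) 1, deriv (fun t' =>
          T₀.bundleCutoff β b g (T₀.pathInv T₁ t' 1 (T₀.path T₁ t 1 v))) t < 1 := by
  choose a ha0 ha using fun n : ℕ =>
    exists_cutoff_exponent_level (T₀ := T₀) (T₁ := T₁) hβ hb hβ1 hN hNd (hbc (n + 1))
  obtain ⟨g, hg, hg0, hga⟩ := exists_contDiff_pos_deriv_le a ha0
  refine ⟨g, hg, hg0, fun v hv => ?_⟩
  have hn1 := (Nat.lt_floor_add_one (b v.proj)).le
  obtain ⟨h1, h2⟩ := hga ⌊b v.proj⌋₊ (b v.proj) (Nat.floor_le (hb0 _)) hn1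
  exact ha ⌊b v.proj⌋₊ g hg v hn1 (hg0 _) h1 h2 hv

/-- The support of the cut-off isotopy, in the total space. -/
def cutoffSupport (T₀ : TubularNeighborhood G EM ES S F E) (β b : M → ℝ) (g : ℝ → ℝ) :
    Set (TotalSpace F E) :=
  {v | (v.proj : M) ∈ closure {x | β x ≠ 0} ∧ T₀.metric.normSq v ^ g (b v.proj) ≤ 1 / 2}

theorem isClosed_cutoffSupport {β b : M → ℝ} {g : ℝ → ℝ}
    (hb : ContMDiff 𝓘(ℝ, EM) 𝓘(ℝ, ℝ) ∞ b) (hg : ContDiff ℝ ∞ g) (hg0 : ∀ y, 0 < g y) :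
    IsClosed (T₀.cutoffSupport β b g) := by
  have h : IsClosed {v : TotalSpace F E | T₀.metric.normSq v ^ g (b v.proj) ≤ 1 / 2} :=
    isClosed_le (T₀.metric.contMDiff_normSq.continuous.rpow
      (hg.continuous.comp (contMDiff_comp_proj hb T₀).continuous) fun v => Or.inr (hg0 _))
      continuous_const
  exact (isClosed_closure.preimage
    (continuous_subtype_val.comp (FiberBundle.continuous_proj F E))).inter h

theorem exists_diffeotopy_cutoff [FiniteDimensional ℝ ES] [FiniteDimensional ℝ EM]
    [IsManifold 𝓘(ℝ, EM) ∞ M]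
    (EG : Type*) [NormedAddCommGroup EG] [NormedSpace ℝ EG]
    [TopologicalSpace G] [ChartedSpace EG G] [IsGVectorBundle EG ES G F E]
    [IsGVectorBundle EG ES G F' E'] {β b : M → ℝ}
    (hβ : ContMDiff 𝓘(ℝ, EM) 𝓘(ℝ, ℝ) ∞ β) (hβ_smul : ∀ (g : G) x, β (g • x) = β x)
    (hβI : ∀ x, β x ∈ Icc (0 : ℝ) 1)
    (hb : ContMDiff 𝓘(ℝ, EM) 𝓘(ℝ, ℝ) ∞ b) (hb_smul : ∀ (g : G) x, b (g • x) = b x)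
    (hb0 : ∀ x, 0 ≤ b x) (hbc : ∀ m, IsCompact {x : S | b x ≤ m})
    {N : Set (TotalSpace F E)}
    (hN : ∀ x : S, N ∈ 𝓝 (⟨x, 0⟩ : TotalSpace F E)) (hNd : N ⊆ T₀.pathDomain T₁)
    (hNb : ∀ v ∈ N, ∀ t ∈ Icc (0 : ℝ) 1, |b (T₀.isotopy T₁ t (T₀.φ v)) - b v.proj| < 1) :
    ∃ g : ℝ → ℝ, ContDiff ℝ ∞ g ∧ (∀ y, 0 < g y) ∧ T₀.cutoffSupport β b g ⊆ N ∧
      IsClosed (T₀.φ '' T₀.cutoffSupport β b g) ∧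
      ∃ H : EquivariantDiffeotopy G EM M,
        (∀ t, ∀ v ∈ T₀.cutoffSupport β b g, H.toDiffeo t (T₀.φ v) =
          T₀.isotopy T₁ (t * T₀.bundleCutoff β b g v) (T₀.φ v)) ∧
        ∀ t, ∀ x ∉ T₀.φ '' T₀.cutoffSupport β b g, H.toDiffeo t x = x := by
  classical
  have : LocallyCompactSpace S := Manifold.locallyCompact_of_finiteDimensional 𝓘(ℝ, ES)
  have := FiniteDimensional.complete ℝ EM
  have hβ1 : ∀ x, |β x| ≤ 1 := fun x => by rw [abs_of_nonneg (hβI x).1]; exact (hβI x).2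
  obtain ⟨g, hg, hg0, hgN⟩ := exists_cutoff_exponent (T₀ := T₀) (T₁ := T₁) hβ hb hβ1 hb0 hbc hN hNd
  set K := T₀.cutoffSupport β b g with hK
  have hKN : K ⊆ N := fun v hv => (hgN v hv.2).1
  have hKd : K ⊆ T₀.pathDomain T₁ := hKN.trans hNd
  have hKc : IsClosed K := isClosed_cutoffSupport hb hg hg0
  -- The support is contained in the unit disc bundle, so its part over a compact base is compact.
  have hcomp : ∀ m : ℝ, IsCompact (K ∩ {v | b v.proj ≤ m}) := fun m => by
    refine (T₀.metric.isCompact_disc (hbc m) 1).of_isClosed_subset (hKc.inter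
      (isClosed_le (contMDiff_comp_proj hb T₀).continuous continuous_const)) ?_
    exact fun v hv => ⟨hv.2, (hgN v hv.1.2).2.1⟩
  -- The map `φ₀` is only an open embedding, so its image of a closed set needs an argument. The
  -- function `b` changes by less than `1` from `v.proj` to any point of the trajectory, so over a
  -- sublevel of `b` in `M` only a compact part of `K` matters. The same works for the swept-out
  -- set.
  have hφK : IsClosed (T₀.φ '' K) := by
    refine isClosed_of_forall_exists_isCompact hb.continuous fun m =>
      ⟨T₀.φ '' (K ∩ {v | b v.proj ≤ m + 1}), (hcomp (m + 1)).image_of_continuousOn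
        (T₀.φ.continuousOn.mono fun v hv => (hKd hv.1).1), image_mono inter_subset_left, ?_⟩
    rintro _ ⟨v, hv, rfl⟩ hm
    have h1 := hNb v (hKN hv) 0 (by simp)
    rw [isotopy_zero (hKd hv)] at h1
    exact ⟨v, ⟨hv, by rw [mem_ofPred_eq]; linarith [(abs_lt.1 h1).1]⟩, rfl⟩
  have hφK' : IsClosed (⋃ t ∈ Icc (0 : ℝ) 1, T₀.isotopy T₁ t '' (T₀.φ '' K)) := by
    refine isClosed_of_forall_exists_isCompact hb.continuous fun m =>
      ⟨(fun p : ℝ × TotalSpace F E => T₀.isotopy T₁ p.1 (T₀.φ p.2)) ''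
        (Icc (0 : ℝ) 1 ×ˢ (K ∩ {v | b v.proj ≤ m + 1})), ?_, ?_, ?_⟩
    · refine (isCompact_Icc.prod (hcomp (m + 1))).image_of_continuousOn fun p hp => ?_
      have h1 := hKd hp.2.1
      refine ContinuousAt.continuousWithinAt ?_
      exact ContinuousAt.comp (g := uncurry (T₀.isotopy T₁))
        (f := fun p : ℝ × TotalSpace F E => (p.1, T₀.φ p.2)) (contMDiffAt_isotopy h1 p.1).continuousAt
        (continuousAt_fst.prodMk ((T₀.φ.continuousAt h1.1).comp (f := fun p : ℝ × TotalSpace F E => p.2)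
          continuousAt_snd))
    · rintro _ ⟨⟨t, v⟩, ⟨ht, hv⟩, rfl⟩
      exact mem_iUnion₂.2 ⟨t, ht, _, ⟨v, hv.1, rfl⟩, rfl⟩
    · intro y hy hm
      obtain ⟨t, ht, _, ⟨v, hv, rfl⟩, rfl⟩ := mem_iUnion₂.1 hy
      have h1 := hNb v (hKN hv) t ht
      exact ⟨(t, v), ⟨ht, hv, by rw [mem_ofPred_eq]; linarith [(abs_lt.1 h1).1]⟩, rfl⟩
  -- The extension by zero is smooth because the image of `K` is closed in `M` and `χ` vanishes off
  -- it.
  let χ : M → ℝ := fun y => if y ∈ T₀.φ.target then T₀.bundleCutoff β b g (T₀.φ.symm y) else 0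
  have hχφ : ∀ v ∈ T₀.φ.source, χ (T₀.φ v) = T₀.bundleCutoff β b g v := fun v hv => by
    simp only [χ, if_pos (T₀.φ.map_source hv), T₀.φ.left_inv hv]
  have hχK : ∀ y ∉ T₀.φ '' K, χ y = 0 := by
    intro y hy
    by_cases h : y ∈ T₀.φ.target
    · simp only [χ, if_pos h]
      by_contra hne
      obtain ⟨h1, h2⟩ := mul_ne_zero_iff.1 hne
      refine hy ⟨T₀.φ.symm y, ⟨subset_closure h1, ?_⟩, T₀.φ.right_inv h⟩
      by_contra h3
      exact h2 (Real.smoothTransition.zero_of_nonpos (by linarith [not_le.1 h3]))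
    · exact if_neg h
  have hχI : ∀ y, χ y ∈ Icc (0 : ℝ) 1 := by
    intro y
    by_cases h : y ∈ T₀.φ.target
    · simp only [χ, if_pos h]
      exact ⟨mul_nonneg (hβI _).1 (Real.smoothTransition.nonneg _),
        mul_le_one₀ (hβI _).2 (Real.smoothTransition.nonneg _) (Real.smoothTransition.le_one _)⟩
    · simp only [χ, if_neg h]; simp
  have hχ : ContMDiff 𝓘(ℝ, EM) 𝓘(ℝ, ℝ) ∞ χ := by
    intro y
    by_cases h : y ∈ T₀.φ.target
    · have h1 := ((T₀.contMDiff_bundleCutoff hβ hb hg hg0).contMDiffAt).comp y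
        (T₀.contMDiffAt_φ_symm h)
      refine h1.congr_of_eventuallyEq ?_
      filter_upwards [T₀.φ.open_target.mem_nhds h] with z hz
      exact if_pos hz
    · have h1 : y ∉ T₀.φ '' K := by
        rintro ⟨v, hv, rfl⟩; exact h (T₀.φ.map_source (hKd hv).1)
      refine (contMDiffAt_const (c := (0 : ℝ))).congr_of_eventuallyEq ?_
      filter_upwards [hφK.isOpen_compl.mem_nhds h1] with z hz
      exact hχK z hz
  have hχ_smul : ∀ (γ : G) y, χ (γ • y) = χ y := by
    intro γ y
    by_cases h : y ∈ T₀.φ.target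
    · simp only [χ, if_pos h, if_pos (T₀.smul_mem_target EG γ h), T₀.φ_symm_smul EG γ h,
        bundleCutoff, T₀.normSq_smul]
      rw [proj_smul EG ES]
      have h1 : ((γ • (T₀.φ.symm y).proj : S) : M) = γ • ((T₀.φ.symm y).proj : M) := rfl
      rw [h1, hβ_smul, hb_smul]
    · have h' : γ • y ∉ T₀.φ.target := fun h1 => h (by
        simpa using T₀.smul_mem_target EG γ⁻¹ h1)
      simp only [χ, if_neg h, if_neg h']
  obtain ⟨H, hH1, hH2⟩ := exists_equivariantDiffeotopy_of_local (G := G) (Φ := T₀.isotopy T₁)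
    (Ψ := T₀.isotopyInv T₁) (Ω₀ := T₀.φ '' T₀.pathDomain T₁) (Ω₁ := T₁.φ '' T₀.invDomain T₁)
    (K := T₀.φ '' K) (χ := χ)
    (T₀.φ.isOpen_image_of_subset_source (T₀.isOpen_pathDomain T₁) inter_subset_left)
    (T₁.φ.isOpen_image_of_subset_source (T₀.isOpen_invDomain T₁) inter_subset_left)
    (by rintro t _ ⟨v, hv, rfl⟩; exact contMDiffAt_isotopy hv t)
    (by rintro t _ ⟨w, hw, rfl⟩; exact contMDiffAt_isotopyInv hw t)
    (by rintro t _ ⟨v, hv, rfl⟩; rw [isotopy_φ hv]; exact ⟨_, (path_mem hv t).2, rfl⟩)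
    (by rintro t _ ⟨v, hv, rfl⟩; exact isotopyInv_isotopy hv t)
    (by rintro t _ ⟨w, hw, rfl⟩; exact isotopy_isotopyInv hw t)
    (by rintro _ ⟨v, hv, rfl⟩; exact isotopy_zero hv)
    (by rintro _ ⟨w, hw, rfl⟩; exact isotopyInv_zero hw)
    (by
      rintro γ _ ⟨v, hv, rfl⟩
      exact ⟨γ • v, smul_mem_pathDomain EG γ hv, T₀.φ_smul γ v hv.1⟩)
    (by rintro t γ _ ⟨v, hv, rfl⟩; exact isotopy_smul EG γ hv t)
    hχ (fun y => (hχI y).1) (fun y => (hχI y).2) hχ_smul hφK (image_mono hKd) hχK hφK'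
    (by
      rintro t ht _ ⟨v, hv, rfl⟩
      have h1 : (fun t' => χ (T₀.isotopyInv T₁ t' (T₀.isotopy T₁ t (T₀.φ v)))) = fun t' =>
          T₀.bundleCutoff β b g (T₀.pathInv T₁ t' 1 (T₀.path T₁ t 1 v)) := by
        funext t'
        rw [isotopyInv_isotopy_φ (hKd hv),
          hχφ _ (pathInv_mem (path_mem (hKd hv) t).2 t').2]
      rw [h1]
      exact (hgN v hv.2).2.2 t ht)
  refine ⟨g, hg, hg0, hKN, hφK, H, fun t v hv => ?_, hH2⟩
  rw [hH1 t _ ⟨v, hv, rfl⟩, hχφ v (hKd hv).1]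

/-- Conditions on points that hold on `S` and are open hold along the isotopy near the zero
section. -/
theorem forall_isotopy_mem_nhds {W : Set (M × TotalSpace F E)} {x : S}
    (hW : W ∈ 𝓝 ((x : M), (⟨x, 0⟩ : TotalSpace F E))) :
    {v | ∀ t ∈ Icc (0 : ℝ) 1, (T₀.isotopy T₁ t (T₀.φ v), v) ∈ W} ∈
      𝓝 (⟨x, 0⟩ : TotalSpace F E) := by
  refine isCompact_Icc.eventually_forall_of_forall_eventually
    (P := fun v t => (T₀.isotopy T₁ t (T₀.φ v), v) ∈ W) fun t _ => ?_
  have h0 := T₀.zero_mem_pathDomain T₁ x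
  have h1 : ContinuousAt (fun p : TotalSpace F E × ℝ => T₀.isotopy T₁ p.2 (T₀.φ p.1))
      (⟨x, 0⟩, t) :=
    ContinuousAt.comp (g := uncurry (T₀.isotopy T₁))
      (f := fun p : TotalSpace F E × ℝ => (p.2, T₀.φ p.1)) (contMDiffAt_isotopy h0 t).continuousAt
      (continuousAt_snd.prodMk ((T₀.φ.continuousAt h0.1).comp (f := fun p : TotalSpace F E × ℝ => p.1)
        continuousAt_fst))
  have h2 := h1.prodMk (continuousAt_fst (p := ((⟨x, 0⟩ : TotalSpace F E), t)))
  refine h2 ?_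
  have h3 : T₀.isotopy T₁ t (T₀.φ ⟨x, 0⟩) = x := by rw [T₀.φ_zero, isotopy_coe]
  simp only [h3]
  exact hW

end TubularNeighborhood

/-! ### Recognizing isomorphisms of tubular neighbourhoods. -/

namespace TubularNeighborhood

open IsGVectorBundle Function Bundle.ContMDiffRiemannianMetric

variable {G : Type*} [Group G]
  {EM : Type*} [NormedAddCommGroup EM] [NormedSpace ℝ EM]
  {ES : Type*} [NormedAddCommGroup ES] [NormedSpace ℝ ES]
  {M : Type*} [TopologicalSpace M] [ChartedSpace EM M] [MulAction G M]
  {S : SubMulAction G M} [ChartedSpace ES S] [IsManifold 𝓘(ℝ, ES) ∞ S]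
  {F : Type*} [NormedAddCommGroup F] [NormedSpace ℝ F]
  {E : S → Type*} [TopologicalSpace (TotalSpace F E)]
  [∀ x, AddCommGroup (E x)] [∀ x, Module ℝ (E x)] [∀ x, TopologicalSpace (E x)]
  [∀ x, IsTopologicalAddGroup (E x)] [∀ x, ContinuousConstSMul ℝ (E x)]
  [FiberBundle F E] [VectorBundle ℝ F E] [ContMDiffVectorBundle ∞ F E 𝓘(ℝ, ES)]
  [MulAction G (TotalSpace F E)]
  {F' : Type*} [NormedAddCommGroup F'] [NormedSpace ℝ F']
  {E' : S → Type*} [TopologicalSpace (TotalSpace F' E')]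
  [∀ x, AddCommGroup (E' x)] [∀ x, Module ℝ (E' x)] [∀ x, TopologicalSpace (E' x)]
  [∀ x, IsTopologicalAddGroup (E' x)] [∀ x, ContinuousConstSMul ℝ (E' x)]
  [FiberBundle F' E'] [VectorBundle ℝ F' E'] [ContMDiffVectorBundle ∞ F' E' 𝓘(ℝ, ES)]
  [MulAction G (TotalSpace F' E')]
  [T2Space M] [FiniteDimensional ℝ F] [FiniteDimensional ℝ F']
  (T₀ : TubularNeighborhood G EM ES S F E) (T₁ : TubularNeighborhood G EM ES S F' E')

/-- A smooth equivariant isometry of vector bundles that locally, near the zero section, conjugates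
the two embeddings over `X` is an isomorphism of tubular neighbourhoods over `X`. -/
theorem exists_isoOver_of_local [FiniteDimensional ℝ ES] [T2Space S] [SigmaCompactSpace S]
    (X : Set S) (L : ∀ x, E x ≃ₗ[ℝ] E' x)
    (hL : ∀ x v w, T₁.metric.inner x (L x v) (L x w) = T₀.metric.inner x v w)
    (hL_smooth : ContMDiff (𝓘(ℝ, ES).prod 𝓘(ℝ, F)) (𝓘(ℝ, ES).prod 𝓘(ℝ, F')) ∞
      (fun v : TotalSpace F E => (⟨v.proj, L v.proj v.snd⟩ : TotalSpace F' E')))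
    (hL_smul : ∀ (g : G) (v : TotalSpace F E),
      (⟨(g • v).proj, L (g • v).proj (g • v).snd⟩ : TotalSpace F' E') =
        g • (⟨v.proj, L v.proj v.snd⟩ : TotalSpace F' E'))
    (hloc : ∀ x : S, ∃ c > 0, ∀ᶠ y in 𝓝 x, y ∈ X → ∀ v : E y, T₀.metric.inner y v v < c →
      T₁.φ ⟨y, L y v⟩ = T₀.φ ⟨y, v⟩) :
    ∃ ψ : T₀.IsoOver T₁ X, ∀ x, ψ.ψ x = L x := by
  obtain ⟨d, hd⟩ := exists_contMDiffMap_forall_mem_convex_of_local_const (n := ⊤) 𝓘(ℝ, ES)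
    (t := fun y : S => {d : ℝ | 0 < d ∧ (y ∈ X → ∀ v : E y, T₀.metric.inner y v v < d →
      T₁.φ ⟨y, L y v⟩ = T₀.φ ⟨y, v⟩)})
    (fun y => by
      -- The admissible radii at a point form an interval, since shrinking the radius preserves the
      -- condition; convexity lets the local radii be glued to one smooth positive function.
      refine OrdConnected.convex ⟨fun a ha c hc d hd => ⟨ha.1.trans_le hd.1, fun hy v hv => ?_⟩⟩
      exact hc.2 hy v (hv.trans_le hd.2))
    (fun x => by
      obtain ⟨c, hc, h⟩ := hloc x
      exact ⟨c, h.mono fun y hy => ⟨hc, hy⟩⟩)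
  exact ⟨{
    ψ := fun x => L x
    isometry := fun x => hL x
    smooth := fun x _ => ⟨univ, isOpen_univ, mem_univ x, _, hL_smooth.contMDiffOn,
      fun _ _ _ => rfl⟩
    equivariant := fun g v _ _ => hL_smul g v
    δ := fun x => min (d x) (min (T₀.ε x) (T₁.ε x))
    δ_pos := fun x => lt_min (hd x).1 (lt_min (T₀.ε_pos x) (T₁.ε_pos x))
    δ_le := fun x => min_le_right _ _
    δ_continuous := ((d.contMDiff.continuous).min
      (T₀.ε_smooth.continuous.min T₁.ε_smooth.continuous)).comp continuous_subtype_val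
    φ_comp := fun x v hv => (hd x).2 x.2 v (hv.trans_le (min_le_left _ _)) }, fun _ => rfl⟩

variable {T₀ T₁}

theorem bundleCutoff_mem_Icc {β b : M → ℝ} (hβI : ∀ x, β x ∈ Icc (0 : ℝ) 1) (g : ℝ → ℝ)
    (v : TotalSpace F E) : T₀.bundleCutoff β b g v ∈ Icc (0 : ℝ) 1 :=
  ⟨mul_nonneg (hβI _).1 (Real.smoothTransition.nonneg _),
    mul_le_one₀ (hβI _).2 (Real.smoothTransition.nonneg _) (Real.smoothTransition.le_one _)⟩

/-- Near a point where `β = 1` the cut-off function is `1` on a disc bundle. -/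
theorem exists_bundleCutoff_eq_one {β b : M → ℝ} {g : ℝ → ℝ}
    (hb : ContMDiff 𝓘(ℝ, EM) 𝓘(ℝ, ℝ) ∞ b) (hg : ContDiff ℝ ∞ g) (hg0 : ∀ y, 0 < g y)
    {x : S} (hx : ∀ᶠ y in 𝓝 (x : M), β y = 1) :
    ∃ c > 0, ∀ᶠ y in 𝓝 x, ∀ v : TotalSpace F E, v.proj = y → T₀.metric.normSq v < c →
      v ∈ T₀.cutoffSupport β b g ∧ T₀.bundleCutoff β b g v = 1 := by
  have h1 : Continuous fun v : TotalSpace F E => T₀.metric.normSq v ^ g (b v.proj) :=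
    T₀.metric.contMDiff_normSq.continuous.rpow
      (hg.continuous.comp (contMDiff_comp_proj hb T₀).continuous) fun v => Or.inr (hg0 _)
  have h2 : {v : TotalSpace F E | T₀.metric.normSq v ^ g (b v.proj) < 1 / 4} ∈
      𝓝 (⟨x, 0⟩ : TotalSpace F E) := by
    refine (isOpen_lt h1 continuous_const).mem_nhds ?_
    rw [mem_ofPred_eq, normSq_zero, Real.zero_rpow (hg0 _).ne']
    norm_num
  obtain ⟨c, hc, h3⟩ := T₀.metric.exists_disc_subset h2
  refine ⟨c, hc, ?_⟩
  filter_upwards [h3, continuous_subtype_val.continuousAt.eventually hx] with y hy hβy v hv hvc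
  have h4 : T₀.metric.normSq v ^ g (b v.proj) < 1 / 4 := hy v hv hvc.le
  have h5 : β v.proj = 1 := by rw [hv]; exact hβy
  refine ⟨⟨subset_closure (by rw [mem_ofPred_eq, h5]; exact one_ne_zero), by linarith⟩, ?_⟩
  rw [bundleCutoff, h5, one_mul, Real.smoothTransition.one_of_one_le (by linarith)]

/-- If `T₀` and `T₁` are isomorphic near `x`, then every cut-off of the isotopy has the same
effect near `x`. -/
theorem IsoOver.exists_eventually_isotopy_eq {U : Set S} (ψ : T₀.IsoOver T₁ U) (hU : IsOpen U)
    {x : S} (hx : x ∈ U) :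
    ∃ c > 0, ∀ᶠ y in 𝓝 x, ∀ v : TotalSpace F E, v.proj = y → T₀.metric.normSq v < c →
      T₁.φ ⟨v.proj, T₀.fiberIsometry T₁ v.proj v.snd⟩ = T₀.φ v ∧
      ∀ t, T₀.isotopy T₁ t (T₀.φ v) = T₀.φ v := by
  refine ⟨ψ.δ ⟨x, hx⟩ / 2, half_pos (ψ.δ_pos _), ?_⟩
  have h1 : ∀ᶠ z : U in 𝓝 ⟨x, hx⟩, ψ.δ ⟨x, hx⟩ / 2 < ψ.δ z :=
    ψ.δ_continuous.continuousAt.eventually_const_lt (half_lt_self (ψ.δ_pos _))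
  have h2 : ∀ᶠ y in 𝓝 x, ∀ hy : y ∈ U, ψ.δ ⟨x, hx⟩ / 2 < ψ.δ ⟨y, hy⟩ := by
    rw [← hU.isOpenEmbedding_subtypeVal.map_nhds_eq ⟨x, hx⟩, Filter.eventually_map]
    exact h1.mono fun z hz _ => hz
  filter_upwards [h2, hU.mem_nhds hx] with y hy hyU v hv hvc
  subst hv
  have h3 : T₀.metric.normSq v < ψ.δ ⟨v.proj, hyU⟩ := hvc.trans (hy hyU)
  have h4 : T₁.φ ⟨v.proj, T₀.fiberIsometry T₁ v.proj v.snd⟩ = T₀.φ v := by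
    rw [ψ.fiberIsometry_eq hyU]; exact ψ.φ_comp ⟨v.proj, hyU⟩ v.snd h3
  refine ⟨h4, fun t => ?_⟩
  have h5 : v ∈ T₀.φ.source :=
    T₀.mem_source_iff.2 (h3.trans_le ((ψ.δ_le _).trans (min_le_left _ _)))
  rw [isotopy, T₀.φ.left_inv h5, ψ.path_eq hyU h3, h4]

end TubularNeighborhood

/-! ### The uniqueness theorem. -/

open TubularNeighborhood Bundle.ContMDiffRiemannianMetric

theorem mainTheorem2
    {EG : Type*} [NormedAddCommGroup EG] [NormedSpace ℝ EG] [FiniteDimensional ℝ EG]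
    {EM : Type*} [NormedAddCommGroup EM] [NormedSpace ℝ EM] [FiniteDimensional ℝ EM]
    {EP : Type*} [NormedAddCommGroup EP] [NormedSpace ℝ EP] [FiniteDimensional ℝ EP]
    {ES : Type*} [NormedAddCommGroup ES] [NormedSpace ℝ ES] [FiniteDimensional ℝ ES]
    -- the compact Lie group `G` and the smooth `G`-manifolds `M` and `P`
    {G : Type*} [Group G] [TopologicalSpace G] [ChartedSpace EG G] [LieGroup 𝓘(ℝ, EG) ∞ G]
    [CompactSpace G] [T2Space G]
    {M : Type*} [TopologicalSpace M] [ChartedSpace EM M] [IsManifold 𝓘(ℝ, EM) ∞ M]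
    [T2Space M] [SigmaCompactSpace M] [MulAction G M]
    [ContMDiffSMul 𝓘(ℝ, EG) 𝓘(ℝ, EM) ∞ G M]
    {P : Type*} [TopologicalSpace P] [ChartedSpace EP P] [IsManifold 𝓘(ℝ, EP) ∞ P]
    [T2Space P] [SigmaCompactSpace P] [MulAction G P]
    [ContMDiffSMul 𝓘(ℝ, EG) 𝓘(ℝ, EP) ∞ G P]
    -- the closed `G`-invariant submanifold `S`
    (S : SubMulAction G M) [ChartedSpace ES S] [IsManifold 𝓘(ℝ, ES) ∞ S]
    (hS_closed : IsClosed (S : Set M))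
    (hS_embedding : IsSmoothEmbedding 𝓘(ℝ, ES) 𝓘(ℝ, EM) ∞ (Subtype.val : S → M))
    -- the equivariant map `f`
    (f : M → P) (hf : ContMDiff 𝓘(ℝ, EM) 𝓘(ℝ, EP) ∞ f)
    (hf_equivariant : ∀ (g : G) (x : M), f (g • x) = g • f x)
    (hf_submersion : IsSubmersion 𝓘(ℝ, ES) 𝓘(ℝ, EP) ∞ (fun x : S => f x))
    -- the `G`-vector bundles `E₀` and `E₁` over `S`
    {F₀ : Type*} [NormedAddCommGroup F₀] [NormedSpace ℝ F₀] [FiniteDimensional ℝ F₀]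
    {E₀ : S → Type*} [TopologicalSpace (TotalSpace F₀ E₀)]
    [∀ x, AddCommGroup (E₀ x)] [∀ x, Module ℝ (E₀ x)] [∀ x, TopologicalSpace (E₀ x)]
    [∀ x, IsTopologicalAddGroup (E₀ x)] [∀ x, ContinuousConstSMul ℝ (E₀ x)]
    [FiberBundle F₀ E₀] [VectorBundle ℝ F₀ E₀] [ContMDiffVectorBundle ∞ F₀ E₀ 𝓘(ℝ, ES)]
    [MulAction G (TotalSpace F₀ E₀)] [IsGVectorBundle EG ES G F₀ E₀]
    {F₁ : Type*} [NormedAddCommGroup F₁] [NormedSpace ℝ F₁] [FiniteDimensional ℝ F₁]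
    {E₁ : S → Type*} [TopologicalSpace (TotalSpace F₁ E₁)]
    [∀ x, AddCommGroup (E₁ x)] [∀ x, Module ℝ (E₁ x)] [∀ x, TopologicalSpace (E₁ x)]
    [∀ x, IsTopologicalAddGroup (E₁ x)] [∀ x, ContinuousConstSMul ℝ (E₁ x)]
    [FiberBundle F₁ E₁] [VectorBundle ℝ F₁ E₁] [ContMDiffVectorBundle ∞ F₁ E₁ 𝓘(ℝ, ES)]
    [MulAction G (TotalSpace F₁ E₁)] [IsGVectorBundle EG ES G F₁ E₁]
    -- the tubular neighbourhoods, isomorphic over `U`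
    (T₀ : TubularNeighborhood G EM ES S F₀ E₀) (hT₀ : T₀.CompatibleWith f)
    (T₁ : TubularNeighborhood G EM ES S F₁ E₁) (hT₁ : T₁.CompatibleWith f)
    (U : Set S) (hU_open : IsOpen U) (hU_invariant : ∀ (g : G), ∀ x ∈ U, g • x ∈ U)
    (ψ₀ : T₀.IsoOver T₁ U)
    (A Z : Set S) (hA_closed : IsClosed A) (hA_invariant : ∀ (g : G), ∀ x ∈ A, g • x ∈ A)
    (hZ_closed : IsClosed Z) (hZ_invariant : ∀ (g : G), ∀ x ∈ Z, g • x ∈ Z)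
    (hAU : A ⊆ U)
    (V : Set M) (hV_open : IsOpen V) (hV_invariant : ∀ (g : G), ∀ x ∈ V, g • x ∈ V)
    (hZV : ∀ x ∈ Z, (x : M) ∈ V)
    (O : Set (M × M)) (hO_nhds : O ∈ 𝓝ˢ (diagonal M))
    (hO_invariant : ∀ (g : G) (x y : M), (x, y) ∈ O → (g • x, g • y) ∈ O) :
    ∃ (H : EquivariantDiffeotopy G EM M) (hHS : ∀ t (x : S), H.toDiffeo t (x : M) = x),
      H.CompatibleWith f ∧
      H.support ⊆ V \ (Subtype.val '' A) ∧
      (∀ t x, (H.toDiffeo t x, x) ∈ O) ∧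
      ∃ ψ : (T₀.pushforward (H.toDiffeo 1) (H.map_smul 1) (hHS 1)).IsoOver T₁ (A ∪ Z),
        ∀ (x : S) (hx : x ∈ A), ψ.ψ ⟨x, Or.inl hx⟩ = ψ₀.ψ ⟨x, hAU hx⟩ := by
  have hemb := hS_closed.isClosedEmbedding_subtypeVal
  have : SigmaCompactSpace S := hemb.sigmaCompactSpace
  obtain ⟨b, hb, hb_smul, hb0, hbc⟩ := exists_contMDiff_invariant_exhaustion (EM := EM) (M := M) EG G
  have hbS : ∀ m, IsCompact {x : S | b x ≤ m} := fun m => hemb.isCompact_preimage (hbc m)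
  have hAM : IsClosed (Subtype.val '' A : Set M) := hemb.isClosedMap _ hA_closed
  have hdisj : Disjoint (Subtype.val '' (Z \ U) : Set M) (Subtype.val '' A ∪ Vᶜ) := by
    rw [Set.disjoint_left]
    rintro _ ⟨x, hx, rfl⟩ (⟨y, hy, hxy⟩ | h)
    · rw [Subtype.val_injective hxy] at hy; exact hx.2 (hAU hy)
    · exact h (hZV x hx.1)
  -- The cutoff has to be `1` only near `Z \ U`: over `U` the isotopy is already stationary near the
  -- zero section. This is what makes the two closed sets disjoint although `A` may meet `Z`.
  obtain ⟨β, hβ, hβ_smul, hβI, hβ1, hβ0⟩ := exists_contMDiff_invariant_cutoff (EM := EM) EG G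
    (C := Subtype.val '' (Z \ U)) (D := Subtype.val '' A ∪ Vᶜ)
    (hemb.isClosedMap _ (hZ_closed.sdiff hU_open))
    (hAM.union hV_open.isClosed_compl) hdisj
    (by
      rintro g _ ⟨x, hx, rfl⟩
      refine ⟨g • x, ⟨hZ_invariant g x hx.1, fun h => hx.2 ?_⟩, rfl⟩
      simpa using hU_invariant g⁻¹ _ h)
    (by
      rintro g x (⟨y, hy, rfl⟩ | hx)
      · exact Or.inl ⟨g • y, hA_invariant g y hy, rfl⟩
      · refine Or.inr fun h => hx ?_
        simpa using hV_invariant g⁻¹ _ h)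
  have hβV : closure {x | β x ≠ 0} ⊆ V \ (Subtype.val '' A) := by
    intro x hx
    have h : x ∉ (Subtype.val '' A ∪ Vᶜ : Set M) := fun h =>
      (mem_closure_iff_frequently.1 hx) ((hβ0 x h).mono fun y hy h' => h' hy)
    exact ⟨by_contra fun h1 => h (Or.inr h1), fun h1 => h (Or.inl h1)⟩
  have hO : ∀ x, O ∈ 𝓝 (x, x) := fun x => mem_nhdsSet_iff_forall.1 hO_nhds (x, x) rfl
  have hφ0 : ∀ x : S, ContinuousAt T₀.φ ⟨x, 0⟩ := fun x => T₀.φ.continuousAt (T₀.zero_mem_source x)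
  -- `N` collects what the support must satisfy: the isotopy is defined, the point lies in `V \ A`
  -- when its base point is in the support of `β`, all trajectories are `O`-small, and `b` varies by
  -- less than `1`. The last condition serves closedness of the support.
  let N : Set (TotalSpace F₀ E₀) := T₀.pathDomain T₁ ∩
    ({v | (v.proj : M) ∈ closure {x | β x ≠ 0} → T₀.φ v ∈ V \ (Subtype.val '' A)} ∩
      {v | ∀ t ∈ Icc (0 : ℝ) 1, (T₀.isotopy T₁ t (T₀.φ v), v) ∈
        {p : M × TotalSpace F₀ E₀ | (p.1, T₀.φ p.2) ∈ O ∧ |b p.1 - b p.2.proj| < 1}})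
  have hbp := (contMDiff_comp_proj hb T₀).continuous
  have hN : ∀ x : S, N ∈ 𝓝 (⟨x, 0⟩ : TotalSpace F₀ E₀) := by
    intro x
    refine Filter.inter_mem ((T₀.isOpen_pathDomain T₁).mem_nhds (T₀.zero_mem_pathDomain T₁ x))
      (Filter.inter_mem ?_ (forall_isotopy_mem_nhds (Filter.inter_mem ?_ ?_)))
    · by_cases hx : (x : M) ∈ closure {x | β x ≠ 0}
      · have h1 : V \ (Subtype.val '' A) ∈ 𝓝 (T₀.φ ⟨x, 0⟩) := by
          rw [T₀.φ_zero]; exact (hV_open.sdiff hAM).mem_nhds (hβV hx)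
        filter_upwards [hφ0 x h1] with v hv _ using hv
      · have h1 : ∀ᶠ v in 𝓝 (⟨x, 0⟩ : TotalSpace F₀ E₀), (v.proj : M) ∉ closure {x | β x ≠ 0} :=
          ((isClosed_closure.preimage (continuous_subtype_val.comp
            (FiberBundle.continuous_proj F₀ E₀))).isOpen_compl).mem_nhds hx
        filter_upwards [h1] with v hv h using absurd h hv
    · have h1 : ContinuousAt (fun p : M × TotalSpace F₀ E₀ => (p.1, T₀.φ p.2))
          ((x : M), (⟨x, 0⟩ : TotalSpace F₀ E₀)) :=
        continuousAt_fst.prodMk (ContinuousAt.comp (g := T₀.φ)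
          (f := fun p : M × TotalSpace F₀ E₀ => p.2) (hφ0 x) continuousAt_snd)
      refine h1 ?_
      simpa only [T₀.φ_zero] using hO x
    · have h1 : Continuous fun p : M × TotalSpace F₀ E₀ => |b p.1 - b p.2.proj| :=
        ((hb.continuous.comp continuous_fst).sub (hbp.comp continuous_snd)).abs
      refine (isOpen_lt h1 continuous_const).mem_nhds ?_
      simp
  obtain ⟨g, hg, hg0, hKN, hKc, H, hHK, hHK'⟩ := exists_diffeotopy_cutoff (T₀ := T₀) (T₁ := T₁) EG
    hβ hβ_smul hβI hb hb_smul hb0 hbS hN inter_subset_left (fun v hv t ht => (hv.2.2 t ht).2)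
  set K := T₀.cutoffSupport β b g
  have hχI : ∀ (t : unitInterval) (v : TotalSpace F₀ E₀),
      (t : ℝ) * T₀.bundleCutoff β b g v ∈ Icc (0 : ℝ) 1 := fun t v =>
    unitInterval.mul_mem t.2 (bundleCutoff_mem_Icc hβI g v)
  have hHS : ∀ t (x : S), H.toDiffeo t (x : M) = x := by
    intro t x
    by_cases h : (x : M) ∈ T₀.φ '' K
    · obtain ⟨v, hv, hvx⟩ := h
      rw [← hvx, hHK t v hv, hvx, isotopy_coe]
    · exact hHK' t _ h
  refine ⟨H, hHS, ?_, ?_, ?_, ?_⟩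
  · intro t x
    by_cases h : x ∈ T₀.φ '' K
    · obtain ⟨v, hv, rfl⟩ := h
      rw [hHK t v hv, hT₀.apply_isotopy hT₁ (hKN hv).1]
    · rw [hHK' t x h]
  · refine (closure_minimal (t := T₀.φ '' K) ?_ hKc).trans ?_
    · rintro x ⟨t, ht⟩
      by_contra h
      exact ht (hHK' t x h)
    · rintro _ ⟨v, hv, rfl⟩
      exact (hKN hv).2.1 hv.1
  · intro t x
    by_cases h : x ∈ T₀.φ '' K
    · obtain ⟨v, hv, rfl⟩ := h
      rw [hHK t v hv]
      exact ((hKN hv).2.2 _ (hχI t v)).1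
    · rw [hHK' t x h]
      exact mem_of_mem_nhds (hO x)
  · refine (exists_isoOver_of_local (T₀.pushforward (H.toDiffeo 1) (H.map_smul 1) (hHS 1)) T₁ (A ∪ Z)
      (fun x => LinearEquiv.ofBijective (T₀.fiberIsometry T₁ x) (T₀.fiberIsometry_bijective T₁ x))
      (T₀.fiberIsometry_isometry T₁) (T₀.contMDiff_fiberIsometry T₁)
      (T₀.fiberIsometry_smul T₁ EG) ?_).imp fun ψ hψ x hx => ?_
    · intro x
      -- Near `U` the isotopy is stationary at every time, so the value of the cutoff is irrelevant.
      -- Near `Z \ U` the cutoff is `1` and `H_1` is the end of the isotopy. Points outside both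
      -- have a neighbourhood disjoint from `A ∪ Z`.
      by_cases hxU : x ∈ U
      · obtain ⟨c, hc, h⟩ := ψ₀.exists_eventually_isotopy_eq hU_open hxU
        refine ⟨c, hc, h.mono fun y hy _ v hv => ?_⟩
        obtain ⟨h1, h2⟩ := hy ⟨y, v⟩ rfl hv
        refine h1.trans (Eq.symm ?_)
        change H.toDiffeo 1 (T₀.φ ⟨y, v⟩) = T₀.φ ⟨y, v⟩
        by_cases hK : T₀.φ ⟨y, v⟩ ∈ T₀.φ '' K
        · obtain ⟨w, hw, hwv⟩ := hK
          rw [← hwv, hHK 1 w hw, hwv, h2]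
        · exact hHK' 1 _ hK
      by_cases hxZ : x ∈ Z
      · obtain ⟨c, hc, h⟩ := exists_bundleCutoff_eq_one (T₀ := T₀) hb hg hg0
          (hβ1 x ⟨x, ⟨hxZ, hxU⟩, rfl⟩)
        refine ⟨c, hc, h.mono fun y hy _ v hv => ?_⟩
        obtain ⟨h1, h2⟩ := hy ⟨y, v⟩ rfl hv
        change _ = H.toDiffeo 1 (T₀.φ ⟨y, v⟩)
        rw [hHK 1 _ h1, h2, isotopy_φ (hKN h1).1, Icc.coe_one, one_mul, path_time_one]
        rfl
      · have h1 : (A ∪ Z)ᶜ ∈ 𝓝 x := (hA_closed.union hZ_closed).isOpen_compl.mem_nhds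
          (fun h => h.elim (fun h => hxU (hAU h)) hxZ)
        refine ⟨1, one_pos, ?_⟩
        filter_upwards [h1] with y hy hy' using absurd hy' hy
    · rw [hψ]
      ext v
      exact ψ₀.fiberIsometry_eq (hAU hx) v
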